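/- Consider the equation $\rho_t+f(\rho)_x=(D(\rho)\rho_x)_x+g(\rho)$ for densities $\rho$ valued in $[0,1]$; a dot denotes the derivative on $[0,1]$ (one-sided at the end points) and $h:=\dot f$. Assume - (f) $f\in C^1[0,1]$, $f(0)=0$; - (g) $g\in C^0[0,1]$, $g>0$ in $(0,1)$, $g(0)=g(1)=0$; - (D$_{\rm pn}$) $D\in C^1[0,1]$ and, for some $\alpha\in(0,1)$, $D>0$ in $(0,\alpha)$ and $D<0$ in $(\alpha,1)$; - (Dg) $D^+(Dg)(0)<+\infty$ and $D^-(Dg)(1)<+\infty$, where $D^{\pm}q(r):=\limsup_{\rho\to r^\pm}\frac{q(\rho)-q(r)}{\rho-r}\in[-\infty,+\infty]$. **Definitions.** Let $I\subseteq\mathbb R$ be an open interval and $c\in\mathbb R$. A *profile* on $I$ with speed $c$ is a continuous $\varphi:I\to[0,1]$, differentiable a.e., with $D(\varphi)\varphi'\in L^1_{\rm loc}(I)$, such that $D(\varphi)\varphi'$ is the weak derivative of $\int_0^{\varphi}D(s)\,ds$ on $I$ and $$\int_I\big(D(\varphi)\varphi'-f(\varphi)+c\varphi\big)\psi'-g(\varphi)\psi\,d\xi=0\qquad\text{for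 every }\psi\in C_0^\infty(I).$$ A *wavefront* (from $1$ to $0$) with speed $c$ is a non-increasing profile $\varphi$ on $\mathbb R$ with $\varphi(-\infty)=1$, $\varphi(+\infty)=0$. A *strict semi-wavefront to $0$ connecting $\alpha$ to $0$* is a non-increasing profile on some $(a,\infty)$, $a\in\mathbb R$, with $\varphi(a^+)=\alpha$, $\varphi(+\infty)=0$, which cannot be extended to a profile on $\mathbb R$ with the same speed and with values in $[0,\alpha]$. A *strict semi-wavefront from $1$ connecting $1$ to $\alpha$* is a non-increasing profile on some $(-\infty,b)$, $b\in\mathbb R$, with $\varphi(-\infty)=1$, $\varphi(b^-)=\alpha$, which cannot be extended to a profile on $\mathbb R$ with the same speed and with values in $[\alpha,1]$. A profile is *classical* in an open set $J$ if it is differentiable there, $D(\varphi)\varphi'$ is locally absolutely continuous in $J$ and $(D(\varphi)\varphi')'+(c-h(\varphi))\varphi'+g(\varphi)=0$ a.e. in $J$. It is *sharp at $\ell$* on $I$, with $\ell$ reached at $\xi_\ell\in I$, if $\varphi(\xi_\ell)=\ell$, $\varphi$ is classical in $I\setminus\{\xi_\ell\}$, and $\varphi$ is not differentiable at $\xi_\ell$.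 Finally $\varphi'(\xi^\pm)$ denotes the limit of $\varphi'$ at $\xi$ from the right/left, and $$s_-(\alpha,c):=\tfrac12\Big[h(\alpha)-c-\sqrt{(h(\alpha)-c)^2-4\dot D(\alpha)g(\alpha)}\Big].$$ **Theorem.** There are (unique) real numbers $c^*_{p,r}$ and $c^*_{n,l}$ such that strict semi-wavefronts to $0$ connecting $\alpha$ to $0$ with speed $c$ exist if and only if $c\ge c^*_{p,r}$, and strict semi-wavefronts from $1$ connecting $1$ to $\alpha$ with speed $c$ exist if and only if $c\ge c^*_{n,l}$. Let $c^*_{pn}:=\max\{c^*_{p,r},c^*_{n,l}\}$. A wavefront with speed $c$ exists if and only if $c\ge c^*_{pn}$, and for each such $c$ it is unique up to shifts. For every such $c$ the profile $\varphi$ satisfies $\varphi'(\xi)<0$ whenever $\varphi(\xi)\in(0,1)\setminus\{\alpha\}$; there is a unique $\xi_\alpha\in\mathbb R$ with $\varphi(\xi_\alpha)=\alpha$, and $$\varphi'(\xi_\alpha^\pm)=\begin{cases}\dfrac{g(\alpha)}{s_-(\alpha,c)}<0&\text{if }\dot D(\alpha)<0\text{ or }c>h(\alpha),\\[2mm]-\infty&\text{if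 }\dot D(\alpha)=0\text{ and }c\le h(\alpha).\end{cases}$$ Moreover: (i) if $D(0)D(1)<0$, then $\varphi$ is strictly decreasing, and classical in $\mathbb R\setminus\{\xi_\alpha\}$; (ii) if $D(0)D(1)=0$ and $c>c^*_{pn}$, then $\varphi$ is classical in $\mathbb R\setminus\{\xi_\alpha\}$; if in addition $c>\max\{h(0)+D^+g(0),\,h(1)+D^-(-g)(1)\}$, then $\varphi$ is strictly decreasing; (iii) if $D(0)=0$ and $c=c^*_{pn}=c^*_{p,r}>h(0)$, then $\varphi$ is sharp at $0$ on $(\xi_\alpha,\infty)$, with $0$ reached at some $\xi_0>\xi_\alpha$, and $\varphi'(\xi_0^-)=\frac{h(0)-c^*_{p,r}}{\dot D(0)}<0$ if $\dot D(0)>0$, $\varphi'(\xi_0^-)=-\infty$ if $\dot D(0)=0$; if $D(1)=0$ and $c=c^*_{pn}=c^*_{n,l}>h(1)$, then $\varphi$ is sharp at $1$ on $(-\infty,\xi_\alpha)$, with $1$ reached at some $\xi_1<\xi_\alpha$, and $\varphi'(\xi_1^+)=\frac{h(1)-c^*_{n,l}}{\dot D(1)}<0$ if $\dot D(1)>0$,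 $\varphi'(\xi_1^+)=-\infty$ if $\dot D(1)=0$. -/

import Mathlib

open Set Filter Topology MeasureTheory
open scoped ContDiff

noncomputable section

namespace Wavefront

/-! The equation is `ρ_t + f(ρ)_x = (D(ρ) ρ_x)_x + g(ρ)` for densities `ρ` in `[0,1]`.
The coefficients `D`, `f`, `g` are functions `ℝ → ℝ` of which only the values on `[0,1]` matter. -/

/-- The derivative on `[0,1]` of a coefficient (one-sided at the end points). -/
def dot (F : ℝ → ℝ) (s : ℝ) : ℝ := derivWithin F (Icc 0 1) s

/-- Assumption (f) on the convective term. -/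
def CondF (f : ℝ → ℝ) : Prop := ContDiffOn ℝ 1 f (Icc 0 1) ∧ f 0 = 0

/-- Assumption (g) on the monostable reaction term. -/
def CondG (g : ℝ → ℝ) : Prop :=
  ContinuousOn g (Icc 0 1) ∧ (∀ s ∈ Ioo (0 : ℝ) 1, 0 < g s) ∧ g 0 = 0 ∧ g 1 = 0

/-- Assumption (D_pn) on the diffusivity: positive on `(0,α)`, negative on `(α,1)`. -/
def CondDpn (D : ℝ → ℝ) (α : ℝ) : Prop :=
  α ∈ Ioo (0 : ℝ) 1 ∧ ContDiffOn ℝ 1 D (Icc 0 1) ∧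
    (∀ s ∈ Ioo 0 α, 0 < D s) ∧ (∀ s ∈ Ioo α 1, D s < 0)

/-- Right upper Dini derivative `D⁺q(r)`, as an extended real number. -/
def diniUpperRight (q : ℝ → ℝ) (r : ℝ) : EReal :=
  limsup (fun s : ℝ => (((q s - q r) / (s - r) : ℝ) : EReal)) (𝓝[>] r)

/-- Left upper Dini derivative `D⁻q(r)`, as an extended real number. -/
def diniUpperLeft (q : ℝ → ℝ) (r : ℝ) : EReal :=
  limsup (fun s : ℝ => (((q s - q r) / (s - r) : ℝ) : EReal)) (𝓝[<] r)

/-- The Dini bounds on the product `D g` at `0` and at `1`. -/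
def CondDini (D g : ℝ → ℝ) : Prop :=
  diniUpperRight (fun s => D s * g s) 0 < ⊤ ∧ diniUpperLeft (fun s => D s * g s) 1 < ⊤

/-- `φ` is, on the open interval `I`, the profile of a travelling wave with speed `c`:
it is continuous, valued in `[0,1]`, differentiable almost everywhere, `D(φ) φ'` is locally
integrable, and the equation holds in the weak sense.  In the weak sense `D(φ) φ'` stands for the
derivative of `∫₀^φ D` (field `weak_deriv`); this excludes monotone functions with a
singular (Cantor-like) part, whose almost everywhere derivative is not their weak derivative. -/
structure IsTW (D f g : ℝ → ℝ) (I : Set ℝ) (c : ℝ) (φ : ℝ → ℝ) : Prop where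
  continuousOn : ContinuousOn φ I
  mapsTo : MapsTo φ I (Icc 0 1)
  differentiable_ae : ∀ᵐ ξ ∂(volume.restrict I), DifferentiableAt ℝ φ ξ
  locallyIntegrable : LocallyIntegrableOn (fun ξ => D (φ ξ) * deriv φ ξ) I
  weak_deriv : ∀ ψ : ℝ → ℝ, ContDiff ℝ ∞ ψ → HasCompactSupport ψ → tsupport ψ ⊆ I →
    ∫ ξ in I, (∫ s in (0 : ℝ)..φ ξ, D s) * deriv ψ ξ
      = -∫ ξ in I, (D (φ ξ) * deriv φ ξ) * ψ ξ
  weak_eq : ∀ ψ : ℝ → ℝ, ContDiff ℝ ∞ ψ → HasCompactSupport ψ → tsupport ψ ⊆ I →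
    ∫ ξ in I, ((D (φ ξ) * deriv φ ξ - f (φ ξ) + c * φ ξ) * deriv ψ ξ - g (φ ξ) * ψ ξ) = 0

/-- `φ` is the profile of a wavefront with speed `c` from `1` to `0`: a global travelling wave
with a non-increasing profile, `φ(-∞) = 1` and `φ(+∞) = 0`. -/
def IsWavefront (D f g : ℝ → ℝ) (c : ℝ) (φ : ℝ → ℝ) : Prop :=
  IsTW D f g univ c φ ∧ Antitone φ ∧ Tendsto φ atBot (𝓝 1) ∧ Tendsto φ atTop (𝓝 0)

/-- `φ` is, on `(a,∞)`, the profile of a strict semi-wavefront to `0` connecting `α` to `0`, with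
speed `c`.  Strictness: `φ` is not the restriction of a global profile valued in `[0,α]`. -/
def IsStrictSemiTo0 (D f g : ℝ → ℝ) (α c a : ℝ) (φ : ℝ → ℝ) : Prop :=
  IsTW D f g (Ioi a) c φ ∧ AntitoneOn φ (Ioi a) ∧
    Tendsto φ (𝓝[>] a) (𝓝 α) ∧ Tendsto φ atTop (𝓝 0) ∧
    ¬ ∃ χ : ℝ → ℝ, IsTW D f g univ c χ ∧ (∀ ξ, χ ξ ∈ Icc 0 α) ∧ EqOn χ φ (Ioi a)

/-- `φ` is, on `(-∞,b)`, the profile of a strict semi-wavefront from `1` connecting `1` to `α`, with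
speed `c`.  Strictness: `φ` is not the restriction of a global profile valued in `[α,1]`. -/
def IsStrictSemiFrom1 (D f g : ℝ → ℝ) (α c b : ℝ) (φ : ℝ → ℝ) : Prop :=
  IsTW D f g (Iio b) c φ ∧ AntitoneOn φ (Iio b) ∧
    Tendsto φ atBot (𝓝 1) ∧ Tendsto φ (𝓝[<] b) (𝓝 α) ∧
    ¬ ∃ χ : ℝ → ℝ, IsTW D f g univ c χ ∧ (∀ ξ, χ ξ ∈ Icc α 1) ∧ EqOn χ φ (Iio b)

/-- The speeds of the strict semi-wavefronts to `0` connecting `α` to `0`. -/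
def speedsTo0 (D f g : ℝ → ℝ) (α : ℝ) : Set ℝ :=
  {c | ∃ (a : ℝ) (φ : ℝ → ℝ), IsStrictSemiTo0 D f g α c a φ}

/-- The speeds of the strict semi-wavefronts from `1` connecting `1` to `α`. -/
def speedsFrom1 (D f g : ℝ → ℝ) (α : ℝ) : Set ℝ :=
  {c | ∃ (b : ℝ) (φ : ℝ → ℝ), IsStrictSemiFrom1 D f g α c b φ}

/-- The threshold `c*_{p,r}`. -/
def cpr (D f g : ℝ → ℝ) (α : ℝ) : ℝ := sInf (speedsTo0 D f g α)

/-- The threshold `c*_{n,l}`. -/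
def cnl (D f g : ℝ → ℝ) (α : ℝ) : ℝ := sInf (speedsFrom1 D f g α)

/-- The threshold `c*_{pn}`. -/
def cpn (D f g : ℝ → ℝ) (α : ℝ) : ℝ := max (cpr D f g α) (cnl D f g α)

/-- The quantity `s_-(γ,c)`. -/
def sMinus (D f g : ℝ → ℝ) (γ c : ℝ) : ℝ :=
  (1 / 2) * (dot f γ - c - Real.sqrt ((dot f γ - c) ^ 2 - 4 * dot D γ * g γ))

/-- `φ` is a classical solution in the open set `J`: it is differentiable, `D(φ) φ'` is (locally)
absolutely continuous and `(D(φ) φ')' + (c - h(φ)) φ' + g(φ) = 0` almost everywhere in `J`. -/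
def IsClassicalOn (D f g : ℝ → ℝ) (c : ℝ) (φ : ℝ → ℝ) (J : Set ℝ) : Prop :=
  (∀ ξ ∈ J, DifferentiableAt ℝ φ ξ) ∧
    (∀ a b : ℝ, a ≤ b → Icc a b ⊆ J →
      AbsolutelyContinuousOnInterval (fun ξ => D (φ ξ) * deriv φ ξ) a b) ∧
    ∀ᵐ ξ ∂(volume.restrict J), deriv (fun η => D (φ η) * deriv φ η) ξ
      + (c - dot f (φ ξ)) * deriv φ ξ + g (φ ξ) = 0

/-- The profile `φ` on the open interval `I` is sharp at the value `l`, reached at `ξl`. -/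
def IsSharpAt (D f g : ℝ → ℝ) (c : ℝ) (φ : ℝ → ℝ) (I : Set ℝ) (l ξl : ℝ) : Prop :=
  ξl ∈ I ∧ φ ξl = l ∧ IsClassicalOn D f g c φ (I \ {ξl}) ∧ ¬ DifferentiableAt ℝ φ ξl

end Wavefront

end

/-! The profile is studied through its flux `Z = D(φ) φ'`.  The lemma of du Bois-Reymond turns the weak
formulation into two classical equations, `(∫₀^φ D)' = Z` and `(Z - f(φ) + c φ)' = -g(φ)` with a
continuous `Z` (`IsTW.exists_strong`, `Strong.isTW`).  Where `φ` takes the value `α` the primitive of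
`D` has its maximum, so `Z` vanishes there.

On the side of the equilibrium `0`, where `D > 0`, put `w(φ) = -Z`.  The profile equation becomes the
singular first-order problem `w' = c - h - D g / w` on `(0,α)`, with `w > 0` and `w(α) = 0`.  Comparison
backward from `α` shows that for each `c` there is exactly one solution (`exists_isSol`, `IsSol.eq`),
non-increasing and Lipschitz in `c`; the speeds with `w(0⁺) = 0` form a closed half-line
(`exists_threshold`), and this half-line is the set of speeds of the semi-wavefronts.  Indeed, for any
profile that starts at `α`, the defect `d = w(φ) + Z` obeys the linear equation
`d' = -(g(φ) / w(φ)) d`; hence `w(φ) ≤ -Z`, which forces `w(0⁺) = 0` (`Below.vanishAt`), and `d = 0` if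
the flux vanishes at the start (`Below.flux_eq`).  Conversely, if `w(0⁺) = 0`, the time
`G(s) = ∫_s^α D / w` is finite and its inverse is a half profile (`Data.exists_half`).  It is strict
because a continuation with values in `[0,α]`, read backward, would be a profile for `-c` and `-f`, and
the solutions for `(c,h)` and `(-c,-h)` cannot both vanish at `0` (`Below.not_extends`).

The change of variables `ρ ↦ 1 - ρ`, `ξ ↦ -ξ` exchanges the two equilibria and keeps the speed, so the
half between `1` and `α` is of the same kind.  Both halves have zero flux at `α`, so they can be glued
(`Half.wave`); this gives existence exactly for the speeds above both thresholds.  A wavefront solves `φ' = -w(φ) / D(φ)` right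
of `α`, hence `G(φ(ξ))` is the time since the passage through `α`, which gives uniqueness up to
translation.

The remaining properties are read off from `w`.  At `α` the multiples of `D` are lower and upper
solutions and determine the limit of `D / w` (`Data.tendsto_D_div_w`).  At `0` with `D(0) = 0`, the
solution lies either below or above a small multiple of `D`: above the threshold `w / D → 0`, and the
profile is `C¹` (`Data.eventually_le_mul_D`); at the threshold `w ≥ ε D`, because otherwise slightly
smaller speeds would be admissible too, and the profile reaches `0` in finite time with a corner or a
vertical tangent (`Data.exists_mul_D_lt`, `Wave.sharp`).  A Dini bound on `g` at `0` improves `w / D → 0`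
to `w = O(s D)`, which keeps the profile from reaching `0` (`Data.eventually_le_mul_mul_D`). -/

namespace Wavefront

/-! ### The singular first-order problem: comparison and existence -/

/-- A function whose derivative is nonnegative wherever the function is positive cannot decrease
from a positive value. -/
lemma le_of_deriv_nonneg_of_pos {d d' : ℝ → ℝ} {x b : ℝ} (hxb : x ≤ b)
    (hc : ContinuousOn d (Icc x b)) (hd : ∀ s ∈ Ioo x b, HasDerivAt d (d' s) s)
    (h : ∀ s ∈ Ioo x b, 0 < d s → 0 ≤ d' s) (hx : 0 < d x) : d x ≤ d b := by
  by_contra! hlt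
  obtain ⟨m, hm1, hm2⟩ : ∃ m, max (d b) 0 < m ∧ m < d x := exists_between (max_lt hlt hx)
  have hm0 : 0 < m := (le_max_right _ _).trans_lt hm1
  have hbm : d b < m := (le_max_left _ _).trans_lt hm1
  set S := Icc x b ∩ d ⁻¹' Iic m with hS
  have hSc : IsClosed S := hc.preimage_isClosed_of_isClosed isClosed_Icc isClosed_Iic
  have hSne : S.Nonempty := ⟨b, ⟨hxb, le_rfl⟩, hbm.le⟩
  have hSb : BddBelow S := ⟨x, fun t ht => ht.1.1⟩
  have hy : sInf S ∈ S := hSc.csInf_mem hSne hSb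
  set y := sInf S with hydef
  have hpos : ∀ t ∈ Ioo x y, m < d t := by
    intro t ht
    by_contra! hle
    exact absurd (csInf_le hSb ⟨⟨ht.1.le, ht.2.le.trans hy.1.2⟩, hle⟩) (not_le.2 ht.2)
  have hsub : Icc x y ⊆ Icc x b := Icc_subset_Icc_right hy.1.2
  have hmono : MonotoneOn d (Icc x y) := by
    apply monotoneOn_of_deriv_nonneg (convex_Icc x y) (hc.mono hsub)
    · rw [interior_Icc]
      intro t ht
      exact (hd t ⟨ht.1, ht.2.trans_le hy.1.2⟩).differentiableAt.differentiableWithinAt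
    · rw [interior_Icc]
      intro t ht
      have ht' : t ∈ Ioo x b := ⟨ht.1, ht.2.trans_le hy.1.2⟩
      rw [(hd t ht').deriv]
      exact h t ht' (hm0.trans (hpos t ht))
  have h1 := hmono (left_mem_Icc.2 hy.1.1) (right_mem_Icc.2 hy.1.1) hy.1.1
  have h2 : d y ≤ m := hy.2
  linarith

/-- Comparison for `w' = k - q / w`: the excess of a function with `w' ≥ k - q / w` over a positive
function with `v' ≤ k - q / v` cannot decrease as long as it is positive. -/
lemma sub_le_sub_of_comparison {q k w w' v v' : ℝ → ℝ} {x b : ℝ} (hxb : x ≤ b)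
    (hq : ∀ s ∈ Ioo x b, 0 ≤ q s) (hwc : ContinuousOn w (Icc x b)) (hvc : ContinuousOn v (Icc x b))
    (hv0 : ∀ s ∈ Ioo x b, 0 < v s)
    (hw : ∀ s ∈ Ioo x b, HasDerivAt w (w' s) s) (hv : ∀ s ∈ Ioo x b, HasDerivAt v (v' s) s)
    (hw' : ∀ s ∈ Ioo x b, 0 < w s → k s - q s / w s ≤ w' s)
    (hv' : ∀ s ∈ Ioo x b, v' s ≤ k s - q s / v s)
    (hx : v x < w x) : w x - v x ≤ w b - v b := by
  refine le_of_deriv_nonneg_of_pos (d := fun s => w s - v s) (d' := fun s => w' s - v' s) hxb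
    (hwc.sub hvc) (fun s hs => (hw s hs).sub (hv s hs)) ?_ (by simpa using hx)
  intro s hs hds
  have hvw : v s < w s := by simpa using hds
  have h1 := hv0 s hs
  have h2 : q s / w s ≤ q s / v s := div_le_div_of_nonneg_left (hq s hs) h1 hvw.le
  have h3 := hw' s hs (h1.trans hvw)
  have h4 := hv' s hs
  show 0 ≤ w' s - v' s
  linarith

lemma le_of_comparison {q k w w' v v' : ℝ → ℝ} {x b : ℝ} (hxb : x ≤ b)
    (hq : ∀ s ∈ Ioo x b, 0 ≤ q s) (hwc : ContinuousOn w (Icc x b)) (hvc : ContinuousOn v (Icc x b))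
    (hv0 : ∀ s ∈ Ioo x b, 0 < v s)
    (hw : ∀ s ∈ Ioo x b, HasDerivAt w (w' s) s) (hv : ∀ s ∈ Ioo x b, HasDerivAt v (v' s) s)
    (hw' : ∀ s ∈ Ioo x b, 0 < w s → k s - q s / w s ≤ w' s)
    (hv' : ∀ s ∈ Ioo x b, v' s ≤ k s - q s / v s)
    (hb : w b ≤ v b) : w x ≤ v x := by
  by_contra! hlt
  have := sub_le_sub_of_comparison hxb hq hwc hvc hv0 hw hv hw' hv' hlt
  linarith

/-- The positive solution on `(0,α)` of `w' = c - h - q / w` that vanishes at `α`.  Along a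
decreasing profile `φ` with values in `(0,α)` one has `w(φ) = -D(φ) φ'`. -/
structure IsSol (q h : ℝ → ℝ) (α c : ℝ) (w : ℝ → ℝ) : Prop where
  cont : ContinuousOn w (Ioc 0 α)
  zero : w α = 0
  pos : ∀ s ∈ Ioo 0 α, 0 < w s
  deriv : ∀ s ∈ Ioo 0 α, HasDerivAt w (c - h s - q s / w s) s

/-- The conditions on the coefficients of `w' = c - h - q / w`. -/
structure Coef (q h : ℝ → ℝ) (α : ℝ) : Prop where
  pos : 0 < α
  contq : ContinuousOn q (Icc 0 α)
  conth : ContinuousOn h (Icc 0 α)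
  qpos : ∀ s ∈ Ioo 0 α, 0 < q s
  q0 : q 0 = 0
  qα : q α = 0

lemma Coef.nonneg {q h : ℝ → ℝ} {α : ℝ} (H : Coef q h α) : ∀ s ∈ Icc 0 α, 0 ≤ q s := by
  intro s hs
  rcases eq_or_lt_of_le hs.1 with h1 | h1
  · rw [← h1, H.q0]
  rcases eq_or_lt_of_le hs.2 with h2 | h2
  · rw [h2, H.qα]
  exact (H.qpos s ⟨h1, h2⟩).le

/-- Adding `C ε` to `q` with `C` larger than `c - h` keeps the solution above its final value `ε`,
so that the regularised equation is never singular. -/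
lemma exists_regularised {q h : ℝ → ℝ} {α : ℝ} (H : Coef q h α) (c : ℝ) :
    ∃ C > 0, (∀ s ∈ Icc 0 α, c - h s ≤ C) ∧ ∀ ε > 0, ∃ u : ℝ → ℝ, ContinuousOn u (Icc 0 α) ∧
      u α = ε ∧ (∀ s ∈ Icc 0 α, ε ≤ u s) ∧
      ∀ s ∈ Ioo 0 α, HasDerivAt u (c - h s - (q s + C * ε) / u s) s := by
  obtain ⟨A, hA⟩ := isCompact_Icc.exists_bound_of_continuousOn
    ((continuousOn_const (c := c)).sub H.conth)
  obtain ⟨B, hB⟩ := isCompact_Icc.exists_bound_of_continuousOn H.contq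
  have h0m : (0 : ℝ) ∈ Icc 0 α := ⟨le_rfl, H.pos.le⟩
  have hαm : α ∈ Icc 0 α := ⟨H.pos.le, le_rfl⟩
  have hA0 : 0 ≤ A := (norm_nonneg _).trans (hA 0 h0m)
  have hB0 : 0 ≤ B := (norm_nonneg _).trans (hB 0 h0m)
  have hq0 := H.nonneg
  have hAC : ∀ s ∈ Icc 0 α, c - h s ≤ A + 1 := fun s hs => by
    have h1 : c - h s ≤ A := (le_abs_self _).trans (hA s hs)
    linarith
  refine ⟨A + 1, by linarith, hAC, ?_⟩
  intro ε hε
  set C := A + 1 with hC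
  have hC0 : 0 < C := by rw [hC]; linarith
  set F : ℝ → ℝ → ℝ := fun t x => c - h t - (q t + C * ε) / max x ε with hF
  have hqb : ∀ t ∈ Icc 0 α, 0 ≤ q t + C * ε ∧ q t + C * ε ≤ B + C * ε := fun t ht =>
    ⟨add_nonneg (hq0 t ht) (by positivity), by
      have := (le_abs_self _).trans (hB t ht); linarith⟩
  set L : ℝ := A + (B + C * ε) / ε
  have hL : 0 ≤ L := by positivity
  set K : ℝ := (B + C * ε) / ε ^ 2
  have hK : 0 ≤ K := by positivity
  have hPL : IsPicardLindelof F (tmin := 0) (tmax := α) ⟨α, hαm⟩ ε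
      (Real.toNNReal (L * α)) 0 (Real.toNNReal L) (Real.toNNReal K) := by
    refine ⟨?_, ?_, ?_, ?_⟩
    · intro t ht
      apply LipschitzWith.lipschitzOnWith
      apply LipschitzWith.of_dist_le_mul
      intro x y
      rw [Real.coe_toNNReal _ hK, Real.dist_eq, Real.dist_eq]
      have hx : ε ≤ max x ε := le_max_right _ _
      have hy : ε ≤ max y ε := le_max_right _ _
      have hx0 := hε.trans_le hx
      have hy0 := hε.trans_le hy
      have e1 : F t x - F t y = (q t + C * ε) * (max x ε - max y ε) / (max x ε * max y ε) := by
        simp only [hF]; field_simp; ring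
      rw [e1, abs_div, abs_mul, abs_of_nonneg (hqb t ht).1, abs_of_pos (mul_pos hx0 hy0)]
      have e2 : |max x ε - max y ε| ≤ |x - y| := abs_max_sub_max_le_abs x y ε
      have e3 : ε ^ 2 ≤ max x ε * max y ε := by rw [sq]; exact mul_le_mul hx hy hε.le hx0.le
      calc (q t + C * ε) * |max x ε - max y ε| / (max x ε * max y ε)
          ≤ (B + C * ε) * |x - y| / ε ^ 2 := by
            apply div_le_div₀ _ _ (by positivity) e3
            · positivity
            · exact mul_le_mul (hqb t ht).2 e2 (abs_nonneg _) (by positivity)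
        _ = K * |x - y| := by simp only [K]; ring
    · intro x _
      simp only [hF]
      exact ((continuousOn_const).sub H.conth).sub ((H.contq.add continuousOn_const).div_const _)
    · intro t ht x _
      rw [Real.coe_toNNReal _ hL, Real.norm_eq_abs]
      have hx : ε ≤ max x ε := le_max_right _ _
      have hx0 := hε.trans_le hx
      have e1 : |c - h t| ≤ A := hA t ht
      have e2 : (q t + C * ε) / max x ε ≤ (B + C * ε) / ε :=
        div_le_div₀ (by positivity) (hqb t ht).2 hε hx
      have e3 : 0 ≤ (q t + C * ε) / max x ε := div_nonneg (hqb t ht).1 hx0.le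
      simp only [hF, L]
      rw [abs_le] at e1 ⊢
      constructor <;> linarith [e1.1, e1.2]
    · rw [Real.coe_toNNReal _ hL, Real.coe_toNNReal _ (mul_nonneg hL H.pos.le)]
      simp [H.pos.le]
  obtain ⟨u, hu1, hu2⟩ := hPL.exists_eq_forall_mem_Icc_hasDerivWithinAt₀
  have huc : ContinuousOn u (Icc 0 α) := fun t ht => (hu2 t ht).continuousWithinAt
  have hud : ∀ s ∈ Ioo 0 α, HasDerivAt u (F s (u s)) s := fun s hs =>
    (hu2 s ⟨hs.1.le, hs.2.le⟩).hasDerivAt (Icc_mem_nhds hs.1 hs.2)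
  have hge : ∀ s ∈ Icc 0 α, ε ≤ u s := by
    intro s hs
    by_contra! hlt
    have := le_of_deriv_nonneg_of_pos (d := fun t => ε - u t) (d' := fun t => - F t (u t)) hs.2
      (continuousOn_const.sub (huc.mono (Icc_subset_Icc_left hs.1)))
      (fun t ht => by
        simpa using (hud t ⟨hs.1.trans_lt ht.1, ht.2⟩).const_sub ε) ?_ (by simpa using hlt)
    · rw [show u α = ε from hu1] at this
      linarith
    · intro t ht hpos
      have htm : t ∈ Icc 0 α := ⟨hs.1.trans ht.1.le, ht.2.le⟩
      have h1 : max (u t) ε = ε := max_eq_right (by linarith)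
      have h2 : C ≤ (q t + C * ε) / ε := by
        rw [le_div_iff₀ hε]; linarith [hq0 t htm]
      simp only [hF, h1]
      linarith [hAC t htm]
  refine ⟨u, huc, hu1, hge, fun s hs => ?_⟩
  have := hud s hs
  simp only [hF] at this
  rwa [max_eq_left (hge s ⟨hs.1.le, hs.2.le⟩)] at this

/-- The solution is the decreasing limit, as `ε → 0`, of the solutions of the regularised equations;
a lower bound uniform in `ε` on compact subsets of `(0,α)` keeps the limit positive. -/
lemma exists_isSol {q h : ℝ → ℝ} {α : ℝ} (H : Coef q h α) (c : ℝ) : ∃ w, IsSol q h α c w := by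
  obtain ⟨C, hC, hAC, hreg⟩ := exists_regularised H c
  obtain ⟨B, hB⟩ := isCompact_Icc.exists_bound_of_continuousOn H.contq
  have hB' : ∀ s ∈ Icc 0 α, q s ≤ B := fun s hs => (le_abs_self _).trans (hB s hs)
  set e : ℕ → ℝ := fun n => 1 / ((n : ℝ) + 1) with he
  have he0 : ∀ n, 0 < e n := fun n => Nat.one_div_pos_of_nat
  have hea : Antitone e := fun m n hmn => Nat.one_div_le_one_div hmn
  have het : Tendsto e atTop (𝓝 0) := tendsto_one_div_add_atTop_nhds_zero_nat
  choose u huc huα hue hud using fun n => hreg (e n) (he0 n)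
  have hu0 : ∀ n, ∀ s ∈ Icc 0 α, 0 < u n s := fun n s hs => (he0 n).trans_le (hue n s hs)
  have hsubIcc : ∀ {x b s : ℝ}, 0 ≤ x → b ≤ α → s ∈ Ioo x b → s ∈ Ioo 0 α :=
    fun hx hb hs => ⟨hx.trans_lt hs.1, hs.2.trans_le hb⟩
  -- the approximations decrease with `n`
  have hanti : ∀ s ∈ Icc 0 α, Antitone fun n => u n s := by
    intro s hs m n hmn
    refine le_of_comparison (q := fun s => q s + C * e n) (k := fun s => c - h s) hs.2
      (fun t ht => ?_) ((huc n).mono (Icc_subset_Icc_left hs.1))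
      ((huc m).mono (Icc_subset_Icc_left hs.1)) (fun t ht => ?_)
      (fun t ht => hud n t (hsubIcc hs.1 le_rfl ht)) (fun t ht => hud m t (hsubIcc hs.1 le_rfl ht))
      (fun t ht _ => le_rfl) (fun t ht => ?_) ?_
    · have := H.nonneg t (Ioo_subset_Icc_self (hsubIcc hs.1 le_rfl ht))
      have := he0 n
      positivity
    · exact hu0 m t (Ioo_subset_Icc_self (hsubIcc hs.1 le_rfl ht))
    · have h1 := hu0 m t (Ioo_subset_Icc_self (hsubIcc hs.1 le_rfl ht))
      have h2 : (q t + C * e n) / u m t ≤ (q t + C * e m) / u m t := by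
        have := hea hmn
        gcongr
      linarith
    · rw [huα, huα]; exact hea hmn
  have hlim : ∀ s, ∃ l, s ∈ Icc 0 α → Tendsto (fun n => u n s) atTop (𝓝 l) := by
    intro s
    by_cases hs : s ∈ Icc 0 α
    · refine ⟨⨅ n, u n s, fun _ => tendsto_atTop_ciInf (hanti s hs) ⟨0, ?_⟩⟩
      rintro _ ⟨n, rfl⟩
      exact (hu0 n s hs).le
    · exact ⟨0, fun h => absurd h hs⟩
  choose w hw using hlim
  have hwle : ∀ n, ∀ s ∈ Icc 0 α, w s ≤ u n s := fun n s hs =>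
    (hanti s hs).le_of_tendsto (hw s hs) n
  have hw0 : ∀ s ∈ Icc 0 α, 0 ≤ w s := fun s hs =>
    ge_of_tendsto' (hw s hs) fun n => (hu0 n s hs).le
  have hαm : α ∈ Icc 0 α := ⟨H.pos.le, le_rfl⟩
  have hwα : w α = 0 := by
    refine tendsto_nhds_unique (hw α hαm) ?_
    simpa only [huα] using het
  -- lower bound, uniform in `n`, by a small multiple of `x₃ - s`
  have hlow : ∀ x₁ x₂, 0 < x₁ → x₁ < x₂ → x₂ < α → ∃ m > 0, ∀ s ∈ Icc x₁ x₂, ∀ n, m ≤ u n s := by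
    intro x₁ x₂ h1 h12 h2
    obtain ⟨x₃, h23, h3⟩ := exists_between h2
    have hsub : Icc x₁ x₃ ⊆ Ioo 0 α := fun s hs => ⟨h1.trans_le hs.1, hs.2.trans_lt h3⟩
    obtain ⟨s₀, hs₀, hmin⟩ := isCompact_Icc.exists_isMinOn (nonempty_Icc.2 (h12.trans h23).le)
      (H.contq.mono (hsub.trans Ioo_subset_Icc_self))
    obtain ⟨A, hA⟩ := isCompact_Icc.exists_bound_of_continuousOn
      ((continuousOn_const (c := c)).sub H.conth)
    have hA' : ∀ s ∈ Icc 0 α, -A ≤ c - h s ∧ c - h s ≤ A := fun s hs => abs_le.1 (hA s hs)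
    have hA0 : 0 ≤ A := (norm_nonneg _).trans (hA _ hαm)
    have hm0 : 0 < q s₀ := H.qpos _ (hsub hs₀)
    obtain ⟨δ, hδ0, hδ⟩ : ∃ δ > 0, δ * (A + 1) * α ≤ q s₀ ∧ δ ≤ 1 := by
      refine ⟨min 1 (q s₀ / ((A + 1) * α)), lt_min one_pos ?_, ?_, min_le_left _ _⟩
      · have := H.pos; positivity
      · have h5 : 0 < (A + 1) * α := by have := H.pos; positivity
        calc min 1 (q s₀ / ((A + 1) * α)) * (A + 1) * α
            ≤ (q s₀ / ((A + 1) * α)) * ((A + 1) * α) := by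
              rw [mul_assoc]; gcongr; exact min_le_right _ _
          _ = q s₀ := div_mul_cancel₀ _ h5.ne'
    refine ⟨δ * (x₃ - x₂), mul_pos hδ0 (by linarith), fun s hs n => ?_⟩
    have hss : s ∈ Icc x₁ x₃ := ⟨hs.1, hs.2.trans h23.le⟩
    have hcomp : δ * (x₃ - s) ≤ u n s := by
      have hIoo : ∀ t ∈ Ioo s x₃, t ∈ Icc x₁ x₃ := fun t ht => ⟨hs.1.trans ht.1.le, ht.2.le⟩
      refine le_of_comparison (q := q) (k := fun s => c - h s) (w := fun t => δ * (x₃ - t))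
        (w' := fun _ => -δ) hss.2
        (fun t ht => (H.qpos t (hsub (hIoo t ht))).le) (by fun_prop)
        ((huc n).mono (fun t ht => Ioo_subset_Icc_self (hsub ⟨hs.1.trans ht.1, ht.2⟩)))
        (fun t ht => hu0 n t (Ioo_subset_Icc_self (hsub (hIoo t ht))))
        (fun t ht => ?_) (fun t ht => hud n t (hsub (hIoo t ht))) (fun t ht hpos => ?_)
        (fun t ht => ?_) ?_
      · simpa using ((hasDerivAt_id t).const_sub x₃).const_mul δ
      · have ht' := hsub (hIoo t ht)
        have h5 : q s₀ ≤ q t := hmin (hIoo t ht)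
        have h6 : A + 1 ≤ q t / (δ * (x₃ - t)) := by
          rw [le_div_iff₀ hpos]
          have : x₃ - t ≤ α := by linarith [ht'.1]
          calc (A + 1) * (δ * (x₃ - t)) ≤ (A + 1) * (δ * α) := by gcongr
            _ = δ * (A + 1) * α := by ring
            _ ≤ q t := hδ.1.trans h5
        have h7 := (hA' t (Ioo_subset_Icc_self ht')).2
        linarith [hδ.2]
      · have h5 := hu0 n t (Ioo_subset_Icc_self (hsub (hIoo t ht)))
        have h6 : q t / u n t ≤ (q t + C * e n) / u n t := by
          have := he0 n
          gcongr
          have : 0 < C * e n := by positivity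
          linarith
        linarith
      · simpa using (hu0 n x₃ ⟨by linarith, h3.le⟩).le
    calc δ * (x₃ - x₂) ≤ δ * (x₃ - s) := by gcongr; exact hs.2
      _ ≤ _ := hcomp
  have hwpos : ∀ s ∈ Ioo 0 α, 0 < w s := by
    intro s hs
    obtain ⟨x₁, h1⟩ := exists_between hs.1
    obtain ⟨m, hm, hmu⟩ := hlow x₁ s h1.1 h1.2 hs.2
    exact hm.trans_le (ge_of_tendsto' (hw s ⟨hs.1.le, hs.2.le⟩) fun n => hmu s ⟨h1.2.le, le_rfl⟩ n)
  -- the equation passes to the limit in integrated form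
  have hderiv : ∀ s ∈ Ioo 0 α, HasDerivAt w (c - h s - q s / w s) s := by
    intro s hs
    obtain ⟨x₁, h1, h1s⟩ := exists_between hs.1
    obtain ⟨x₂, hs2, h2⟩ := exists_between hs.2
    obtain ⟨m, hm, hmu⟩ := hlow x₁ x₂ h1 (h1s.trans hs2) h2
    have hsub : Icc x₁ x₂ ⊆ Ioo 0 α := fun s hs => ⟨h1.trans_le hs.1, hs.2.trans_lt h2⟩
    have hsub' : Icc x₁ x₂ ⊆ Icc 0 α := hsub.trans Ioo_subset_Icc_self
    set Fn : ℕ → ℝ → ℝ := fun n t => c - h t - (q t + C * e n) / u n t with hFn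
    set Fl : ℝ → ℝ := fun t => c - h t - q t / w t with hFl
    obtain ⟨A, hA⟩ := isCompact_Icc.exists_bound_of_continuousOn
      ((continuousOn_const (c := c)).sub H.conth)
    have hcontFn : ∀ n, ContinuousOn (Fn n) (Icc x₁ x₂) := fun n =>
      (continuousOn_const.sub (H.conth.mono hsub')).sub
        (((H.contq.mono hsub').add continuousOn_const).div ((huc n).mono hsub')
          fun t ht => (hu0 n t (hsub' ht)).ne')
    have hptw : ∀ t ∈ Icc x₁ x₂, Tendsto (fun n => Fn n t) atTop (𝓝 (Fl t)) := by
      intro t ht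
      have h5 : Tendsto (fun n => q t + C * e n) atTop (𝓝 (q t + C * 0)) :=
        tendsto_const_nhds.add (het.const_mul C)
      rw [mul_zero, add_zero] at h5
      exact tendsto_const_nhds.sub (h5.div (hw t (hsub' ht)) (hwpos t (hsub ht)).ne')
    have hbound : ∀ n, ∀ t ∈ Icc x₁ x₂, ‖Fn n t‖ ≤ A + (B + C) / m := by
      intro n t ht
      have h5 : |c - h t| ≤ A := hA t (hsub' ht)
      have h6 : 0 ≤ q t + C * e n := by
        have := H.nonneg t (hsub' ht); have := he0 n; positivity
      have h7 : e n ≤ 1 := by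
        have := hea (Nat.zero_le n); simpa [he] using this
      have h8 : (q t + C * e n) / u n t ≤ (B + C) / m := by
        refine div_le_div₀ ?_ ?_ hm (hmu t ht n)
        · have := (H.nonneg t (hsub' ht)).trans (hB' t (hsub' ht)); positivity
        · have := hB' t (hsub' ht)
          nlinarith
      have h9 : 0 ≤ (q t + C * e n) / u n t := div_nonneg h6 (hu0 n t (hsub' ht)).le
      rw [Real.norm_eq_abs, abs_le]
      rw [abs_le] at h5
      simp only [hFn]
      constructor <;> linarith [h5.1, h5.2]
    have hint : ∀ t ∈ Icc x₁ x₂, w t = w x₁ + ∫ r in x₁..t, Fl r := by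
      intro t ht
      have hsub2 : Icc x₁ t ⊆ Icc x₁ x₂ := Icc_subset_Icc_right ht.2
      have hn : ∀ n, ∫ r in x₁..t, Fn n r = u n t - u n x₁ := by
        intro n
        refine intervalIntegral.integral_eq_sub_of_hasDerivAt (fun r hr => ?_) ?_
        · rw [uIcc_of_le ht.1] at hr
          exact hud n r (hsub (hsub2 hr))
        · apply ContinuousOn.intervalIntegrable
          rw [uIcc_of_le ht.1]
          exact (hcontFn n).mono hsub2
      have hl1 : Tendsto (fun n => ∫ r in x₁..t, Fn n r) atTop (𝓝 (∫ r in x₁..t, Fl r)) := by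
        refine intervalIntegral.tendsto_integral_filter_of_dominated_convergence
          (fun _ => A + (B + C) / m) (Eventually.of_forall fun n => ?_)
          (Eventually.of_forall fun n => ?_) (by simp) ?_
        · rw [uIoc_of_le ht.1]
          exact ((hcontFn n).mono (Ioc_subset_Icc_self.trans hsub2)).aestronglyMeasurable
            measurableSet_Ioc
        · refine Eventually.of_forall fun r hr => hbound n r ?_
          rw [uIoc_of_le ht.1] at hr
          exact hsub2 (Ioc_subset_Icc_self hr)
        · refine Eventually.of_forall fun r hr => hptw r ?_
          rw [uIoc_of_le ht.1] at hr
          exact hsub2 (Ioc_subset_Icc_self hr)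
      have hl2 : Tendsto (fun n => u n t - u n x₁) atTop (𝓝 (w t - w x₁)) :=
        (hw t (hsub' ht)).sub (hw x₁ (hsub' ⟨le_rfl, (h1s.trans hs2).le⟩))
      simp only [hn] at hl1
      have := tendsto_nhds_unique hl1 hl2
      linarith
    have hFlb : ∀ t ∈ Icc x₁ x₂, ‖Fl t‖ ≤ A + (B + C) / m := fun t ht =>
      le_of_tendsto' (hptw t ht).norm fun n => hbound n t ht
    have hFlm : AEStronglyMeasurable Fl (volume.restrict (Icc x₁ x₂)) := by
      refine aestronglyMeasurable_of_tendsto_ae atTop (f := Fn) (fun n =>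
        (hcontFn n).aestronglyMeasurable measurableSet_Icc) ?_
      filter_upwards [ae_restrict_mem measurableSet_Icc] with t ht using hptw t ht
    have hFli : IntegrableOn Fl (Icc x₁ x₂) := by
      refine Integrable.mono' (integrable_const (A + (B + C) / m)) hFlm ?_
      filter_upwards [ae_restrict_mem measurableSet_Icc] with t ht using hFlb t ht
    have hwc : ContinuousOn w (Icc x₁ x₂) := by
      have : ContinuousOn (fun t => w x₁ + ∫ r in x₁..t, Fl r) (Icc x₁ x₂) :=
        continuousOn_const.add (intervalIntegral.continuousOn_primitive_interval
          (by rwa [uIcc_of_le (h1s.trans hs2).le]) |>.mono (by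
            rw [uIcc_of_le (h1s.trans hs2).le]))
      exact this.congr hint
    have hFlc : ContinuousOn Fl (Icc x₁ x₂) :=
      (continuousOn_const.sub (H.conth.mono hsub')).sub
        ((H.contq.mono hsub').div hwc fun t ht => (hwpos t (hsub ht)).ne')
    have hnhd : Icc x₁ x₂ ∈ 𝓝 s := Icc_mem_nhds h1s hs2
    have h5 : HasDerivAt (fun t => w x₁ + ∫ r in x₁..t, Fl r) (Fl s) s := by
      refine HasDerivAt.const_add _ (intervalIntegral.integral_hasDerivAt_right ?_ ?_ ?_)
      · apply ContinuousOn.intervalIntegrable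
        rw [uIcc_of_le h1s.le]
        exact hFlc.mono (Icc_subset_Icc_right hs2.le)
      · exact hFlc.stronglyMeasurableAtFilter_nhdsWithin measurableSet_Icc s |>.filter_mono
          (by rw [nhdsWithin_eq_nhds.2 hnhd])
      · exact hFlc.continuousAt hnhd
    exact h5.congr_of_eventuallyEq (by filter_upwards [hnhd] with t ht using hint t ht)
  refine ⟨w, ?_, hwα, hwpos, hderiv⟩
  intro s hs
  rcases eq_or_lt_of_le hs.2 with h2 | h2
  · subst h2
    -- at `α` the limit lies between `0` and `u n`, and `u n α` is as small as desired
    rw [ContinuousWithinAt, hwα]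
    rw [Metric.tendsto_nhdsWithin_nhds]
    intro ε hε
    obtain ⟨n, hn⟩ := (het.eventually (gt_mem_nhds hε)).exists
    have hc := huc n s hαm
    have : ∀ᶠ t in 𝓝[Icc 0 s] s, u n t < ε := hc.eventually (gt_mem_nhds (by rwa [huα]))
    obtain ⟨δ, hδ, hδ'⟩ := Metric.mem_nhdsWithin_iff.1 this
    refine ⟨δ, hδ, fun {t} ht htd => ?_⟩
    have ht' : t ∈ Icc 0 s := ⟨ht.1.le, ht.2⟩
    rw [Real.dist_eq, sub_zero, abs_of_nonneg (hw0 t ht')]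
    exact (hwle n t ht').trans_lt (hδ' ⟨htd, ht'⟩)
  · exact (hderiv s ⟨hs.1, h2⟩).continuousAt.continuousWithinAt

/-! ### The threshold speed of the singular first-order problem -/

section Threshold

variable {q h : ℝ → ℝ} {α c c₁ c₂ : ℝ} {w w₁ w₂ : ℝ → ℝ}

lemma IsSol.contOn (hw : IsSol q h α c w) {x b : ℝ} (hx : 0 < x) (hb : b ≤ α) :
    ContinuousOn w (Icc x b) :=
  hw.cont.mono fun _ ht => ⟨hx.trans_le ht.1, ht.2.trans hb⟩

/-- The solution is non-increasing in the speed. -/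
lemma IsSol.anti (H : Coef q h α) (hw₁ : IsSol q h α c₁ w₁) (hw₂ : IsSol q h α c₂ w₂)
    (hc : c₁ ≤ c₂) {s : ℝ} (hs : s ∈ Ioc 0 α) : w₂ s ≤ w₁ s := by
  have hsub : ∀ t ∈ Ioo s α, t ∈ Ioo 0 α := fun t ht => ⟨hs.1.trans ht.1, ht.2⟩
  refine le_of_comparison (q := q) (k := fun s => c₁ - h s) hs.2
    (fun t ht => (H.qpos t (hsub t ht)).le) (hw₂.contOn hs.1 le_rfl) (hw₁.contOn hs.1 le_rfl)
    (fun t ht => hw₁.pos t (hsub t ht)) (fun t ht => hw₂.deriv t (hsub t ht))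
    (fun t ht => hw₁.deriv t (hsub t ht)) (fun t ht _ => by linarith) (fun t ht => le_rfl) ?_
  rw [hw₁.zero, hw₂.zero]

/-- The solution depends on the speed in a Lipschitz way. -/
lemma IsSol.le_add (H : Coef q h α) (hw₁ : IsSol q h α c₁ w₁) (hw₂ : IsSol q h α c₂ w₂)
    (hc : c₁ ≤ c₂) {s : ℝ} (hs : s ∈ Ioc 0 α) : w₁ s ≤ w₂ s + (c₂ - c₁) * (α - s) := by
  have hsub : ∀ t ∈ Ioo s α, t ∈ Ioo 0 α := fun t ht => ⟨hs.1.trans ht.1, ht.2⟩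
  refine le_of_comparison (q := q) (k := fun s => c₁ - h s)
    (v := fun t => w₂ t + (c₂ - c₁) * (α - t))
    (v' := fun t => c₂ - h t - q t / w₂ t + (c₂ - c₁) * (-1)) hs.2
    (fun t ht => (H.qpos t (hsub t ht)).le) (hw₁.contOn hs.1 le_rfl)
    ((hw₂.contOn hs.1 le_rfl).add (by fun_prop))
    (fun t ht => ?_) (fun t ht => hw₁.deriv t (hsub t ht))
    (fun t ht => (hw₂.deriv t (hsub t ht)).add (((hasDerivAt_id t).const_sub α).const_mul _))
    (fun t ht _ => le_rfl) (fun t ht => ?_) ?_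
  · have h1 := hw₂.pos t (hsub t ht)
    have h2 : 0 ≤ (c₂ - c₁) * (α - t) := mul_nonneg (by linarith) (by linarith [ht.2])
    linarith
  · have h1 := hw₂.pos t (hsub t ht)
    have h2 : 0 ≤ (c₂ - c₁) * (α - t) := mul_nonneg (by linarith) (by linarith [ht.2])
    have h3 : q t / (w₂ t + (c₂ - c₁) * (α - t)) ≤ q t / w₂ t :=
      div_le_div_of_nonneg_left (H.qpos t (hsub t ht)).le h1 (by linarith)
    linarith
  · rw [hw₁.zero, hw₂.zero]; simp

/-- Since the comparison runs backward from `α`, the final value `w(α) = 0` alone determines the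
solution. -/
lemma IsSol.eq (H : Coef q h α) (hw₁ : IsSol q h α c w₁) (hw₂ : IsSol q h α c w₂) {s : ℝ}
    (hs : s ∈ Ioc 0 α) : w₁ s = w₂ s :=
  le_antisymm (hw₂.anti H hw₁ le_rfl hs) (hw₁.anti H hw₂ le_rfl hs)

/-- `w` takes arbitrarily small values arbitrarily close to `0`.  For a solution this already implies
`w(0⁺) = 0`. -/
def SmallNearZero (α : ℝ) (w : ℝ → ℝ) : Prop := ∀ ε > 0, ∃ s ∈ Ioo 0 α, s < ε ∧ w s < ε

lemma SmallNearZero.of_tendsto (hα : 0 < α) (h : Tendsto w (𝓝[>] 0) (𝓝 0)) :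
    SmallNearZero α w := by
  intro ε hε
  have h1 : ∀ᶠ s in 𝓝[>] (0 : ℝ), s ∈ Ioo 0 (min α ε) := Ioo_mem_nhdsGT (lt_min hα hε)
  obtain ⟨s, hs, hs'⟩ := (h1.and (h.eventually (gt_mem_nhds hε))).exists
  exact ⟨s, ⟨hs.1, hs.2.trans_le (min_le_left _ _)⟩, hs.2.trans_le (min_le_right _ _), hs'⟩

lemma sub_le_mul_of_deriv_le {w w' : ℝ → ℝ} {C x y : ℝ} (hxy : x < y)
    (hd : ∀ t ∈ Icc x y, HasDerivAt w (w' t) t) (hC : ∀ t ∈ Ioo x y, w' t ≤ C) :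
    w y - w x ≤ C * (y - x) := by
  obtain ⟨t, ht, he⟩ := exists_hasDerivAt_eq_slope w w' hxy
    (fun t ht => (hd t ht).continuousAt.continuousWithinAt)
    (fun t ht => hd t (Ioo_subset_Icc_self ht))
  have h1 := hC t ht
  rwa [he, div_le_iff₀ (sub_pos.2 hxy)] at h1

lemma mul_le_sub_of_le_deriv {w w' : ℝ → ℝ} {C x y : ℝ} (hxy : x < y)
    (hd : ∀ t ∈ Icc x y, HasDerivAt w (w' t) t) (hC : ∀ t ∈ Ioo x y, C ≤ w' t) :
    C * (y - x) ≤ w y - w x := by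
  obtain ⟨t, ht, he⟩ := exists_hasDerivAt_eq_slope w w' hxy
    (fun t ht => (hd t ht).continuousAt.continuousWithinAt)
    (fun t ht => hd t (Ioo_subset_Icc_self ht))
  have h1 := hC t ht
  rwa [he, le_div_iff₀ (sub_pos.2 hxy)] at h1

/-- A solution with arbitrarily small values near `0` lies below the line of slope `C`, for every upper
bound `C` of `c - h`.  Taking `C` close to `c - h(0)` bounds the slope of `w` at `0`. -/
lemma IsSol.le_mul (H : Coef q h α) (hw : IsSol q h α c w) (hsm : SmallNearZero α w) {C b : ℝ}
    (hb : b ≤ α) (hC : ∀ s ∈ Ioo 0 b, c - h s ≤ C) {s : ℝ} (hs : s ∈ Ioo 0 b) :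
    w s ≤ C * s := by
  have hk : ∀ ε > 0, w s ≤ C * s + (1 + |C|) * ε := by
    intro ε hε
    obtain ⟨t, ht, hte, hwt⟩ := hsm (min ε s) (lt_min hε hs.1)
    have hts : t < s := hte.trans_le (min_le_right _ _)
    have h1 := sub_le_mul_of_deriv_le (C := C) hts
      (fun r hr => hw.deriv r ⟨ht.1.trans_le hr.1, hr.2.trans_lt (hs.2.trans_le hb)⟩) ?_
    · have h2 : -(C * t) ≤ |C| * ε := by
        have h3 : -(C * t) ≤ |C| * t := by
          have := neg_abs_le C
          nlinarith [ht.1]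
        have h4 : |C| * t ≤ |C| * ε :=
          mul_le_mul_of_nonneg_left (hte.le.trans (min_le_left _ _)) (abs_nonneg _)
        linarith
      have h5 : w t < ε := hwt.trans_le (min_le_left _ _)
      nlinarith
    · intro r hr
      have hr' : r ∈ Ioo 0 α := ⟨ht.1.trans hr.1, (hr.2.trans hs.2).trans_le hb⟩
      have h2 := hC r ⟨hr'.1, hr.2.trans hs.2⟩
      have h3 : 0 ≤ q r / w r := div_nonneg (H.qpos r hr').le (hw.pos r hr').le
      linarith
  refine le_of_forall_pos_le_add fun ε hε => ?_
  have h0 : 0 < 1 + |C| := by positivity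
  have := hk (ε / (1 + |C|)) (by positivity)
  rwa [mul_div_cancel₀ _ h0.ne'] at this

lemma mul_le_of_le_deriv {w w' : ℝ → ℝ} {C b : ℝ} (hpos : ∀ s ∈ Ioo 0 b, 0 < w s)
    (hd : ∀ s ∈ Ioo 0 b, HasDerivAt w (w' s) s) (hC : ∀ s ∈ Ioo 0 b, C ≤ w' s) {s : ℝ}
    (hs : s ∈ Ioo 0 b) : C * s ≤ w s := by
  have h1 : ∀ᶠ t in 𝓝[>] (0 : ℝ), C * (s - t) ≤ w s := by
    filter_upwards [Ioo_mem_nhdsGT hs.1] with t ht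
    have := mul_le_sub_of_le_deriv ht.2 (fun r hr => hd r ⟨ht.1.trans_le hr.1, hr.2.trans_lt hs.2⟩)
      (fun r hr => hC r ⟨ht.1.trans hr.1, hr.2.trans hs.2⟩)
    have := hpos t ⟨ht.1, ht.2.trans hs.2⟩
    linarith
  have h2 : Tendsto (fun t => C * (s - t)) (𝓝[>] (0 : ℝ)) (𝓝 (C * (s - 0))) :=
    ((continuous_const.mul (continuous_const.sub continuous_id)).tendsto 0).mono_left
      nhdsWithin_le_nhds
  rw [sub_zero] at h2
  exact le_of_tendsto h2 h1

lemma Coef.exists_bound (H : Coef q h α) (c : ℝ) : ∃ C > 0, ∀ s ∈ Icc 0 α, |c - h s| ≤ C := by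
  obtain ⟨A, hA⟩ := isCompact_Icc.exists_bound_of_continuousOn
    ((continuousOn_const (c := c)).sub H.conth)
  exact ⟨|A| + 1, by positivity, fun s hs => by
    have h1 : |c - h s| ≤ A := hA s hs
    linarith [le_abs_self A]⟩

lemma IsSol.exists_le_mul (H : Coef q h α) (hw : IsSol q h α c w) (hsm : SmallNearZero α w) :
    ∃ C > 0, ∀ s ∈ Ioo 0 α, w s ≤ C * s := by
  obtain ⟨C, hC, hb⟩ := H.exists_bound c
  exact ⟨C, hC, fun s hs => hw.le_mul H hsm le_rfl
    (fun t ht => (le_abs_self _).trans (hb t (Ioo_subset_Icc_self ht))) hs⟩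

lemma IsSol.tendsto_zero (H : Coef q h α) (hw : IsSol q h α c w) (hsm : SmallNearZero α w) :
    Tendsto w (𝓝[>] 0) (𝓝 0) := by
  obtain ⟨C, hC, hb⟩ := hw.exists_le_mul H hsm
  have h2 : Tendsto (fun t => C * t) (𝓝[>] (0 : ℝ)) (𝓝 (C * 0)) :=
    ((continuous_const.mul continuous_id).tendsto 0).mono_left nhdsWithin_le_nhds
  rw [mul_zero] at h2
  refine tendsto_of_tendsto_of_tendsto_of_le_of_le' tendsto_const_nhds h2 ?_ ?_
  · filter_upwards [Ioo_mem_nhdsGT H.pos] with t ht using (hw.pos t ht).le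
  · filter_upwards [Ioo_mem_nhdsGT H.pos] with t ht using hb t ht

/-- The solution of `w' = c - h - q / w`, `w(α) = 0`, also vanishes at `0`. -/
def Vanish (q h : ℝ → ℝ) (α c : ℝ) : Prop := ∃ w, IsSol q h α c w ∧ Tendsto w (𝓝[>] 0) (𝓝 0)

lemma Coef.eventually_lt (H : Coef q h α) {m : ℝ} (hm : c - h 0 < m) :
    ∃ b ∈ Ioc 0 α, ∀ s ∈ Ioo 0 b, c - h s < m := by
  have h1 : ContinuousWithinAt (fun s => c - h s) (Icc 0 α) 0 :=
    (continuousOn_const.sub H.conth) 0 ⟨le_rfl, H.pos.le⟩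
  have h2 : ∀ᶠ s in 𝓝[Icc 0 α] 0, c - h s < m := h1.eventually (gt_mem_nhds hm)
  obtain ⟨δ, hδ, hδ'⟩ := Metric.mem_nhdsWithin_iff.1 h2
  refine ⟨min δ α, ⟨lt_min hδ H.pos, min_le_right _ _⟩, fun s hs => hδ' ⟨?_, hs.1.le, ?_⟩⟩
  · rw [Metric.mem_ball, Real.dist_eq, sub_zero, abs_of_pos hs.1]
    exact hs.2.trans_le (min_le_left _ _)
  · exact (hs.2.trans_le (min_le_right _ _)).le

lemma Vanish.le (H : Coef q h α) (hv : Vanish q h α c) : h 0 ≤ c := by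
  obtain ⟨w, hw, hw0⟩ := hv
  by_contra! hlt
  obtain ⟨b, hb, hb'⟩ := H.eventually_lt (c := c) (m := (c - h 0) / 2) (by linarith)
  obtain ⟨s, hs⟩ := nonempty_Ioo.2 hb.1
  have h1 := hw.le_mul H (.of_tendsto H.pos hw0) hb.2 (fun s hs => (hb' s hs).le) hs
  have h2 := hw.pos s ⟨hs.1, hs.2.trans_le hb.2⟩
  nlinarith [hs.1]

lemma Vanish.mono (H : Coef q h α) (hv : Vanish q h α c₁) (hc : c₁ ≤ c₂) : Vanish q h α c₂ := by
  obtain ⟨w₁, hw₁, hv₁⟩ := hv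
  obtain ⟨w₂, hw₂⟩ := exists_isSol H c₂
  refine ⟨w₂, hw₂, hw₂.tendsto_zero H fun ε hε => ?_⟩
  obtain ⟨s, hs, h1, h2⟩ := SmallNearZero.of_tendsto H.pos hv₁ ε hε
  exact ⟨s, hs, h1, (hw₁.anti H hw₂ hc ⟨hs.1, hs.2.le⟩).trans_lt h2⟩

/-- The speeds with `w(0) = 0` form a closed half-line.  A bound `q(s) ≤ K s` makes `w = s` an upper
solution for large speeds; the set is closed because `w` depends on `c` in a Lipschitz way. -/
theorem exists_threshold (H : Coef q h α) {K : ℝ} (hK : ∀ s ∈ Ioo 0 α, q s ≤ K * s) :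
    ∃ c₀, ∀ c, Vanish q h α c ↔ c₀ ≤ c := by
  set S := {c | Vanish q h α c} with hS
  obtain ⟨A, hA0, hA⟩ := H.exists_bound 0
  have hA' : ∀ s ∈ Icc 0 α, -A ≤ h s ∧ h s ≤ A := fun s hs => by
    have := abs_le.1 (hA s hs); constructor <;> linarith [this.1, this.2]
  have hne : S.Nonempty := by
    refine ⟨1 + A + K, ?_⟩
    obtain ⟨w, hw⟩ := exists_isSol H (1 + A + K)
    refine ⟨w, hw, hw.tendsto_zero H fun ε hε => ?_⟩
    obtain ⟨s, hs⟩ := nonempty_Ioo.2 (lt_min H.pos hε)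
    have hs' : s ∈ Ioo 0 α := ⟨hs.1, hs.2.trans_le (min_le_left _ _)⟩
    have hsε : s < ε := hs.2.trans_le (min_le_right _ _)
    refine ⟨s, hs', hsε, lt_of_le_of_lt ?_ hsε⟩
    have hsub : ∀ t ∈ Ioo s α, t ∈ Ioo 0 α := fun t ht => ⟨hs.1.trans ht.1, ht.2⟩
    refine le_of_comparison (q := q) (k := fun s => (1 + A + K) - h s) (v := fun t => t)
      (v' := fun _ => 1) hs'.2.le
      (fun t ht => (H.qpos t (hsub t ht)).le) (hw.contOn hs.1 le_rfl) continuousOn_id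
      (fun t ht => (hsub t ht).1) (fun t ht => hw.deriv t (hsub t ht))
      (fun t ht => hasDerivAt_id t) (fun t ht _ => le_rfl) (fun t ht => ?_) ?_
    · have h1 : q t / t ≤ K := by
        rw [div_le_iff₀ (hsub t ht).1]; exact hK t (hsub t ht)
      have h2 := (hA' t (Ioo_subset_Icc_self (hsub t ht))).2
      linarith
    · rw [hw.zero]; exact H.pos.le
  have hbdd : BddBelow S := ⟨h 0, fun c hc => Vanish.le H hc⟩
  have hmem : sInf S ∈ S := by
    obtain ⟨w, hw⟩ := exists_isSol H (sInf S)
    refine ⟨w, hw, hw.tendsto_zero H fun ε hε => ?_⟩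
    have hα := H.pos
    obtain ⟨c, hc, hclt⟩ := exists_lt_of_csInf_lt hne
      (show sInf S < sInf S + ε / (2 * α) by have : 0 < ε / (2 * α) := by positivity
                                             linarith)
    have hle : sInf S ≤ c := csInf_le hbdd hc
    obtain ⟨wc, hwc, hwc0⟩ := hc
    obtain ⟨s, hs, h1, h2⟩ := SmallNearZero.of_tendsto H.pos hwc0 (ε / 2) (by linarith)
    refine ⟨s, hs, by linarith, ?_⟩
    have h3 := hw.le_add H hwc hle ⟨hs.1, hs.2.le⟩
    have h4 : (c - sInf S) * (α - s) ≤ ε / (2 * α) * α := by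
      apply mul_le_mul <;> linarith [hs.1, hs.2]
    have h5 : ε / (2 * α) * α = ε / 2 := by field_simp
    linarith
  exact ⟨sInf S, fun c => ⟨fun hc => csInf_le hbdd hc, fun hc => Vanish.mono H hmem hc⟩⟩

/-- For opposite data `(c,h)` and `(-c,-h)` the sum of the two solutions is strictly decreasing, so
they cannot both vanish at `0`. -/
lemma not_vanish_neg (H : Coef q h α) (h1 : Vanish q h α c)
    (h2 : Vanish q (fun s => -h s) α (-c)) : False := by
  obtain ⟨w, hw, hw0⟩ := h1
  obtain ⟨v, hv, hv0⟩ := h2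
  have hd : ∀ s ∈ Ioo 0 α, HasDerivAt (fun s => w s + v s)
      (c - h s - q s / w s + (-c - -h s - q s / v s)) s :=
    fun s hs => (hw.deriv s hs).add (hv.deriv s hs)
  have hlim : Tendsto (fun s => w s + v s) (𝓝[>] 0) (𝓝 0) := by simpa using hw0.add hv0
  obtain ⟨s, hs⟩ := nonempty_Ioo.2 H.pos
  have hp : 0 < w s + v s := add_pos (hw.pos s hs) (hv.pos s hs)
  have : ∀ᶠ t in 𝓝[>] (0 : ℝ), w s + v s ≤ w t + v t := by
    filter_upwards [Ioo_mem_nhdsGT hs.1] with t ht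
    have h3 := sub_le_mul_of_deriv_le (C := 0) ht.2
      (fun r hr => hd r ⟨ht.1.trans_le hr.1, hr.2.trans_lt hs.2⟩) (fun r hr => by
        have hr' : r ∈ Ioo 0 α := ⟨ht.1.trans hr.1, hr.2.trans hs.2⟩
        have h4 := div_pos (H.qpos r hr') (hw.pos r hr')
        have h5 := div_pos (H.qpos r hr') (hv.pos r hr')
        linarith)
    simp only [zero_mul] at h3
    linarith
  linarith [ge_of_tendsto hlim this]

end Threshold

/-! ### The coefficients -/

/-- The standing assumptions on the coefficients. -/
structure Data (D f g : ℝ → ℝ) (α : ℝ) : Prop where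
  hf : CondF f
  hg : CondG g
  hD : CondDpn D α
  hDg : CondDini D g

section Data

variable {D f g : ℝ → ℝ} {α c : ℝ}

lemma Data.α0 (A : Data D f g α) : 0 < α := A.hD.1.1
lemma Data.α1 (A : Data D f g α) : α < 1 := A.hD.1.2
lemma Data.contD (A : Data D f g α) : ContinuousOn D (Icc 0 1) := A.hD.2.1.continuousOn
lemma Data.contf (A : Data D f g α) : ContinuousOn f (Icc 0 1) := A.hf.1.continuousOn
lemma Data.contg (A : Data D f g α) : ContinuousOn g (Icc 0 1) := A.hg.1
lemma Data.gpos (A : Data D f g α) : ∀ s ∈ Ioo (0 : ℝ) 1, 0 < g s := A.hg.2.1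
lemma Data.g0 (A : Data D f g α) : g 0 = 0 := A.hg.2.2.1
lemma Data.Dpos (A : Data D f g α) : ∀ s ∈ Ioo 0 α, 0 < D s := A.hD.2.2.1
lemma Data.Dneg (A : Data D f g α) : ∀ s ∈ Ioo α 1, D s < 0 := A.hD.2.2.2

lemma Data.mem_of_lt (A : Data D f g α) {s : ℝ} (hs : s ∈ Ioo 0 α) : s ∈ Ioo (0 : ℝ) 1 :=
  ⟨hs.1, hs.2.trans A.α1⟩

lemma Data.mem_α (A : Data D f g α) : α ∈ Ioo (0 : ℝ) 1 := ⟨A.α0, A.α1⟩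

lemma Data.gα (A : Data D f g α) : 0 < g α := A.gpos α A.mem_α

lemma Data.g_nonneg (A : Data D f g α) {s : ℝ} (hs : s ∈ Icc (0 : ℝ) 1) : 0 ≤ g s := by
  rcases eq_or_lt_of_le hs.1 with h1 | h1
  · rw [← h1, A.g0]
  rcases eq_or_lt_of_le hs.2 with h2 | h2
  · rw [h2, A.hg.2.2.2]
  exact (A.gpos s ⟨h1, h2⟩).le

lemma hasDerivWithinAt_dot {F : ℝ → ℝ} (hF : ContDiffOn ℝ 1 F (Icc 0 1)) {s : ℝ}
    (hs : s ∈ Icc (0 : ℝ) 1) : HasDerivWithinAt F (dot F s) (Icc 0 1) s :=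
  ((hF.differentiableOn one_ne_zero) s hs).hasDerivWithinAt

lemma hasDerivAt_dot {F : ℝ → ℝ} (hF : ContDiffOn ℝ 1 F (Icc 0 1)) {s : ℝ}
    (hs : s ∈ Ioo (0 : ℝ) 1) : HasDerivAt F (dot F s) s :=
  (hasDerivWithinAt_dot hF (Ioo_subset_Icc_self hs)).hasDerivAt (Icc_mem_nhds hs.1 hs.2)

lemma continuousOn_dot {F : ℝ → ℝ} (hF : ContDiffOn ℝ 1 F (Icc 0 1)) :
    ContinuousOn (dot F) (Icc 0 1) :=
  hF.continuousOn_derivWithin (uniqueDiffOn_Icc zero_lt_one) le_rfl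

lemma continuousAt_of_mem_Ioo {F : ℝ → ℝ} (hF : ContinuousOn F (Icc 0 1)) {s : ℝ}
    (hs : s ∈ Ioo (0 : ℝ) 1) : ContinuousAt F s := hF.continuousAt (Icc_mem_nhds hs.1 hs.2)

lemma tendsto_zero_right {F : ℝ → ℝ} (hF : ContinuousOn F (Icc 0 1)) :
    Tendsto F (𝓝[>] 0) (𝓝 (F 0)) := by
  have h1 : Tendsto F (𝓝[Icc 0 1] 0) (𝓝 (F 0)) := hF 0 ⟨le_rfl, zero_le_one⟩
  refine h1.mono_left ?_
  rw [← nhdsWithin_Ioo_eq_nhdsGT (zero_lt_one' ℝ)]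
  exact nhdsWithin_mono _ Ioo_subset_Icc_self

lemma Data.Dα (A : Data D f g α) : D α = 0 := by
  have hc := continuousAt_of_mem_Ioo A.contD A.mem_α
  apply le_antisymm
  · refine le_of_tendsto (hc.tendsto.mono_left (nhdsWithin_le_nhds (s := Ioi α))) ?_
    filter_upwards [Ioo_mem_nhdsGT A.α1] with s hs using (A.Dneg s hs).le
  · refine ge_of_tendsto (hc.tendsto.mono_left (nhdsWithin_le_nhds (s := Iio α))) ?_
    filter_upwards [Ioo_mem_nhdsLT A.α0] with s hs using (A.Dpos s hs).le

lemma Data.D0 (A : Data D f g α) : 0 ≤ D 0 := by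
  refine ge_of_tendsto (tendsto_zero_right A.contD) ?_
  filter_upwards [Ioo_mem_nhdsGT A.α0] with s hs using (A.Dpos s hs).le

lemma Data.dotDα (A : Data D f g α) : dot D α ≤ 0 := by
  have h := (hasDerivAt_iff_tendsto_slope.1 (hasDerivAt_dot A.hD.2.1 A.mem_α)).mono_left
    (nhdsWithin_mono α (show Ioi α ⊆ {α}ᶜ from fun s hs => ne_of_gt hs))
  refine le_of_tendsto h ?_
  filter_upwards [Ioo_mem_nhdsGT A.α1] with s hs
  rw [slope_def_field, A.Dα, sub_zero]
  exact div_nonpos_of_nonpos_of_nonneg (A.Dneg s hs).le (sub_pos.2 hs.1).le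

lemma Data.tendsto_D_div (A : Data D f g α) (h0 : D 0 = 0) :
    Tendsto (fun s => D s / s) (𝓝[>] 0) (𝓝 (dot D 0)) := by
  have h1 := hasDerivWithinAt_iff_tendsto_slope.1
    (hasDerivWithinAt_dot A.hD.2.1 (s := 0) ⟨le_rfl, zero_le_one⟩)
  have h2 : Tendsto (slope D 0) (𝓝[>] 0) (𝓝 (dot D 0)) := by
    refine h1.mono_left ?_
    rw [← nhdsWithin_Ioo_eq_nhdsGT (zero_lt_one' ℝ)]
    exact nhdsWithin_mono _ fun s hs => ⟨Ioo_subset_Icc_self hs, hs.1.ne'⟩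
  refine h2.congr fun s => ?_
  rw [slope_def_field, h0, sub_zero, sub_zero]

lemma Data.coef (A : Data D f g α) : Coef (fun s => D s * g s) (dot f) α where
  pos := A.α0
  contq := (A.contD.mul A.contg).mono (Icc_subset_Icc_right A.α1.le)
  conth := (continuousOn_dot A.hf.1).mono (Icc_subset_Icc_right A.α1.le)
  qpos := fun s hs => mul_pos (A.Dpos s hs) (A.gpos s (A.mem_of_lt hs))
  q0 := by simp [A.g0]
  qα := by simp [A.Dα]

lemma eventually_le_mul_of_dini {F : ℝ → ℝ} (h0 : F 0 = 0) (h : diniUpperRight F 0 < ⊤) :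
    ∃ L > 0, ∀ᶠ s in 𝓝[>] 0, F s ≤ L * s := by
  obtain ⟨L, hL, -⟩ := EReal.lt_iff_exists_real_btwn.1 h
  refine ⟨max L 1, by positivity, ?_⟩
  have h1 := Filter.eventually_lt_of_limsup_lt hL
  filter_upwards [h1, self_mem_nhdsWithin] with s hs hs0
  have hs0' : 0 < s := hs0
  rw [EReal.coe_lt_coe_iff, h0, sub_zero, sub_zero, div_lt_iff₀ hs0'] at hs
  exact hs.le.trans (mul_le_mul_of_nonneg_right (le_max_left _ _) hs0'.le)

lemma exists_Ioo_of_eventually {P : ℝ → Prop} {b : ℝ} (hb : 0 < b) (h : ∀ᶠ s in 𝓝[>] 0, P s) :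
    ∃ δ ∈ Ioc 0 b, ∀ s ∈ Ioo 0 δ, P s := by
  obtain ⟨u, hu, hu'⟩ := (mem_nhdsGT_iff_exists_Ioo_subset).1 h
  exact ⟨min u b, ⟨lt_min hu hb, min_le_right _ _⟩,
    fun s hs => hu' ⟨hs.1, hs.2.trans_le (min_le_left _ _)⟩⟩

/-- The Dini bound at `0` and the boundedness of `D g` give a linear bound on all of `(0,α)`. -/
lemma Data.exists_q_le (A : Data D f g α) : ∃ K, ∀ s ∈ Ioo 0 α, D s * g s ≤ K * s := by
  obtain ⟨L, hL, hev⟩ := eventually_le_mul_of_dini (F := fun s => D s * g s) (by simp [A.g0])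
    A.hDg.1
  obtain ⟨δ, hδ, hδ'⟩ := exists_Ioo_of_eventually A.α0 hev
  obtain ⟨B, hB⟩ := isCompact_Icc.exists_bound_of_continuousOn A.coef.contq
  refine ⟨L + |B| / δ, fun s hs => ?_⟩
  have hB0 : 0 ≤ |B| / δ := div_nonneg (abs_nonneg _) hδ.1.le
  by_cases hsd : s < δ
  · have := hδ' s ⟨hs.1, hsd⟩
    have := mul_nonneg hB0 hs.1.le
    linarith
  · have h1 : D s * g s ≤ |B| :=
      ((le_abs_self _).trans (hB s (Ioo_subset_Icc_self hs))).trans (le_abs_self B)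
    have h2 : |B| ≤ |B| / δ * s := by
      rw [div_mul_eq_mul_div, le_div_iff₀ hδ.1]
      exact mul_le_mul_of_nonneg_left (not_lt.1 hsd) (abs_nonneg _)
    have := mul_nonneg hL.le hs.1.le
    linarith

/-- The condition on the speed that decides on existence on the side of the equilibrium `0`. -/
abbrev VanishAt (D f g : ℝ → ℝ) (α c : ℝ) : Prop := Vanish (fun s => D s * g s) (dot f) α c

lemma Data.exists_threshold (A : Data D f g α) : ∃ c₀, ∀ c, VanishAt D f g α c ↔ c₀ ≤ c := by
  obtain ⟨K, hK⟩ := A.exists_q_le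
  exact Wavefront.exists_threshold A.coef hK

/-- The reflection `ξ ↦ -ξ` turns the data `(c, f)` into `(-c, -f)`. -/
lemma Data.neg (A : Data D f g α) : Data D (fun s => -f s) g α :=
  ⟨⟨A.hf.1.neg, by simp [A.hf.2]⟩, A.hg, A.hD, A.hDg⟩

lemma dot_neg (F : ℝ → ℝ) (s : ℝ) : dot (fun s => -F s) s = -dot F s := by
  simp [dot, derivWithin.fun_neg]

lemma Data.not_vanishAt_neg (A : Data D f g α) (h1 : VanishAt D f g α c)
    (h2 : VanishAt D (fun s => -f s) g α (-c)) : False := by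
  refine not_vanish_neg A.coef h1 ?_
  have : dot (fun s => -f s) = fun s => -dot f s := funext fun s => dot_neg f s
  rwa [VanishAt, this] at h2

/-! ### Behaviour of the solution of the first-order problem near `0` -/

variable {w : ℝ → ℝ}

/-- Near `0` a solution lies on one side of an upper solution `v`: being below `v` at one point
propagates toward `0`. -/
lemma IsSol.dichotomy {q h v v' : ℝ → ℝ} (H : Coef q h α) (hw : IsSol q h α c w)
    (hv : ∀ᶠ s in 𝓝[>] 0, 0 < v s ∧ HasDerivAt v (v' s) s ∧ v' s ≤ c - h s - q s / v s) :
    (∀ᶠ s in 𝓝[>] 0, w s ≤ v s) ∨ (∀ᶠ s in 𝓝[>] 0, v s < w s) := by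
  obtain ⟨δ, hδ, hδ'⟩ := exists_Ioo_of_eventually H.pos hv
  by_cases hex : ∃ b ∈ Ioo 0 δ, w b ≤ v b
  · left
    obtain ⟨b, hb, hwb⟩ := hex
    filter_upwards [Ioo_mem_nhdsGT hb.1] with s hs
    have hsub : ∀ t ∈ Ioo s b, t ∈ Ioo 0 δ := fun t ht => ⟨hs.1.trans ht.1, ht.2.trans hb.2⟩
    have hsub' : ∀ t ∈ Ioo s b, t ∈ Ioo 0 α := fun t ht =>
      ⟨hs.1.trans ht.1, (ht.2.trans hb.2).trans_le hδ.2⟩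
    exact le_of_comparison (q := q) (k := fun s => c - h s) hs.2.le
      (fun t ht => (H.qpos t (hsub' t ht)).le) (hw.contOn hs.1 (hb.2.le.trans hδ.2))
      (fun t ht => (hδ' t ⟨hs.1.trans_le ht.1,
        ht.2.trans_lt hb.2⟩).2.1.continuousAt.continuousWithinAt)
      (fun t ht => (hδ' t (hsub t ht)).1) (fun t ht => hw.deriv t (hsub' t ht))
      (fun t ht => (hδ' t (hsub t ht)).2.1) (fun t _ _ => le_rfl)
      (fun t ht => (hδ' t (hsub t ht)).2.2) hwb
  · right
    push Not at hex
    filter_upwards [Ioo_mem_nhdsGT hδ.1] with s hs using hex s hs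

/-- The multiples `ε D` with small `ε` are upper solutions near `0`. -/
lemma Data.dichotomy_mul_D (A : Data D f g α) (hw : IsSol (fun s => D s * g s) (dot f) α c w)
    {ε : ℝ} (hε : 0 < ε) (hεD : ε * dot D 0 < c - dot f 0) :
    (∀ᶠ s in 𝓝[>] 0, w s ≤ ε * D s) ∨ (∀ᶠ s in 𝓝[>] 0, ε * D s < w s) := by
  refine hw.dichotomy A.coef (v' := fun s => ε * dot D s) ?_
  have h1 : Tendsto (fun s => ε * dot D s) (𝓝[>] 0) (𝓝 (ε * dot D 0)) :=
    (tendsto_zero_right (continuousOn_dot A.hD.2.1)).const_mul ε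
  have h2 : Tendsto (fun s => c - dot f s - g s / ε) (𝓝[>] 0) (𝓝 (c - dot f 0 - g 0 / ε)) :=
    (tendsto_const_nhds.sub (tendsto_zero_right (continuousOn_dot A.hf.1))).sub
      ((tendsto_zero_right A.contg).div_const ε)
  rw [A.g0, zero_div, sub_zero] at h2
  filter_upwards [h1.eventually_lt h2 hεD, Ioo_mem_nhdsGT A.α0] with s hs hsα
  have hD := A.Dpos s hsα
  refine ⟨by positivity, (hasDerivAt_dot A.hD.2.1 (A.mem_of_lt hsα)).const_mul ε, ?_⟩
  have : D s * g s / (ε * D s) = g s / ε := by field_simp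
  rw [this]
  exact hs.le

/-- A solution that stays above a multiple of `D` has the maximal slope `c - h(0)` at `0`. -/
lemma Data.eventually_mul_le (A : Data D f g α) (hw : IsSol (fun s => D s * g s) (dot f) α c w)
    {ε : ℝ} (hε : 0 < ε) (hup : ∀ᶠ s in 𝓝[>] 0, ε * D s < w s) {m : ℝ}
    (hm : m < c - dot f 0) : ∀ᶠ s in 𝓝[>] 0, m * s ≤ w s := by
  have h2 : Tendsto (fun s => c - dot f s - g s / ε) (𝓝[>] 0) (𝓝 (c - dot f 0 - g 0 / ε)) :=
    (tendsto_const_nhds.sub (tendsto_zero_right (continuousOn_dot A.hf.1))).sub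
      ((tendsto_zero_right A.contg).div_const ε)
  rw [A.g0, zero_div, sub_zero] at h2
  obtain ⟨δ, hδ, hδ'⟩ := exists_Ioo_of_eventually A.α0 ((h2.eventually (lt_mem_nhds hm)).and hup)
  have hsub : ∀ t ∈ Ioo 0 δ, t ∈ Ioo 0 α := fun t ht => ⟨ht.1, ht.2.trans_le hδ.2⟩
  filter_upwards [Ioo_mem_nhdsGT hδ.1] with s hs
  refine mul_le_of_le_deriv (fun t ht => hw.pos t (hsub t ht)) (fun t ht => hw.deriv t (hsub t ht))
    (fun t ht => ?_) hs
  have h3 := (hδ' t ht).1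
  have h4 := (hδ' t ht).2
  have h5 := A.Dpos t (hsub t ht)
  have h6 := A.gpos t (A.mem_of_lt (hsub t ht))
  have h7 : D t * g t / w t ≤ g t / ε := by
    rw [div_le_div_iff₀ (hw.pos t (hsub t ht)) hε]
    nlinarith
  linarith

/-- Above the threshold the profile meets the equilibrium `0` with zero slope: `w / D → 0`. -/
lemma Data.eventually_le_mul_D (A : Data D f g α) {c₁ : ℝ} (hv : VanishAt D f g α c₁)
    (hc : c₁ < c) (hw : IsSol (fun s => D s * g s) (dot f) α c w) {ε : ℝ} (hε : 0 < ε) :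
    ∀ᶠ s in 𝓝[>] 0, w s ≤ ε * D s := by
  have h0 := Vanish.le A.coef hv
  obtain ⟨w₁, hw₁, hv₁⟩ := hv
  -- a smaller multiple, for which the dichotomy applies
  obtain ⟨η, hη, hηε, hηD⟩ : ∃ η > 0, η ≤ ε ∧ η * dot D 0 < c - dot f 0 := by
    have hk : 0 < c - dot f 0 := by linarith
    refine ⟨min ε ((c - dot f 0) / (|dot D 0| + 1)), by positivity, min_le_left _ _, ?_⟩
    have h1 : 0 < |dot D 0| + 1 := by positivity
    calc _ ≤ min ε ((c - dot f 0) / (|dot D 0| + 1)) * |dot D 0| := by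
            gcongr; exact le_abs_self _
      _ ≤ ((c - dot f 0) / (|dot D 0| + 1)) * |dot D 0| := by gcongr; exact min_le_right _ _
      _ < ((c - dot f 0) / (|dot D 0| + 1)) * (|dot D 0| + 1) := by gcongr; linarith
      _ = _ := div_mul_cancel₀ _ h1.ne'
  rcases A.dichotomy_mul_D hw hη hηD with h | h
  · filter_upwards [h, Ioo_mem_nhdsGT A.α0] with s hs hsα
    exact hs.trans (mul_le_mul_of_nonneg_right hηε (A.Dpos s hsα).le)
  · -- otherwise `w` is steeper at `0` than the larger function `w₁`
    exfalso
    obtain ⟨m, hm1, hm2⟩ := exists_between (show c₁ - dot f 0 < c - dot f 0 by linarith)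
    obtain ⟨m', hm'1, hm'2⟩ := exists_between hm2
    have h2 := A.eventually_mul_le hw hη h hm'2
    obtain ⟨b, hb, hb'⟩ := A.coef.eventually_lt hm1
    have h3 : ∀ᶠ s in 𝓝[>] 0, w₁ s ≤ m * s := by
      filter_upwards [Ioo_mem_nhdsGT hb.1] with s hs
      exact hw₁.le_mul A.coef (.of_tendsto A.α0 hv₁) hb.2 (fun s hs => (hb' s hs).le) hs
    obtain ⟨s, hs2, hs3, hs⟩ := (h2.and (h3.and (Ioo_mem_nhdsGT A.α0))).exists
    have := hw₁.anti A.coef hw hc.le ⟨hs.1, hs.2.le⟩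
    nlinarith [hs.1]

/-- At the threshold the solution is steep at `0`: otherwise a multiple of `D` is an upper solution
also for slightly smaller speeds. -/
lemma Data.exists_mul_D_lt (A : Data D f g α) (hD0 : D 0 = 0) (hc : dot f 0 < c)
    (hw : IsSol (fun s => D s * g s) (dot f) α c w)
    (hmin : ∀ c' < c, ¬ VanishAt D f g α c') : ∃ ε > 0, ∀ᶠ s in 𝓝[>] 0, ε * D s < w s := by
  set κ := c - dot f 0 with hκ
  have hκ0 : 0 < κ := by linarith
  have h1 : 0 < |dot D 0| + 1 := by positivity
  set ε := κ / (8 * (|dot D 0| + 1)) with hεd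
  have hε : 0 < ε := by positivity
  have hεD : ε * dot D 0 ≤ κ / 8 := by
    calc ε * dot D 0 ≤ ε * (|dot D 0| + 1) := by gcongr; linarith [le_abs_self (dot D 0)]
      _ = κ / 8 := by rw [hεd]; field_simp
  refine ⟨ε, hε, ?_⟩
  rcases A.dichotomy_mul_D hw hε (by linarith) with h | h
  swap
  · exact h
  exfalso
  have ht1 : Tendsto (fun s => 2 * ε * dot D s) (𝓝[>] 0) (𝓝 (2 * ε * dot D 0)) :=
    (tendsto_zero_right (continuousOn_dot A.hD.2.1)).const_mul _
  have ht2 : Tendsto (fun s => c - κ / 2 - dot f s - g s / (2 * ε)) (𝓝[>] 0)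
      (𝓝 (c - κ / 2 - dot f 0 - g 0 / (2 * ε))) :=
    (tendsto_const_nhds.sub (tendsto_zero_right (continuousOn_dot A.hf.1))).sub
      ((tendsto_zero_right A.contg).div_const _)
  rw [A.g0, zero_div, sub_zero] at ht2
  obtain ⟨δ, hδ, hδ'⟩ := exists_Ioo_of_eventually A.α0
    (h.and (ht1.eventually_lt ht2 (by linarith)))
  have hsub : ∀ t ∈ Ioo 0 δ, t ∈ Ioo 0 α := fun t ht => ⟨ht.1, ht.2.trans_le hδ.2⟩
  obtain ⟨b, hb⟩ := nonempty_Ioo.2 hδ.1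
  have hDb := A.Dpos b (hsub b hb)
  set η := min (κ / 2) (ε * D b / α) with hη
  have hα := A.α0
  have hη0 : 0 < η := lt_min (by linarith) (by positivity)
  refine hmin (c - η) (by linarith) ?_
  obtain ⟨v, hv⟩ := exists_isSol A.coef (c - η)
  have hvb : v b ≤ 2 * ε * D b := by
    have h2 := hv.le_add A.coef hw (by linarith) ⟨hb.1, (hsub b hb).2.le⟩
    have h3 : (c - (c - η)) * (α - b) ≤ ε * D b := by
      calc (c - (c - η)) * (α - b) ≤ (ε * D b / α) * α := by
            apply mul_le_mul
            · have := min_le_right (κ / 2) (ε * D b / α); linarith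
            · linarith [hb.1]
            · linarith [(hsub b hb).2]
            · positivity
        _ = ε * D b := div_mul_cancel₀ _ hα.ne'
    have h4 := (hδ' b hb).1
    linarith
  have hvle : ∀ s ∈ Ioo 0 b, v s ≤ 2 * ε * D s := by
    intro s hs
    have hs' : ∀ t ∈ Icc s b, t ∈ Ioo 0 δ := fun t ht => ⟨hs.1.trans_le ht.1, ht.2.trans_lt hb.2⟩
    have hd : ∀ t ∈ Icc s b, HasDerivAt (fun t => 2 * ε * D t) (2 * ε * dot D t) t := fun t ht =>
      (hasDerivAt_dot A.hD.2.1 (A.mem_of_lt (hsub t (hs' t ht)))).const_mul _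
    refine le_of_comparison (q := fun s => D s * g s) (k := fun s => c - η - dot f s) hs.2.le
      (fun t ht => (A.coef.qpos t (hsub t (hs' t (Ioo_subset_Icc_self ht)))).le)
      (hv.contOn hs.1 (hsub b hb).2.le)
      (fun t ht => (hd t ht).continuousAt.continuousWithinAt)
      (fun t ht => ?_)
      (fun t ht => hv.deriv t (hsub t (hs' t (Ioo_subset_Icc_self ht))))
      (fun t ht => hd t (Ioo_subset_Icc_self ht)) (fun t _ _ => le_rfl) (fun t ht => ?_) hvb
    · have := A.Dpos t (hsub t (hs' t (Ioo_subset_Icc_self ht)))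
      positivity
    · have h5 := A.Dpos t (hsub t (hs' t (Ioo_subset_Icc_self ht)))
      have h6 : D t * g t / (2 * ε * D t) = g t / (2 * ε) := by field_simp
      have h7 := (hδ' t (hs' t (Ioo_subset_Icc_self ht))).2
      have h8 := min_le_left (κ / 2) (ε * D b / α)
      rw [h6]
      linarith
  refine ⟨v, hv, ?_⟩
  have ht3 : Tendsto (fun s => 2 * ε * D s) (𝓝[>] 0) (𝓝 (2 * ε * D 0)) :=
    (tendsto_zero_right A.contD).const_mul _
  rw [hD0, mul_zero] at ht3
  refine tendsto_of_tendsto_of_tendsto_of_le_of_le' tendsto_const_nhds ht3 ?_ ?_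
  · filter_upwards [Ioo_mem_nhdsGT A.α0] with s hs using (hv.pos s hs).le
  · filter_upwards [Ioo_mem_nhdsGT hb.1] with s hs using hvle s hs

/-- If moreover `g(s) = O(s)`, then `φ' = -w / D` is `O(φ)` near the equilibrium. -/
lemma Data.eventually_le_mul_mul_D (A : Data D f g α) (hD0 : D 0 = 0) (hc : dot f 0 < c)
    (hw : IsSol (fun s => D s * g s) (dot f) α c w)
    (hsmall : ∀ ε > 0, ∀ᶠ s in 𝓝[>] 0, w s ≤ ε * D s) (hdini : diniUpperRight g 0 < ⊤) :
    ∃ M > 0, ∀ᶠ s in 𝓝[>] 0, w s ≤ M * s * D s := by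
  obtain ⟨L, hL, hgL⟩ := eventually_le_mul_of_dini A.g0 hdini
  set κ := c - dot f 0 with hκ
  have hκ0 : 0 < κ := by linarith
  set M := 4 * L / κ with hM
  have hM0 : 0 < M := by positivity
  have ht1 : Tendsto (fun s => M * (D s + s * dot D s)) (𝓝[>] 0)
      (𝓝 (M * (D 0 + 0 * dot D 0))) :=
    ((tendsto_zero_right A.contD).add ((tendsto_zero_right continuousOn_id).mul
      (tendsto_zero_right (continuousOn_dot A.hD.2.1)))).const_mul _
  rw [hD0, zero_mul, add_zero, mul_zero] at ht1
  have ht2 : Tendsto (fun s => c - dot f s - κ / 4) (𝓝[>] 0) (𝓝 (c - dot f 0 - κ / 4)) :=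
    (tendsto_const_nhds.sub (tendsto_zero_right (continuousOn_dot A.hf.1))).sub_const _
  have hgM : ∀ᶠ s in 𝓝[>] 0, g s / (M * s) ≤ κ / 4 := by
    filter_upwards [hgL, self_mem_nhdsWithin] with s hs hs0
    have hs0' : 0 < s := hs0
    rw [div_le_iff₀ (by positivity), hM]
    calc g s ≤ L * s := hs
      _ = κ / 4 * (4 * L / κ * s) := by field_simp
  refine ⟨M, hM0, (hw.dichotomy A.coef (v := fun s => M * s * D s)
    (v' := fun s => M * (D s + s * dot D s)) ?_).resolve_right fun hup => ?_⟩
  · filter_upwards [ht1.eventually_lt ht2 (by linarith), hgM, Ioo_mem_nhdsGT A.α0] with s h1 h2 hs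
    have hDs := A.Dpos s hs
    have hs0 := hs.1
    refine ⟨by positivity, ?_, ?_⟩
    · have := ((hasDerivAt_id s).const_mul M).mul (hasDerivAt_dot A.hD.2.1 (A.mem_of_lt hs))
      refine this.congr_deriv ?_
      simp; ring
    · have h6 : D s * g s / (M * s * D s) = g s / (M * s) := by field_simp
      rw [h6]; linarith
  · obtain ⟨δ, hδ, hδ'⟩ := exists_Ioo_of_eventually A.α0
      (hup.and (hgM.and (ht2.eventually (lt_mem_nhds (show κ / 2 < c - dot f 0 - κ / 4 by linarith)))))
    have hsub : ∀ t ∈ Ioo 0 δ, t ∈ Ioo 0 α := fun t ht => ⟨ht.1, ht.2.trans_le hδ.2⟩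
    have hlow : ∀ᶠ s in 𝓝[>] 0, κ / 2 * s ≤ w s := by
      filter_upwards [Ioo_mem_nhdsGT hδ.1] with s hs
      refine mul_le_of_le_deriv (fun t ht => hw.pos t (hsub t ht))
        (fun t ht => hw.deriv t (hsub t ht)) (fun t ht => ?_) hs
      obtain ⟨h3, h4, h5⟩ := hδ' t ht
      have h6 := A.Dpos t (hsub t ht)
      have h7 := A.gpos t (A.mem_of_lt (hsub t ht))
      have h8 : D t * g t / w t ≤ g t / (M * t) := by
        rw [div_le_div_iff₀ (hw.pos t (hsub t ht)) (mul_pos hM0 ht.1)]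
        nlinarith
      linarith
    -- but `w ≤ ε D` and `D(s) = O(s)` give a slope as small as desired
    set K := |dot D 0| + 1 with hK
    have hK0 : 0 < K := by positivity
    have hDK : ∀ᶠ s in 𝓝[>] 0, D s / s < K := (A.tendsto_D_div hD0).eventually
      (gt_mem_nhds (by linarith [le_abs_self (dot D 0)]))
    obtain ⟨s, h3, h4, h5, h6⟩ := (hlow.and ((hsmall (κ / (4 * K)) (by positivity)).and
      (hDK.and (Ioo_mem_nhdsGT A.α0)))).exists
    rw [div_lt_iff₀ h6.1] at h5
    have h7 : κ / (4 * K) * D s ≤ κ / (4 * K) * (K * s) := by gcongr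
    have h8 : κ / (4 * K) * (K * s) = κ / 4 * s := by field_simp
    have := h6.1
    nlinarith

end Data

/-! ### Behaviour of the solution of the first-order problem near `α` -/

section NearAlpha

variable {D f g : ℝ → ℝ} {α c : ℝ} {w : ℝ → ℝ}

lemma exists_Ioo_of_eventually_left {P : ℝ → Prop} {a b : ℝ} (hab : a < b)
    (h : ∀ᶠ s in 𝓝[<] b, P s) : ∃ x ∈ Ico a b, ∀ s ∈ Ioo x b, P s := by
  obtain ⟨u, hu, hu'⟩ := (mem_nhdsLT_iff_exists_Ioo_subset).1 h
  exact ⟨max u a, ⟨le_max_right _ _, max_lt hu hab⟩,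
    fun s hs => hu' ⟨(le_max_left _ _).trans_lt hs.1, hs.2⟩⟩

lemma Data.tendsto_left_α (A : Data D f g α) {F : ℝ → ℝ} (hF : ContinuousOn F (Icc 0 1)) :
    Tendsto F (𝓝[<] α) (𝓝 (F α)) :=
  (continuousAt_of_mem_Ioo hF A.mem_α).tendsto.mono_left nhdsWithin_le_nhds

/-- `D g(α) / μ` is a lower solution near `α` when `μ` exceeds `-s_-(α,c)`. -/
lemma Data.mul_D_le_near_α (A : Data D f g α) (hw : IsSol (fun s => D s * g s) (dot f) α c w)
    {μ : ℝ} (hμ : 0 < μ) (hμ' : c - dot f α - μ < dot D α * (g α / μ)) :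
    ∀ᶠ s in 𝓝[<] α, D s * (g α / μ) ≤ w s := by
  have hgα := A.gα
  have ht1 : Tendsto (fun s => dot D s * (g α / μ)) (𝓝[<] α) (𝓝 (dot D α * (g α / μ))) :=
    (A.tendsto_left_α (continuousOn_dot A.hD.2.1)).mul_const _
  have ht2 : Tendsto (fun s => c - dot f s - g s / (g α / μ)) (𝓝[<] α)
      (𝓝 (c - dot f α - g α / (g α / μ))) :=
    (tendsto_const_nhds.sub (A.tendsto_left_α (continuousOn_dot A.hf.1))).sub
      ((A.tendsto_left_α A.contg).div_const _)
  have he : g α / (g α / μ) = μ := by field_simp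
  rw [he] at ht2
  obtain ⟨x, hx, hx'⟩ := exists_Ioo_of_eventually_left A.α0 (ht2.eventually_lt ht1 hμ')
  filter_upwards [Ioo_mem_nhdsLT hx.2] with s hs
  have hsub : ∀ t ∈ Ioo s α, t ∈ Ioo 0 α := fun t ht => ⟨(hx.1.trans_lt hs.1).trans ht.1, ht.2⟩
  have hs0 : 0 < s := hx.1.trans_lt hs.1
  refine le_of_comparison (q := fun s => D s * g s) (k := fun s => c - dot f s) hs.2.le
    (w := fun s => D s * (g α / μ)) (w' := fun s => dot D s * (g α / μ))
    (fun t ht => (A.coef.qpos t (hsub t ht)).le)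
    ((A.contD.mono (Icc_subset_Icc hs0.le A.α1.le)).mul continuousOn_const)
    (hw.contOn hs0 le_rfl) (fun t ht => hw.pos t (hsub t ht))
    (fun t ht => (hasDerivAt_dot A.hD.2.1 (A.mem_of_lt (hsub t ht))).mul_const _)
    (fun t ht => hw.deriv t (hsub t ht)) (fun t ht _ => ?_) (fun t _ => le_rfl) ?_
  · have hDt := A.Dpos t (hsub t ht)
    have : D t * g t / (D t * (g α / μ)) = g t / (g α / μ) := by field_simp
    rw [this]
    exact (hx' t ⟨hs.1.trans ht.1, ht.2⟩).le
  · rw [A.Dα, hw.zero, zero_mul]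

/-- `D g(α) / μ` is an upper solution near `α` when `μ` is below `-s_-(α,c)`. -/
lemma Data.le_mul_D_near_α (A : Data D f g α) (hw : IsSol (fun s => D s * g s) (dot f) α c w)
    {μ : ℝ} (hμ : 0 < μ) (hμ' : dot D α * (g α / μ) < c - dot f α - μ) :
    ∀ᶠ s in 𝓝[<] α, w s ≤ D s * (g α / μ) := by
  have hgα := A.gα
  have ht1 : Tendsto (fun s => dot D s * (g α / μ)) (𝓝[<] α) (𝓝 (dot D α * (g α / μ))) :=
    (A.tendsto_left_α (continuousOn_dot A.hD.2.1)).mul_const _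
  have ht2 : Tendsto (fun s => c - dot f s - g s / (g α / μ)) (𝓝[<] α)
      (𝓝 (c - dot f α - g α / (g α / μ))) :=
    (tendsto_const_nhds.sub (A.tendsto_left_α (continuousOn_dot A.hf.1))).sub
      ((A.tendsto_left_α A.contg).div_const _)
  have he : g α / (g α / μ) = μ := by field_simp
  rw [he] at ht2
  obtain ⟨x, hx, hx'⟩ := exists_Ioo_of_eventually_left A.α0 (ht1.eventually_lt ht2 hμ')
  filter_upwards [Ioo_mem_nhdsLT hx.2] with s hs
  have hsub : ∀ t ∈ Ioo s α, t ∈ Ioo 0 α := fun t ht => ⟨(hx.1.trans_lt hs.1).trans ht.1, ht.2⟩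
  have hs0 : 0 < s := hx.1.trans_lt hs.1
  refine le_of_comparison (q := fun s => D s * g s) (k := fun s => c - dot f s) hs.2.le
    (v := fun s => D s * (g α / μ)) (v' := fun s => dot D s * (g α / μ))
    (fun t ht => (A.coef.qpos t (hsub t ht)).le)
    (hw.contOn hs0 le_rfl)
    ((A.contD.mono (Icc_subset_Icc hs0.le A.α1.le)).mul continuousOn_const)
    (fun t ht => ?_) (fun t ht => hw.deriv t (hsub t ht))
    (fun t ht => (hasDerivAt_dot A.hD.2.1 (A.mem_of_lt (hsub t ht))).mul_const _)
    (fun t _ _ => le_rfl) (fun t ht => ?_) ?_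
  · have hDt := A.Dpos t (hsub t ht)
    positivity
  · have hDt := A.Dpos t (hsub t ht)
    have : D t * g t / (D t * (g α / μ)) = g t / (g α / μ) := by field_simp
    rw [this]
    exact (hx' t ⟨hs.1.trans ht.1, ht.2⟩).le
  · rw [A.Dα, hw.zero, zero_mul]

/-- `-s_-(α,c)` is the nonnegative root of `r² - (c - h(α)) r + Ḋ(α) g(α)`; the other root is
nonpositive. -/
lemma Data.sMinus_spec (A : Data D f g α) (c : ℝ) : ∃ r' ≤ 0,
    0 ≤ -sMinus D f g α c ∧ -sMinus D f g α c + r' = c - dot f α ∧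
    -sMinus D f g α c * r' = dot D α * g α := by
  set κ := c - dot f α with hκ
  have hm : dot D α * g α ≤ 0 := mul_nonpos_of_nonpos_of_nonneg A.dotDα A.gα.le
  set S := Real.sqrt ((dot f α - c) ^ 2 - 4 * dot D α * g α) with hS
  have hS2 : S ^ 2 = κ ^ 2 - 4 * (dot D α * g α) := by
    rw [hS, Real.sq_sqrt (by nlinarith [sq_nonneg (dot f α - c)])]; ring
  have hSk : |κ| ≤ S := by
    rw [hS]; apply Real.abs_le_sqrt; nlinarith
  have h1 := abs_le.1 hSk
  refine ⟨1 / 2 * (κ - S), by linarith [h1.2], ?_, ?_, ?_⟩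
  · simp only [sMinus]; linarith [h1.1]
  · simp only [sMinus]; linarith
  · simp only [sMinus, ← hS]
    have : dot f α - c = -κ := by rw [hκ]; ring
    rw [this]; nlinarith

lemma Data.sMinus_nonpos (A : Data D f g α) (c : ℝ) : sMinus D f g α c ≤ 0 := by
  obtain ⟨r', -, h, -⟩ := A.sMinus_spec c; linarith

lemma Data.sMinus_neg (A : Data D f g α) (h : dot D α < 0 ∨ dot f α < c) :
    sMinus D f g α c < 0 := by
  obtain ⟨r', hr', h1, h2, h3⟩ := A.sMinus_spec c
  refine lt_of_le_of_ne (A.sMinus_nonpos c) fun h0 => ?_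
  rw [h0] at h2 h3
  have := A.gα
  rcases h with h | h
  · have : dot D α * g α < 0 := mul_neg_of_neg_of_pos h A.gα
    simp at h3
    rcases h3 with h3 | h3 <;> linarith
  · linarith

lemma Data.sMinus_eq_zero (A : Data D f g α) (h : dot D α = 0) (h' : c ≤ dot f α) :
    sMinus D f g α c = 0 := by
  obtain ⟨r', hr', h1, h2, h3⟩ := A.sMinus_spec c
  rw [h, zero_mul] at h3
  rcases mul_eq_zero.1 h3 with h4 | h4 <;> linarith

/-- The reciprocal of the slope of the profile at `α`.  The functions `D g(α) / μ` are lower or upper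
solutions according to the position of `μ` relative to the root `-s_-(α,c)`. -/
lemma Data.tendsto_D_div_w (A : Data D f g α) (hw : IsSol (fun s => D s * g s) (dot f) α c w) :
    Tendsto (fun s => D s / w s) (𝓝[<] α) (𝓝 (-sMinus D f g α c / g α)) := by
  obtain ⟨r', hr', h1, h2, h3⟩ := A.sMinus_spec c
  set r := -sMinus D f g α c with hr
  have hgα := A.gα
  have hk : ∀ μ > 0, dot D α * (g α / μ) - (c - dot f α - μ) = (μ - r) * (μ - r') / μ := by
    intro μ hμ
    rw [← h2, show dot D α * (g α / μ) = (dot D α * g α) / μ by ring, ← h3]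
    field_simp; ring
  refine tendsto_order.2 ⟨fun a ha => ?_, fun a ha => ?_⟩
  · by_cases ha0 : a < 0
    · filter_upwards [Ioo_mem_nhdsLT A.α0] with s hs
      exact ha0.trans (div_pos (A.Dpos s hs) (hw.pos s hs))
    · push Not at ha0
      rw [lt_div_iff₀ hgα] at ha
      obtain ⟨μ, hμ1, hμ2⟩ := exists_between ha
      have hμ0 : 0 < μ := (mul_nonneg ha0 hgα.le).trans_lt hμ1
      have hneg : (μ - r) * (μ - r') / μ < 0 :=
        div_neg_of_neg_of_pos (mul_neg_of_neg_of_pos (by linarith) (by linarith)) hμ0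
      filter_upwards [A.le_mul_D_near_α hw hμ0 (by linarith [hk μ hμ0]), Ioo_mem_nhdsLT A.α0]
        with s hs1 hs
      rw [lt_div_iff₀ (hw.pos s hs)]
      have hDs := A.Dpos s hs
      calc a * w s ≤ a * (D s * (g α / μ)) := by gcongr
        _ = (a * g α) * D s / μ := by ring
        _ < μ * D s / μ := by gcongr
        _ = D s := by field_simp
  · rw [gt_iff_lt, div_lt_iff₀ hgα] at ha
    obtain ⟨μ, hμ1, hμ2⟩ := exists_between ha
    have hμ0 : 0 < μ := h1.trans_lt hμ1
    have hpos : 0 < (μ - r) * (μ - r') / μ :=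
      div_pos (mul_pos (by linarith) (by linarith)) hμ0
    filter_upwards [A.mul_D_le_near_α hw hμ0 (by linarith [hk μ hμ0]), Ioo_mem_nhdsLT A.α0]
      with s hs1 hs
    rw [div_lt_iff₀ (hw.pos s hs)]
    have hDs := A.Dpos s hs
    have ha0 : 0 < a := by
      have h5 : 0 < a * g α := hμ0.trans hμ2
      exact (pos_iff_pos_of_mul_pos h5).2 hgα
    calc D s = μ * D s / μ := by field_simp
      _ < (a * g α) * D s / μ := by gcongr
      _ = a * (D s * (g α / μ)) := by ring
      _ ≤ a * w s := by gcongr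

end NearAlpha

/-! ### From the weak equation to an equation for the flux -/

section Weak

variable {I : Set ℝ} {k ψ Y Y' : ℝ → ℝ}

lemma integrable_mul_of_tsupport_subset (hk : LocallyIntegrableOn k I)
    (hψ : Continuous ψ) (hc : HasCompactSupport ψ) (hs : tsupport ψ ⊆ I) :
    Integrable (fun x => k x * ψ x) := by
  have h1 : IntegrableOn k (tsupport ψ) := hk.integrableOn_compact_subset hs hc
  have h2 : IntegrableOn (fun x => k x * ψ x) (tsupport ψ) :=
    h1.mul_continuousOn hψ.continuousOn hc
  refine (integrableOn_iff_integrable_of_support_subset fun x hx => ?_).1 h2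
  exact subset_tsupport _ (right_ne_zero_of_mul hx)

lemma setIntegral_mul_eq (hs : tsupport ψ ⊆ I) :
    ∫ x in I, k x * ψ x = ∫ x, k x * ψ x :=
  setIntegral_eq_integral_of_forall_compl_eq_zero fun x hx => by
    rw [image_eq_zero_of_notMem_tsupport fun h => hx (hs h), mul_zero]

lemma tsupport_deriv_subset_tsupport (ψ : ℝ → ℝ) : tsupport (deriv ψ) ⊆ tsupport ψ :=
  closure_minimal support_deriv_subset (isClosed_tsupport ψ)

lemma continuous_deriv_of_smooth (h : ContDiff ℝ ∞ ψ) : Continuous (deriv ψ) :=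
  (contDiff_infty_iff_deriv.1 h).2.continuous

/-- Integration by parts against a test function. -/
lemma setIntegral_mul_deriv (hI : IsOpen I) (hY : ∀ ξ ∈ I, HasDerivAt Y (Y' ξ) ξ)
    (hY' : ContinuousOn Y' I) (hψ : ContDiff ℝ ∞ ψ) (hc : HasCompactSupport ψ)
    (hs : tsupport ψ ⊆ I) :
    ∫ ξ in I, Y ξ * deriv ψ ξ = -∫ ξ in I, Y' ξ * ψ ξ := by
  have hsd := (tsupport_deriv_subset_tsupport ψ).trans hs
  have hYc : ContinuousOn Y I := fun ξ hξ => (hY ξ hξ).continuousAt.continuousWithinAt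
  rw [setIntegral_mul_eq hs, setIntegral_mul_eq hsd]
  have hi1 := integrable_mul_of_tsupport_subset
    (hYc.locallyIntegrableOn (μ := volume) hI.measurableSet)
    (continuous_deriv_of_smooth hψ) hc.deriv hsd
  have hi2 := integrable_mul_of_tsupport_subset
    (hY'.locallyIntegrableOn (μ := volume) hI.measurableSet) hψ.continuous hc hs
  have hi3 := integrable_mul_of_tsupport_subset
    (hYc.locallyIntegrableOn (μ := volume) hI.measurableSet) hψ.continuous hc hs
  have hd : ∀ ξ, HasDerivAt (fun x => Y x * ψ x) (Y' ξ * ψ ξ + Y ξ * deriv ψ ξ) ξ := by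
    intro ξ
    by_cases h : ξ ∈ tsupport ψ
    · exact (hY ξ (hs h)).mul (hψ.differentiable (by simp) ξ).hasDerivAt
    · have h0 : ψ =ᶠ[𝓝 ξ] 0 := notMem_tsupport_iff_eventuallyEq.1 h
      rw [h0.eq_of_nhds, h0.deriv_eq]
      have : HasDerivAt (fun _ : ℝ => (0 : ℝ)) 0 ξ := hasDerivAt_const _ _
      refine (this.congr_of_eventuallyEq ?_).congr_deriv (by simp)
      filter_upwards [h0] with x hx
      simp [hx]
  have := integral_eq_zero_of_hasDerivAt_of_integrable hd (hi2.add hi1) hi3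
  rw [integral_add hi2 hi1] at this
  linarith

/-- A function with compact support in `I` and integral zero is the derivative of such a
function. -/
lemma exists_primitive_of_integral_eq_zero [I.OrdConnected] (hψ : ContDiff ℝ ∞ ψ)
    (hc : HasCompactSupport ψ) (hs : tsupport ψ ⊆ I) (h0 : ∫ x, ψ x = 0) :
    ∃ Ψ : ℝ → ℝ, ContDiff ℝ ∞ Ψ ∧ HasCompactSupport Ψ ∧ tsupport Ψ ⊆ I ∧ deriv Ψ = ψ := by
  rcases (tsupport ψ).eq_empty_or_nonempty with he | hne
  · have hz : ψ = 0 := tsupport_eq_empty_iff.1 he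
    refine ⟨0, contDiff_const, HasCompactSupport.zero, by simp, ?_⟩
    rw [hz]; exact deriv_const' 0
  set a := sInf (tsupport ψ)
  set b := sSup (tsupport ψ)
  have ha : a ∈ tsupport ψ := hc.isCompact.sInf_mem hne
  have hb : b ∈ tsupport ψ := hc.isCompact.sSup_mem hne
  have hsub : tsupport ψ ⊆ Icc a b := fun x hx =>
    ⟨csInf_le hc.isCompact.bddBelow hx, le_csSup hc.isCompact.bddAbove hx⟩
  have hz : ∀ x ∉ Icc a b, ψ x = 0 := fun x hx =>
    image_eq_zero_of_notMem_tsupport fun h => hx (hsub h)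
  have hψi : Integrable ψ := hψ.continuous.integrable_of_hasCompactSupport hc
  have hd : ∀ x, HasDerivAt (fun x => ∫ t in Iic x, ψ t) (ψ x) x := by
    intro x
    have h1 : (fun x => ∫ t in Iic x, ψ t) = fun x => (∫ t in Iic 0, ψ t) + ∫ t in (0:ℝ)..x, ψ t := by
      funext x
      rw [← intervalIntegral.integral_Iic_sub_Iic hψi.integrableOn hψi.integrableOn]; ring
    rw [h1]
    exact (intervalIntegral.integral_hasDerivAt_right (hψ.continuous.intervalIntegrable _ _)
      (hψ.continuous.stronglyMeasurableAtFilter _ _) hψ.continuous.continuousAt).const_add _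
  have hd' : deriv (fun x => ∫ t in Iic x, ψ t) = ψ := funext fun x => (hd x).deriv
  have hsupp : Function.support (fun x => ∫ t in Iic x, ψ t) ⊆ Icc a b := by
    intro x hx
    by_contra hxn
    apply hx
    rcases lt_or_ge x a with h | h
    · exact setIntegral_eq_zero_of_forall_eq_zero fun t ht =>
        hz t fun h' => absurd (h'.1.trans ht) (not_le.2 h)
    · have hbx : b < x := by
        by_contra! h'
        exact hxn ⟨h, h'⟩
      show ∫ t in Iic x, ψ t = 0
      rw [setIntegral_eq_integral_of_forall_compl_eq_zero, h0]
      intro t ht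
      exact hz t fun h' => ht (h'.2.trans hbx.le)
  refine ⟨fun x => ∫ t in Iic x, ψ t, ?_, ?_, ?_, hd'⟩
  · rw [contDiff_infty_iff_deriv, hd']
    exact ⟨fun x => (hd x).differentiableAt, hψ⟩
  · exact HasCompactSupport.of_support_subset_isCompact isCompact_Icc hsupp
  · exact (closure_minimal hsupp isClosed_Icc).trans (Set.OrdConnected.out ‹_› (hs ha) (hs hb))

/-- The lemma of du Bois-Reymond. -/
lemma ae_eq_const_of_integral_mul_deriv_eq_zero (hI : IsOpen I) [I.OrdConnected]
    (hk : LocallyIntegrableOn k I)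
    (h : ∀ ψ : ℝ → ℝ, ContDiff ℝ ∞ ψ → HasCompactSupport ψ → tsupport ψ ⊆ I →
      ∫ ξ in I, k ξ * deriv ψ ξ = 0) : ∃ C, ∀ᵐ ξ, ξ ∈ I → k ξ = C := by
  rcases I.eq_empty_or_nonempty with he | ⟨x₀, hx₀⟩
  · exact ⟨0, by simp [he]⟩
  obtain ⟨r, hr, hball⟩ := Metric.isOpen_iff.1 hI x₀ hx₀
  let bump : ContDiffBump x₀ := ⟨r / 4, r / 2, by positivity, by linarith⟩
  set η : ℝ → ℝ := bump.normed volume with hη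
  have hηd : ContDiff ℝ ∞ η := bump.contDiff_normed
  have hηc : HasCompactSupport η := bump.hasCompactSupport_normed
  have hηs : tsupport η ⊆ I := by
    rw [hη, bump.tsupport_normed_eq]
    exact (Metric.closedBall_subset_ball (show r / 2 < r by linarith)).trans hball
  have hη1 : ∫ x, η x = 1 := bump.integral_normed
  set C := ∫ x, k x * η x with hC
  have hkη := integrable_mul_of_tsupport_subset hk hηd.continuous hηc hηs
  -- test with `θ - (∫ θ) η`, which has integral zero and hence is a derivative
  refine ⟨C, ?_⟩
  have hloc : LocallyIntegrableOn (fun x => k x - C) I :=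
    hk.sub (continuousOn_const.locallyIntegrableOn hI.measurableSet)
  have := hI.ae_eq_zero_of_integral_contDiff_smul_eq_zero hloc ?_
  · filter_upwards [this] with x hx hxI
    linarith [hx hxI]
  intro θ hθ hθc hθs
  set m := ∫ x, θ x with hm
  have hkθ := integrable_mul_of_tsupport_subset hk hθ.continuous hθc hθs
  have hθi : Integrable θ := hθ.continuous.integrable_of_hasCompactSupport hθc
  have hηi : Integrable η := hηd.continuous.integrable_of_hasCompactSupport hηc
  have hζs : tsupport (fun x => θ x - m * η x) ⊆ tsupport θ ∪ tsupport η := by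
    refine closure_minimal (fun x hx => ?_) ((isClosed_tsupport _).union (isClosed_tsupport _))
    by_contra hn
    rw [mem_union, not_or] at hn
    apply hx
    simp [image_eq_zero_of_notMem_tsupport hn.1, image_eq_zero_of_notMem_tsupport hn.2]
  obtain ⟨Ψ, hΨ, hΨc, hΨs, hΨd⟩ := exists_primitive_of_integral_eq_zero (I := I)
    (ψ := fun x => θ x - m * η x) (hθ.sub (contDiff_const.mul hηd))
    (HasCompactSupport.of_support_subset_isCompact (hθc.isCompact.union hηc.isCompact)
      ((subset_tsupport _).trans hζs)) (hζs.trans (union_subset hθs hηs)) (by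
        rw [integral_sub hθi (hηi.const_mul m), integral_const_mul, hη1]; simp [hm])
  have h1 := h Ψ hΨ hΨc hΨs
  rw [hΨd] at h1
  rw [setIntegral_mul_eq (ψ := fun x => θ x - m * η x) (hζs.trans (union_subset hθs hηs))] at h1
  have e1 : (fun x => k x * (θ x - m * η x)) = fun x => k x * θ x - m * (k x * η x) := by
    funext x; ring
  rw [e1, integral_sub hkθ (hkη.const_mul m), integral_const_mul] at h1
  have e2 : (fun x => θ x • (k x - C)) = fun x => k x * θ x - C * θ x := by
    funext x; simp only [smul_eq_mul]; ring
  rw [e2, integral_sub hkθ (hθi.const_mul C), integral_const_mul]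
  linarith

lemma exists_primitive (hI : IsOpen I) [I.OrdConnected] (hk : ContinuousOn k I) :
    ∃ G : ℝ → ℝ, ∀ ξ ∈ I, HasDerivAt G (k ξ) ξ := by
  rcases I.eq_empty_or_nonempty with he | ⟨x₀, hx₀⟩
  · exact ⟨0, by simp [he]⟩
  refine ⟨fun x => ∫ t in x₀..x, k t, fun ξ hξ => ?_⟩
  refine intervalIntegral.integral_hasDerivAt_right ?_ ?_ (hk.continuousAt (hI.mem_nhds hξ))
  · exact (hk.mono (Set.OrdConnected.uIcc_subset ‹_› hx₀ hξ)).intervalIntegrable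
  · exact hk.stronglyMeasurableAtFilter hI ξ hξ

end Weak

/-- The equation of a profile in terms of the flux `Z = D(φ) φ'`: the derivative of `∫₀^φ D` is `Z`,
and `(Z - f(φ) + c φ)' = -g(φ)`, both in the classical sense. -/
structure Strong (D f g : ℝ → ℝ) (I : Set ℝ) (c : ℝ) (φ Z : ℝ → ℝ) : Prop where
  contφ : ContinuousOn φ I
  mapsTo : MapsTo φ I (Icc 0 1)
  contZ : ContinuousOn Z I
  derivP : ∀ ξ ∈ I, HasDerivAt (fun η => ∫ s in (0 : ℝ)..φ η, D s) (Z ξ) ξ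
  derivY : ∀ ξ ∈ I, HasDerivAt (fun η => Z η - f (φ η) + c * φ η) (-g (φ ξ)) ξ

section Strong

variable {D f g : ℝ → ℝ} {α c : ℝ} {I : Set ℝ} {φ Z : ℝ → ℝ}

lemma hasDerivWithinAt_prim (hD : ContinuousOn D (Icc 0 1)) {s : ℝ} (hs : s ∈ Icc (0 : ℝ) 1) :
    HasDerivWithinAt (fun x => ∫ t in (0 : ℝ)..x, D t) (D s) (Icc 0 1) s := by
  have hfact : Fact (s ∈ Icc (0 : ℝ) 1) := ⟨hs⟩
  refine intervalIntegral.integral_hasDerivWithinAt_right ?_ ?_ (hD s hs)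
  · exact (hD.mono (by rw [uIcc_of_le hs.1]; exact Icc_subset_Icc_right hs.2)).intervalIntegrable
  · exact hD.stronglyMeasurableAtFilter_nhdsWithin measurableSet_Icc s

lemma continuousOn_prim (hD : ContinuousOn D (Icc 0 1)) :
    ContinuousOn (fun x => ∫ t in (0 : ℝ)..x, D t) (Icc 0 1) := fun _ hs =>
  (hasDerivWithinAt_prim hD hs).continuousWithinAt

/-- At a point of differentiability the flux is `D(φ) φ'`. -/
lemma Strong.eq_mul_deriv (h : Strong D f g I c φ Z) (hD : ContinuousOn D (Icc 0 1))
    (hI : IsOpen I) {ξ p : ℝ} (hξ : ξ ∈ I) (hd : HasDerivAt φ p ξ) : Z ξ = D (φ ξ) * p := by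
  have h1 := (hasDerivWithinAt_prim hD (h.mapsTo hξ)).comp ξ hd.hasDerivWithinAt h.mapsTo
  exact (h.derivP ξ hξ).unique (h1.hasDerivAt (hI.mem_nhds hξ))

/-- A weak profile has a continuous flux.  The weak equation makes `D(φ) φ'` almost everywhere equal to
a continuous function `Z`, and `∫₀^φ D` is then a primitive of `Z`. -/
theorem IsTW.exists_strong (hD : ContinuousOn D (Icc 0 1)) (hf : ContinuousOn f (Icc 0 1))
    (hg : ContinuousOn g (Icc 0 1)) (hI : IsOpen I) [I.OrdConnected]
    (h : IsTW D f g I c φ) : ∃ Z, Strong D f g I c φ Z := by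
  have hφ := h.continuousOn
  have hfφ : ContinuousOn (fun ξ => f (φ ξ)) I := hf.comp hφ h.mapsTo
  have hgφ : ContinuousOn (fun ξ => g (φ ξ)) I := hg.comp hφ h.mapsTo
  have hPφ : ContinuousOn (fun ξ => ∫ s in (0 : ℝ)..φ ξ, D s) I :=
    (continuousOn_prim hD).comp hφ h.mapsTo
  obtain ⟨G, hG⟩ := exists_primitive hI hgφ
  have hGc : ContinuousOn G I := fun ξ hξ => (hG ξ hξ).continuousAt.continuousWithinAt
  have hm := hI.measurableSet
  set u : ℝ → ℝ := fun ξ => D (φ ξ) * deriv φ ξ with hu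
  have hu0 : LocallyIntegrableOn (fun ξ => u ξ - f (φ ξ) + c * φ ξ) I :=
    (h.locallyIntegrable.sub (hfφ.locallyIntegrableOn hm)).add
      ((continuousOn_const.mul hφ).locallyIntegrableOn hm)
  obtain ⟨C, hC⟩ := ae_eq_const_of_integral_mul_deriv_eq_zero hI
    (k := fun ξ => (u ξ - f (φ ξ) + c * φ ξ) + G ξ)
    (hu0.add (hGc.locallyIntegrableOn hm)) (by
      intro ψ hψ hc hs
      have hsd := (tsupport_deriv_subset_tsupport ψ).trans hs
      have h1 := h.weak_eq ψ hψ hc hs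
      have h2 := setIntegral_mul_deriv hI hG hgφ hψ hc hs
      have i1 := integrable_mul_of_tsupport_subset hu0 (continuous_deriv_of_smooth hψ)
        hc.deriv hsd
      have i2 := integrable_mul_of_tsupport_subset (hgφ.locallyIntegrableOn hm)
        hψ.continuous hc hs
      have i3 := integrable_mul_of_tsupport_subset (hGc.locallyIntegrableOn hm)
        (continuous_deriv_of_smooth hψ) hc.deriv hsd
      rw [integral_sub i1.integrableOn i2.integrableOn] at h1
      simp only [add_mul _ (G _)]
      rw [integral_add i1.integrableOn i3.integrableOn, h2]
      linarith)
  set Z : ℝ → ℝ := fun ξ => f (φ ξ) - c * φ ξ - G ξ + C with hZ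
  have hZu : ∀ᵐ ξ, ξ ∈ I → u ξ = Z ξ := by
    filter_upwards [hC] with ξ hξ hξI
    have := hξ hξI
    simp only [hZ]; linarith
  have hZc : ContinuousOn Z I :=
    ((hfφ.sub (continuousOn_const.mul hφ)).sub hGc).add continuousOn_const
  obtain ⟨A, hA⟩ := exists_primitive hI hZc
  have hAc : ContinuousOn A I := fun ξ hξ => (hA ξ hξ).continuousAt.continuousWithinAt
  obtain ⟨C', hC'⟩ := ae_eq_const_of_integral_mul_deriv_eq_zero hI
    (k := fun ξ => (∫ s in (0 : ℝ)..φ ξ, D s) - A ξ)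
    ((hPφ.sub hAc).locallyIntegrableOn hm) (by
      intro ψ hψ hc hs
      have hsd := (tsupport_deriv_subset_tsupport ψ).trans hs
      have h1 := h.weak_deriv ψ hψ hc hs
      have h2 := setIntegral_mul_deriv hI hA hZc hψ hc hs
      have h3 : ∫ ξ in I, u ξ * ψ ξ = ∫ ξ in I, Z ξ * ψ ξ := by
        refine setIntegral_congr_ae hm ?_
        filter_upwards [hZu] with ξ hξ hξI
        rw [hξ hξI]
      have i1 := integrable_mul_of_tsupport_subset (hPφ.locallyIntegrableOn hm)
        (continuous_deriv_of_smooth hψ) hc.deriv hsd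
      have i2 := integrable_mul_of_tsupport_subset (hAc.locallyIntegrableOn hm)
        (continuous_deriv_of_smooth hψ) hc.deriv hsd
      simp only [sub_mul]
      rw [integral_sub i1.integrableOn i2.integrableOn, h1, h2, ← h3]
      simp [hu])
  have hPA : EqOn (fun ξ => ∫ s in (0 : ℝ)..φ ξ, D s) (fun ξ => A ξ + C') I := by
    refine Measure.eqOn_open_of_ae_eq (μ := volume) ?_ hI hPφ (hAc.add continuousOn_const)
    rw [EventuallyEq, ae_restrict_iff' hm]
    filter_upwards [hC'] with ξ hξ hξI
    linarith [hξ hξI]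
  refine ⟨Z, hφ, h.mapsTo, hZc, fun ξ hξ => ?_, fun ξ hξ => ?_⟩
  · exact ((hA ξ hξ).add_const C').congr_of_eventuallyEq
      (hPA.eventuallyEq_of_mem (hI.mem_nhds hξ))
  · have : (fun η => Z η - f (φ η) + c * φ η) = fun η => C - G η := by
      funext η; simp only [hZ]; ring
    rw [this]
    exact (hG ξ hξ).const_sub C

/-- Conversely the equations for the flux give the weak ones; differentiability almost everywhere has
to be supplied. -/
theorem Strong.isTW (hD : ContinuousOn D (Icc 0 1)) (hf : ContinuousOn f (Icc 0 1))
    (hg : ContinuousOn g (Icc 0 1)) (hI : IsOpen I) (h : Strong D f g I c φ Z)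
    (hd : ∀ᵐ ξ ∂(volume.restrict I), DifferentiableAt ℝ φ ξ) : IsTW D f g I c φ := by
  have hφ := h.contφ
  have hm := hI.measurableSet
  have hfφ : ContinuousOn (fun ξ => f (φ ξ)) I := hf.comp hφ h.mapsTo
  have hgφ : ContinuousOn (fun ξ => g (φ ξ)) I := hg.comp hφ h.mapsTo
  have hae : ∀ᵐ ξ ∂(volume.restrict I), Z ξ = D (φ ξ) * deriv φ ξ := by
    filter_upwards [hd, ae_restrict_mem hm] with ξ h1 h2
    exact h.eq_mul_deriv hD hI h2 h1.hasDerivAt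
  refine ⟨hφ, h.mapsTo, hd, ?_, fun ψ hψ hc hs => ?_, fun ψ hψ hc hs => ?_⟩
  · exact (h.contZ.locallyIntegrableOn hm).congr hae
  · rw [setIntegral_mul_deriv hI h.derivP h.contZ hψ hc hs]
    congr 1
    refine integral_congr_ae ?_
    filter_upwards [hae] with ξ hξ
    rw [hξ]
  · have hsd := (tsupport_deriv_subset_tsupport ψ).trans hs
    have h1 := setIntegral_mul_deriv hI h.derivY hgφ.neg hψ hc hs
    have hYc : ContinuousOn (fun η => Z η - f (φ η) + c * φ η) I :=
      fun ξ hξ => (h.derivY ξ hξ).continuousAt.continuousWithinAt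
    have i1 := integrable_mul_of_tsupport_subset (hYc.locallyIntegrableOn (μ := volume) hm)
      (continuous_deriv_of_smooth hψ) hc.deriv hsd
    have i2 := integrable_mul_of_tsupport_subset (hgφ.locallyIntegrableOn (μ := volume) hm)
      hψ.continuous hc hs
    have h2 : ∫ ξ in I, ((D (φ ξ) * deriv φ ξ - f (φ ξ) + c * φ ξ) * deriv ψ ξ - g (φ ξ) * ψ ξ)
        = ∫ ξ in I, ((Z ξ - f (φ ξ) + c * φ ξ) * deriv ψ ξ - g (φ ξ) * ψ ξ) := by
      refine integral_congr_ae ?_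
      filter_upwards [hae] with ξ hξ
      rw [hξ]
    rw [h2, integral_sub i1.integrableOn i2.integrableOn, h1]
    simp only [neg_mul, integral_neg, neg_neg, sub_self]

end Strong

/-! ### Arcs of a profile below the level `α` -/

section Arc

variable {D f g : ℝ → ℝ} {α c a : ℝ} {I J : Set ℝ} {φ Z w : ℝ → ℝ}

lemma Strong.mono (h : Strong D f g I c φ Z) (hJ : J ⊆ I) : Strong D f g J c φ Z :=
  ⟨h.contφ.mono hJ, h.mapsTo.mono_left hJ, h.contZ.mono hJ, fun ξ hξ => h.derivP ξ (hJ hξ),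
    fun ξ hξ => h.derivY ξ (hJ hξ)⟩

/-- The reflection `ξ ↦ -ξ` turns a profile for `(c, f)` into one for `(-c, -f)`. -/
lemma Strong.neg (h : Strong D f g I c φ Z) :
    Strong D (fun s => -f s) g (-I) (-c) (fun ξ => φ (-ξ)) (fun ξ => -Z (-ξ)) := by
  have hm : MapsTo (fun ξ : ℝ => -ξ) (-I) I := fun ξ hξ => hξ
  refine ⟨h.contφ.comp continuous_neg.continuousOn hm, fun ξ hξ => h.mapsTo (hm hξ),
    (h.contZ.comp continuous_neg.continuousOn hm).neg, fun ξ hξ => ?_, fun ξ hξ => ?_⟩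
  · have := (h.derivP (-ξ) (hm hξ)).comp ξ (hasDerivAt_neg ξ)
    simpa [Function.comp_def] using this
  · have := ((h.derivY (-ξ) (hm hξ)).comp ξ (hasDerivAt_neg ξ)).neg
    refine (this.congr_of_eventuallyEq (Eventually.of_forall fun η => ?_)).congr_deriv (by simp)
    simp only [Function.comp_def, Pi.neg_apply]
    ring

/-- Where the equation is not degenerate, the profile is differentiable. -/
lemma Strong.hasDerivAt (h : Strong D f g I c φ Z) (hD : ContinuousOn D (Icc 0 1)) {ξ : ℝ}
    (hI : IsOpen I) (hξ : ξ ∈ I) (h01 : φ ξ ∈ Ioo (0 : ℝ) 1) (hD0 : D (φ ξ) ≠ 0) :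
    HasDerivAt φ (Z ξ / D (φ ξ)) ξ := by
  set P : ℝ → ℝ := fun x => ∫ t in (0 : ℝ)..x, D t with hP
  have hPd : HasDerivAt P (D (φ ξ)) (φ ξ) :=
    (hasDerivWithinAt_prim hD (Ioo_subset_Icc_self h01)).hasDerivAt (Icc_mem_nhds h01.1 h01.2)
  have hφc : ContinuousAt φ ξ := h.contφ.continuousAt (hI.mem_nhds hξ)
  have hsl : ContinuousAt (dslope P (φ ξ)) (φ ξ) :=
    continuousAt_dslope_same.2 hPd.differentiableAt
  have hsl0 : dslope P (φ ξ) (φ ξ) = D (φ ξ) := by rw [dslope_same, hPd.deriv]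
  have ht : Tendsto (fun η => dslope P (φ ξ) (φ η)) (𝓝[≠] ξ) (𝓝 (D (φ ξ))) := by
    have := hsl.tendsto.comp hφc.tendsto
    rw [hsl0] at this
    exact this.mono_left nhdsWithin_le_nhds
  have h1 := hasDerivAt_iff_tendsto_slope.1 (h.derivP ξ hξ)
  rw [hasDerivAt_iff_tendsto_slope]
  refine (h1.div ht hD0).congr' ?_
  filter_upwards [ht.eventually_ne hD0] with η hη
  have h2 := sub_smul_dslope P (φ ξ) (φ η)
  rw [smul_eq_mul] at h2
  show slope (fun η => P (φ η)) ξ η / dslope P (φ ξ) (φ η) = slope φ ξ η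
  rw [slope_def_field, slope_def_field, ← h2]
  field_simp

lemma Strong.hasDerivAt_flux (A : Data D f g α) (h : Strong D f g I c φ Z) {ξ p : ℝ} (hξ : ξ ∈ I)
    (h01 : φ ξ ∈ Ioo (0 : ℝ) 1) (hφ : HasDerivAt φ p ξ) :
    HasDerivAt Z ((dot f (φ ξ) - c) * p - g (φ ξ)) ξ := by
  have h1 := ((h.derivY ξ hξ).add ((hasDerivAt_dot A.hf.1 h01).comp ξ hφ)).sub (hφ.const_mul c)
  refine (h1.congr_of_eventuallyEq (Eventually.of_forall fun η => ?_)).congr_deriv (by ring)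
  simp only [Function.comp_def, Pi.add_apply, Pi.sub_apply]
  ring

lemma Data.D_ne_zero (A : Data D f g α) {s : ℝ} (hs : s ∈ Ioo (0 : ℝ) 1) (hα : s ≠ α) :
    D s ≠ 0 := by
  rcases lt_or_gt_of_ne hα with h | h
  · exact (A.Dpos s ⟨hs.1, h⟩).ne'
  · exact (A.Dneg s ⟨h, hs.2⟩).ne

/-- The primitive of `D` is nonnegative on `[0,α]` and has its maximum on `[0,1]` at `α`. -/
lemma Data.prim_nonneg (A : Data D f g α) {s : ℝ} (hs : s ∈ Icc 0 α) :
    0 ≤ ∫ t in (0 : ℝ)..s, D t := by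
  refine intervalIntegral.integral_nonneg hs.1 fun t ht => ?_
  rcases eq_or_lt_of_le ht.1 with h0 | h0
  · rw [← h0]; exact A.D0
  rcases eq_or_lt_of_le (ht.2.trans hs.2) with h1 | h1
  · rw [h1, A.Dα]
  exact (A.Dpos t ⟨h0, h1⟩).le

lemma Data.prim_le (A : Data D f g α) {s : ℝ} (hs : s ∈ Icc (0 : ℝ) 1) :
    (∫ t in (0 : ℝ)..s, D t) ≤ ∫ t in (0 : ℝ)..α, D t := by
  have hi : ∀ x ∈ Icc (0 : ℝ) 1, IntervalIntegrable D volume 0 x := fun x hx =>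
    (A.contD.mono (by rw [uIcc_of_le hx.1]; exact Icc_subset_Icc_right hx.2)).intervalIntegrable
  have h1 := intervalIntegral.integral_interval_sub_left (hi α (Ioo_subset_Icc_self A.mem_α))
    (hi s hs)
  suffices 0 ≤ ∫ t in s..α, D t by linarith
  rcases le_total s α with h | h
  · refine intervalIntegral.integral_nonneg h fun t ht => ?_
    rcases eq_or_lt_of_le (hs.1.trans ht.1) with h0 | h0
    · rw [← h0]; exact A.D0
    rcases eq_or_lt_of_le ht.2 with h2 | h2
    · rw [h2, A.Dα]
    exact (A.Dpos t ⟨h0, h2⟩).le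
  · rw [intervalIntegral.integral_symm, ← intervalIntegral.integral_neg]
    refine intervalIntegral.integral_nonneg h fun t ht => ?_
    rcases eq_or_lt_of_le ht.1 with h0 | h0
    · rw [← h0, A.Dα]; simp
    have hle : Tendsto D (𝓝[Ioo α 1] t) (𝓝 (D t)) := by
      exact (A.contD t ⟨(A.α0.trans h0).le, ht.2.trans hs.2⟩).mono_left
        (nhdsWithin_mono _ fun x hx => ⟨(A.α0.trans hx.1).le, hx.2.le⟩)
    have hne : (𝓝[Ioo α 1] t).NeBot := by
      rw [← mem_closure_iff_nhdsWithin_neBot, closure_Ioo A.α1.ne]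
      exact ⟨h0.le, ht.2.trans hs.2⟩
    have : D t ≤ 0 := le_of_tendsto hle (by
      filter_upwards [self_mem_nhdsWithin] with x hx using (A.Dneg x hx).le)
    linarith

/-- At the level `α` the primitive of `D` is maximal, so its derivative along the profile vanishes. -/
lemma Strong.flux_eq_zero_of_eq_α (A : Data D f g α) (h : Strong D f g I c φ Z) (hI : IsOpen I)
    {ξ : ℝ} (hξ : ξ ∈ I) (hα : φ ξ = α) : Z ξ = 0 := by
  refine IsLocalMax.hasDerivAt_eq_zero ?_ (h.derivP ξ hξ)
  filter_upwards [hI.mem_nhds hξ] with η hη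
  rw [hα]
  exact A.prim_le (h.mapsTo hη)

lemma Strong.flux_eq_zero_of_eq_zero (A : Data D f g α) (h : Strong D f g I c φ Z) (hI : IsOpen I)
    {ξ : ℝ} (hξ : ξ ∈ I) (h0 : φ ξ = 0) (hα : ∀ᶠ η in 𝓝 ξ, φ η ≤ α) : Z ξ = 0 := by
  refine IsLocalMin.hasDerivAt_eq_zero ?_ (h.derivP ξ hξ)
  filter_upwards [hI.mem_nhds hξ, hα] with η hη hηα
  rw [h0, intervalIntegral.integral_same]
  exact A.prim_nonneg ⟨(h.mapsTo hη).1, hηα⟩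

/-- The points right of `a` up to which the profile stays positive. -/
def arc (φ : ℝ → ℝ) (a : ℝ) : Set ℝ := {ξ | a < ξ ∧ ∀ η ∈ Ioc a ξ, 0 < φ η}

/-- A profile on `(a,∞)` that starts at the level `α` and stays below it. -/
structure Below (D f g : ℝ → ℝ) (α c a : ℝ) (φ Z : ℝ → ℝ) : Prop where
  strong : Strong D f g (Ioi a) c φ Z
  lt : ∀ ξ ∈ Ioi a, φ ξ < α
  lim : Tendsto φ (𝓝[>] a) (𝓝 α)

lemma arc_mono {ξ η : ℝ} (hξ : ξ ∈ arc φ a) (hη : η ∈ Ioc a ξ) : η ∈ arc φ a :=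
  ⟨hη.1, fun t ht => hξ.2 t ⟨ht.1, ht.2.trans hη.2⟩⟩

lemma Below.mem_Ioo (B : Below D f g α c a φ Z) {ξ : ℝ} (hξ : ξ ∈ arc φ a) : φ ξ ∈ Ioo 0 α :=
  ⟨hξ.2 ξ ⟨hξ.1, le_rfl⟩, B.lt ξ hξ.1⟩

lemma Below.hasDerivAt (B : Below D f g α c a φ Z) (A : Data D f g α) {ξ : ℝ} (hξ : ξ ∈ Ioi a)
    (h0 : 0 < φ ξ) : HasDerivAt φ (Z ξ / D (φ ξ)) ξ := by
  have h := A.mem_of_lt ⟨h0, B.lt ξ hξ⟩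
  exact B.strong.hasDerivAt A.contD isOpen_Ioi hξ h (A.D_ne_zero h (B.lt ξ hξ).ne)

lemma Below.hasDerivAt_flux (B : Below D f g α c a φ Z) (A : Data D f g α) {ξ : ℝ}
    (hξ : ξ ∈ Ioi a) (h0 : 0 < φ ξ) :
    HasDerivAt Z ((dot f (φ ξ) - c) * (Z ξ / D (φ ξ)) - g (φ ξ)) ξ :=
  B.strong.hasDerivAt_flux A hξ (A.mem_of_lt ⟨h0, B.lt ξ hξ⟩) (B.hasDerivAt A hξ h0)

/-- At its zeros the flux is strictly decreasing, so it has at most one sign change; were it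
nonnegative somewhere, the profile would increase from its limit `α`. -/
lemma Below.flux_neg (B : Below D f g α c a φ Z) (A : Data D f g α) {ξ : ℝ} (hξ : ξ ∈ arc φ a) :
    Z ξ < 0 := by
  by_contra! hZ
  have hpos : ∀ η ∈ Ioo a ξ, 0 < Z η := by
    intro η hη
    by_contra! hle
    have hmem : ∀ t ∈ Icc η ξ, t ∈ Ioc a ξ := fun t ht => ⟨hη.1.trans_le ht.1, ht.2⟩
    have hd : ∀ t ∈ Icc η ξ, HasDerivAt Z ((dot f (φ t) - c) * (Z t / D (φ t)) - g (φ t)) t :=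
      fun t ht => B.hasDerivAt_flux A (hmem t ht).1 (hξ.2 t (hmem t ht))
    have hzero : ∀ t ∈ Icc η ξ, Z t = 0 →
        (dot f (φ t) - c) * (Z t / D (φ t)) - g (φ t) < 0 := by
      intro t ht h0
      rw [h0, zero_div, mul_zero, zero_sub, neg_lt_zero]
      exact A.gpos _ (A.mem_of_lt (B.mem_Ioo (arc_mono hξ (hmem t ht))))
    have hle' : ∀ t ∈ Icc η ξ, Z t ≤ 0 := fun t ht =>
      image_le_of_deriv_right_lt_deriv_boundary (f := Z) (B := fun _ => 0) (B' := fun _ => 0)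
        (fun t ht => (hd t ht).continuousAt.continuousWithinAt)
        (fun t ht => (hd t (Ico_subset_Icc_self ht)).hasDerivWithinAt) hle
        (fun t => hasDerivAt_const _ _)
        (fun t ht h0 => hzero t (Ico_subset_Icc_self ht) h0) ht
    have hξm : ξ ∈ Icc η ξ := ⟨hη.2.le, le_rfl⟩
    have hξ0 : Z ξ = 0 := le_antisymm (hle' ξ hξm) hZ
    have h1 := hzero ξ hξm hξ0
    have h2 := (hasDerivAt_iff_tendsto_slope.1 (hd ξ hξm)).mono_left
      (nhdsWithin_mono ξ (show Iio ξ ⊆ {ξ}ᶜ from fun s hs => ne_of_lt hs))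
    have h3 : ∀ᶠ t in 𝓝[<] ξ, 0 ≤ slope Z ξ t := by
      filter_upwards [Ioo_mem_nhdsLT hη.2] with t ht
      rw [slope_def_field, hξ0, sub_zero]
      exact div_nonneg_of_nonpos (hle' t ⟨ht.1.le, ht.2.le⟩) (by linarith [ht.2])
    linarith [ge_of_tendsto h2 h3]
  have hmono : ∀ η ∈ Ioo a ξ, φ η ≤ φ ξ := by
    intro η hη
    have hmem : ∀ t ∈ Icc η ξ, t ∈ Ioc a ξ := fun t ht => ⟨hη.1.trans_le ht.1, ht.2⟩
    have := mul_le_sub_of_le_deriv (C := 0) hη.2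
      (fun t ht => B.hasDerivAt A (hmem t ht).1 (hξ.2 t (hmem t ht))) (fun t ht => by
        have h1 := hpos t ⟨hη.1.trans ht.1, ht.2⟩
        have h2 := A.Dpos _ (B.mem_Ioo (arc_mono hξ (hmem t (Ioo_subset_Icc_self ht))))
        positivity)
    linarith
  have h1 : α ≤ φ ξ := le_of_tendsto B.lim (by
    filter_upwards [Ioo_mem_nhdsGT hξ.1] with η hη using hmono η hη)
  exact absurd h1 (not_le.2 (B.lt ξ hξ.1))

lemma Below.anti (B : Below D f g α c a φ Z) (A : Data D f g α) {ξ η : ℝ} (hξ : ξ ∈ arc φ a)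
    (hη : η ∈ Ioo a ξ) : φ ξ ≤ φ η := by
  have hmem : ∀ t ∈ Icc η ξ, t ∈ Ioc a ξ := fun t ht => ⟨hη.1.trans_le ht.1, ht.2⟩
  have := sub_le_mul_of_deriv_le (C := 0) hη.2
    (fun t ht => B.hasDerivAt A (hmem t ht).1 (hξ.2 t (hmem t ht))) (fun t ht => by
      have h1 := B.flux_neg A (arc_mono hξ (hmem t (Ioo_subset_Icc_self ht)))
      have h2 := A.Dpos _ (B.mem_Ioo (arc_mono hξ (hmem t (Ioo_subset_Icc_self ht))))
      exact (div_neg_of_neg_of_pos h1 h2).le)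
  linarith

lemma Below.exists_pos (B : Below D f g α c a φ Z) (A : Data D f g α) :
    ∃ b > a, b ∈ arc φ a := by
  have h := B.lim.eventually (lt_mem_nhds A.α0)
  obtain ⟨u, hu, hu'⟩ := (mem_nhdsGT_iff_exists_Ioo_subset).1 h
  obtain ⟨b, hb⟩ := nonempty_Ioo.2 (show a < u from hu)
  exact ⟨b, hb.1, hb.1, fun η hη => hu' ⟨hη.1, hη.2.trans_lt hb.2⟩⟩

/-- Along the arc profile and flux become small: either the profile reaches `0`, where the flux
vanishes, or the arc is unbounded and a positive lower bound for the profile would force the flux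
to `-∞`. -/
lemma Below.exists_small (B : Below D f g α c a φ Z) (A : Data D f g α) {ε : ℝ} (hε : 0 < ε) :
    ∃ ξ ∈ arc φ a, φ ξ < ε ∧ -Z ξ < ε := by
  obtain ⟨b, hab, hb⟩ := B.exists_pos A
  by_cases hzero : ∃ ξ ≥ b, φ ξ = 0
  · set S := Ici b ∩ φ ⁻¹' {0} with hS
    have hSc : IsClosed S :=
      (B.strong.contφ.mono fun t ht => hab.trans_le ht).preimage_isClosed_of_isClosed
        isClosed_Ici isClosed_singleton
    have hSne : S.Nonempty := by
      obtain ⟨ξ, h1, h2⟩ := hzero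
      exact ⟨ξ, h1, h2⟩
    have hSb : BddBelow S := ⟨b, fun t ht => ht.1⟩
    have he : sInf S ∈ S := hSc.csInf_mem hSne hSb
    set e := sInf S
    have he0 : φ e = 0 := he.2
    have hae : a < e := hab.trans_le he.1
    have harc : ∀ ξ ∈ Ioo a e, ξ ∈ arc φ a := by
      intro ξ hξ
      refine ⟨hξ.1, fun η hη => ?_⟩
      rcases le_or_gt η b with h | h
      · exact hb.2 η ⟨hη.1, h⟩
      · refine lt_of_le_of_ne (B.strong.mapsTo hη.1).1 fun h0 => ?_
        exact absurd (csInf_le hSb ⟨h.le, h0.symm⟩) (not_le.2 (hη.2.trans_lt hξ.2))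
    have hZe : Z e = 0 := B.strong.flux_eq_zero_of_eq_zero A isOpen_Ioi hae he0 (by
      filter_upwards [Ioi_mem_nhds hae] with η hη using (B.lt η hη).le)
    have h1 : Tendsto φ (𝓝[<] e) (𝓝 0) := by
      rw [← he0]
      exact (B.strong.contφ.continuousAt (Ioi_mem_nhds hae)).tendsto.mono_left nhdsWithin_le_nhds
    have h2 : Tendsto (fun ξ => -Z ξ) (𝓝[<] e) (𝓝 0) := by
      rw [show (0 : ℝ) = -Z e by rw [hZe, neg_zero]]
      exact ((B.strong.contZ.continuousAt
        (Ioi_mem_nhds hae)).neg).tendsto.mono_left nhdsWithin_le_nhds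
    obtain ⟨ξ, h3, h4, h5⟩ := ((h1.eventually (gt_mem_nhds hε)).and
      ((h2.eventually (gt_mem_nhds hε)).and (Ioo_mem_nhdsLT hae))).exists
    exact ⟨ξ, harc ξ h5, h3, h4⟩
  · push Not at hzero
    have harc : ∀ ξ > a, ξ ∈ arc φ a := by
      intro ξ hξ
      refine ⟨hξ, fun η hη => ?_⟩
      rcases le_or_gt η b with h | h
      · exact hb.2 η ⟨hη.1, h⟩
      · exact lt_of_le_of_ne (B.strong.mapsTo hη.1).1 (hzero η h.le).symm
    set P : ℝ → ℝ := fun η => ∫ s in (0 : ℝ)..φ η, D s with hP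
    have hP0 : ∀ ξ > a, 0 ≤ P ξ := fun ξ hξ =>
      A.prim_nonneg ⟨(B.strong.mapsTo hξ).1, (B.lt ξ hξ).le⟩
    -- the flux is small at arbitrarily large points
    have hsmall : ∀ δ > 0, ∀ x > a, ∃ ξ > x, -Z ξ < δ := by
      intro δ hδ x hx
      by_contra! hcon
      obtain ⟨n, hn⟩ := exists_nat_gt (P x / δ)
      have hn0 : 0 < (n : ℝ) := (div_nonneg (hP0 x hx) hδ.le).trans_lt hn
      have h1 := sub_le_mul_of_deriv_le (w := P) (C := -δ) (show x < x + n by linarith)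
        (fun t ht => B.strong.derivP t (hx.trans_le ht.1)) (fun t ht => by
          have := hcon t ht.1; linarith)
      have h2 := hP0 (x + n) (by linarith)
      rw [div_lt_iff₀ hδ] at hn
      nlinarith
    by_cases hφ : ∃ x > a, φ x < ε
    · obtain ⟨x, hx, hxε⟩ := hφ
      obtain ⟨ξ, hξ, hξZ⟩ := hsmall ε hε x hx
      exact ⟨ξ, harc ξ (hx.trans hξ), (B.anti A (harc ξ (hx.trans hξ)) ⟨hx, hξ⟩).trans_lt hxε, hξZ⟩
    -- with `φ ≥ ε` the source `g(φ)` stays away from zero, and `Y` would tend to `-∞`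
    · exfalso
      push Not at hφ
      have hsub : Icc ε (φ b) ⊆ Ioo (0 : ℝ) 1 := fun s hs =>
        ⟨hε.trans_le hs.1, hs.2.trans_lt ((B.lt b hab).trans A.α1)⟩
      obtain ⟨s₀, hs₀, hmin⟩ := isCompact_Icc.exists_isMinOn (nonempty_Icc.2 (hφ b hab))
        (A.contg.mono (hsub.trans Ioo_subset_Icc_self))
      have hm := A.gpos s₀ (hsub hs₀)
      obtain ⟨K, hK⟩ := isCompact_Icc.exists_bound_of_continuousOn
        (A.contf.sub ((continuousOn_const (c := c)).mul continuousOn_id))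
      have hK' : ∀ s ∈ Icc (0 : ℝ) 1, |f s - c * s| ≤ K := hK
      set Y : ℝ → ℝ := fun η => Z η - f (φ η) + c * φ η with hY
      obtain ⟨n, hn⟩ := exists_nat_gt ((Y b + 1 + K) / g s₀)
      obtain ⟨ξ, hξ, hξZ⟩ := hsmall 1 one_pos (b + n) (by
        have : (0 : ℝ) ≤ n := n.cast_nonneg
        linarith)
      have hbξ : b < ξ := by
        have : (0 : ℝ) ≤ n := n.cast_nonneg
        linarith
      have h1 := sub_le_mul_of_deriv_le (w := Y) (C := -g s₀) hbξ
        (fun t ht => B.strong.derivY t (hab.trans_le ht.1)) (fun t ht => by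
          have hat : a < t := hab.trans ht.1
          have : g s₀ ≤ g (φ t) := hmin (show φ t ∈ Icc ε (φ b) from
            ⟨hφ t hat, B.anti A (harc t hat) ⟨hab, ht.1⟩⟩)
          linarith)
      have h2 := abs_le.1 (hK' (φ ξ) (B.strong.mapsTo (hab.trans hbξ)))
      have h3 : Y ξ = Z ξ - (f (φ ξ) - c * φ ξ) := by simp only [hY]; ring
      rw [div_lt_iff₀ hm] at hn
      nlinarith [h2.2]

/-- The defect `d = w(φ) + Z` between the flux and the solution of the first-order problem obeys
`d' = -(g(φ) / w(φ)) d`. -/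
lemma Below.hasDerivAt_defect (B : Below D f g α c a φ Z) (A : Data D f g α)
    (hw : IsSol (fun s => D s * g s) (dot f) α c w) {ξ : ℝ} (hξ : ξ ∈ arc φ a) :
    HasDerivAt (fun ξ => w (φ ξ) + Z ξ) (-(g (φ ξ) / w (φ ξ) * (w (φ ξ) + Z ξ))) ξ := by
  have hm := B.mem_Ioo hξ
  have h0 : 0 < φ ξ := hm.1
  have h1 := ((hw.deriv _ hm).comp ξ (B.hasDerivAt A hξ.1 h0)).add (B.hasDerivAt_flux A hξ.1 h0)
  refine h1.congr_deriv ?_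
  have h2 := (A.Dpos _ hm).ne'
  have h3 := (hw.pos _ hm).ne'
  field_simp
  ring

lemma le_of_hasDerivAt_neg_mul {d k : ℝ → ℝ} {x y : ℝ} (hxy : x ≤ y)
    (hd : ∀ t ∈ Icc x y, HasDerivAt d (-(k t * d t)) t) (hk : ∀ t ∈ Icc x y, 0 ≤ k t)
    (hy : 0 < d y) : d y ≤ d x := by
  have hm : ∀ t ∈ Icc (-y) (-x), -t ∈ Icc x y := fun t ht =>
    ⟨by linarith [ht.2], by linarith [ht.1]⟩
  have h1 : ∀ t ∈ Icc (-y) (-x), HasDerivAt (fun t => d (-t)) (k (-t) * d (-t)) t := by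
    intro t ht
    have := (hd _ (hm t ht)).comp t (hasDerivAt_neg t)
    refine this.congr_deriv (by ring)
  have := le_of_deriv_nonneg_of_pos (d := fun t => d (-t)) (d' := fun t => k (-t) * d (-t))
    (neg_le_neg hxy) (fun t ht => (h1 t ht).continuousAt.continuousWithinAt)
    (fun t ht => h1 t (Ioo_subset_Icc_self ht))
    (fun t ht h0 => mul_nonneg (hk _ (hm t (Ioo_subset_Icc_self ht))) h0.le)
    (by simpa using hy)
  simpa using this

lemma Below.tendsto_w (B : Below D f g α c a φ Z) (A : Data D f g α)
    (hw : IsSol (fun s => D s * g s) (dot f) α c w) :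
    Tendsto (fun ξ => w (φ ξ)) (𝓝[>] a) (𝓝 0) := by
  rw [← hw.zero]
  refine (hw.cont α ⟨A.α0, le_rfl⟩).tendsto.comp (tendsto_nhdsWithin_iff.2 ⟨B.lim, ?_⟩)
  obtain ⟨b, hab, hb⟩ := B.exists_pos A
  filter_upwards [Ioo_mem_nhdsGT hab] with ξ hξ
  have := B.mem_Ioo (arc_mono hb ⟨hξ.1, hξ.2.le⟩)
  exact ⟨this.1, this.2.le⟩

/-- The defect cannot be positive: it grows backward in time, while it is at most `w(φ) → 0` at `a`. -/
lemma Below.w_le (B : Below D f g α c a φ Z) (A : Data D f g α)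
    (hw : IsSol (fun s => D s * g s) (dot f) α c w) {ξ : ℝ} (hξ : ξ ∈ arc φ a) :
    w (φ ξ) ≤ -Z ξ := by
  by_contra! hlt
  have h1 : ∀ᶠ η in 𝓝[>] a, w (φ ξ) + Z ξ ≤ w (φ η) := by
    filter_upwards [Ioo_mem_nhdsGT hξ.1] with η hη
    have hmem : ∀ t ∈ Icc η ξ, t ∈ arc φ a := fun t ht => arc_mono hξ ⟨hη.1.trans_le ht.1, ht.2⟩
    have h2 := le_of_hasDerivAt_neg_mul (d := fun ξ => w (φ ξ) + Z ξ)
      (k := fun ξ => g (φ ξ) / w (φ ξ)) hη.2.le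
      (fun t ht => B.hasDerivAt_defect A hw (hmem t ht))
      (fun t ht => div_nonneg (A.gpos _ (A.mem_of_lt (B.mem_Ioo (hmem t ht)))).le
        (hw.pos _ (B.mem_Ioo (hmem t ht))).le) (by linarith)
    have h3 := B.flux_neg A (hmem η ⟨le_rfl, hη.2.le⟩)
    linarith
  linarith [ge_of_tendsto (B.tendsto_w A hw) h1]

/-- If the flux vanishes at `a`, so does the defect, which therefore is zero. -/
lemma Below.flux_eq (B : Below D f g α c a φ Z) (A : Data D f g α)
    (hw : IsSol (fun s => D s * g s) (dot f) α c w) (hZ : Tendsto Z (𝓝[>] a) (𝓝 0)) {ξ : ℝ}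
    (hξ : ξ ∈ arc φ a) : Z ξ = -w (φ ξ) := by
  have h0 := B.w_le A hw hξ
  by_contra hne
  have hlt : w (φ ξ) + Z ξ < 0 := lt_of_le_of_ne (by linarith) fun h => hne (by linarith)
  have h1 : ∀ᶠ η in 𝓝[>] a, -(w (φ ξ) + Z ξ) ≤ -(w (φ η) + Z η) := by
    filter_upwards [Ioo_mem_nhdsGT hξ.1] with η hη
    have hmem : ∀ t ∈ Icc η ξ, t ∈ arc φ a := fun t ht => arc_mono hξ ⟨hη.1.trans_le ht.1, ht.2⟩
    exact le_of_hasDerivAt_neg_mul (d := fun ξ => -(w (φ ξ) + Z ξ))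
      (k := fun ξ => g (φ ξ) / w (φ ξ)) hη.2.le
      (fun t ht => (B.hasDerivAt_defect A hw (hmem t ht)).neg.congr_deriv (by ring))
      (fun t ht => div_nonneg (A.gpos _ (A.mem_of_lt (B.mem_Ioo (hmem t ht)))).le
        (hw.pos _ (B.mem_Ioo (hmem t ht))).le) (by linarith)
  have h2 := ((B.tendsto_w A hw).add hZ).neg
  rw [add_zero, neg_zero] at h2
  linarith [ge_of_tendsto h2 h1]

/-- Along the arc `w(φ) ≤ -Z` becomes small together with `φ`, which is `w(0⁺) = 0`. -/
theorem Below.vanishAt (B : Below D f g α c a φ Z) (A : Data D f g α) : VanishAt D f g α c := by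
  obtain ⟨w, hw⟩ := exists_isSol A.coef c
  refine ⟨w, hw, hw.tendsto_zero A.coef fun ε hε => ?_⟩
  obtain ⟨ξ, hξ, h1, h2⟩ := B.exists_small A hε
  exact ⟨φ ξ, B.mem_Ioo hξ, h1, (B.w_le A hw hξ).trans_lt h2⟩

/-- A profile cannot stay at the level `α`, since `g(α) > 0`. -/
lemma Strong.not_eqOn_α (A : Data D f g α) (h : Strong D f g I c φ Z) (hI : IsOpen I) {x y : ℝ}
    (hxy : x < y) (hsub : Ioo x y ⊆ I) (hα : ∀ ξ ∈ Ioo x y, φ ξ = α) : False := by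
  obtain ⟨ξ, hξ⟩ := nonempty_Ioo.2 hxy
  have hev : ∀ᶠ η in 𝓝 ξ, Z η - f (φ η) + c * φ η = 0 - f α + c * α := by
    filter_upwards [Ioo_mem_nhds hξ.1 hξ.2] with η hη
    rw [h.flux_eq_zero_of_eq_α A hI (hsub hη) (hα η hη), hα η hη]
  have h1 := ((hasDerivAt_const ξ (0 - f α + c * α)).congr_of_eventuallyEq hev).unique
    (h.derivY ξ (hsub hξ))
  rw [hα ξ hξ] at h1
  linarith [A.gα]

lemma Strong.below (A : Data D f g α) (h : Strong D f g (Ioi a) c φ Z)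
    (hanti : AntitoneOn φ (Ioi a)) (hlim : Tendsto φ (𝓝[>] a) (𝓝 α)) :
    Below D f g α c a φ Z := by
  have hle : ∀ ξ ∈ Ioi a, φ ξ ≤ α := fun ξ hξ => ge_of_tendsto hlim (by
    filter_upwards [Ioo_mem_nhdsGT hξ] with η hη using hanti hη.1 hξ hη.2.le)
  refine ⟨h, fun ξ hξ => lt_of_le_of_ne (hle ξ hξ) fun he => ?_, hlim⟩
  refine h.not_eqOn_α A isOpen_Ioi hξ (fun η hη => hη.1) fun η hη => ?_
  exact le_antisymm (hle η hη.1) (he ▸ hanti hη.1 hξ hη.2.le)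

/-- A profile with values in `[0,α]` that starts at `α` has no continuation to the left: the
reflected continuation would be an arc for the speed `-c` and the convection `-f`. -/
theorem Below.not_extends (A : Data D f g α) (hv : VanishAt D f g α c) {χ : ℝ → ℝ}
    (h : Strong D f g univ c χ Z) (hχ : ∀ ξ, χ ξ ∈ Icc 0 α) (ha : χ a = α) : False := by
  have hZa : Z a = 0 := h.flux_eq_zero_of_eq_α A isOpen_univ (mem_univ _) ha
  set Y : ℝ → ℝ := fun η => Z η - f (χ η) + c * χ η with hY
  have hYd : ∀ ξ, HasDerivAt Y (-g (χ ξ)) ξ := fun ξ => h.derivY ξ (mem_univ _)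
  have h01 : ∀ ξ, χ ξ ∈ Icc (0 : ℝ) 1 := fun ξ => h.mapsTo (mem_univ _)
  have hχc : ContinuousAt χ a := h.contφ.continuousAt univ_mem
  have hlt : ∀ ξ < a, χ ξ < α := by
    intro ξ hξ
    refine lt_of_le_of_ne (hχ ξ).2 fun he => ?_
    -- the flux vanishes at both ends, so the non-increasing `Y` would be constant on `[ξ, a]`
    have hZξ : Z ξ = 0 := h.flux_eq_zero_of_eq_α A isOpen_univ (mem_univ _) he
    have hYeq : Y ξ = Y a := by simp only [hY, hZξ, hZa, he, ha]
    have hanti : ∀ x y, x ≤ y → Y y ≤ Y x := by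
      intro x y hxy
      rcases eq_or_lt_of_le hxy with rfl | hxy
      · exact le_rfl
      have := sub_le_mul_of_deriv_le (C := 0) hxy (fun t _ => hYd t)
        (fun t _ => by linarith [A.g_nonneg (h01 t)])
      linarith
    have hev : ∀ᶠ η in 𝓝 a, 0 < g (χ η) := by
      have h1 : ContinuousAt g (χ a) := by
        rw [ha]; exact continuousAt_of_mem_Ioo A.contg A.mem_α
      have h2 : ContinuousAt (fun η => g (χ η)) a := h1.comp hχc
      exact h2.eventually (lt_mem_nhds (by simp only [ha]; exact A.gα))
    obtain ⟨η, hη, hη2⟩ := ((hev.filter_mono (nhdsWithin_le_nhds (s := Iio a))).and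
      (Ioo_mem_nhdsLT hξ)).exists
    have hconst : ∀ᶠ t in 𝓝 η, Y t = Y a := by
      filter_upwards [Ioo_mem_nhds hη2.1 hη2.2] with t ht
      exact le_antisymm (hYeq ▸ hanti _ _ ht.1.le) (hanti _ _ ht.2.le)
    have := ((hasDerivAt_const η (Y a)).congr_of_eventuallyEq hconst).unique (hYd η)
    linarith
  have hB : Below D (fun s => -f s) g α (-c) (-a) (fun ξ => χ (-ξ)) (fun ξ => -Z (-ξ)) := by
    refine ⟨h.neg.mono fun ξ _ => mem_univ (-ξ), fun ξ hξ => hlt (-ξ) ?_, ?_⟩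
    · have : -a < ξ := hξ
      linarith
    · have h1 : ContinuousAt (fun ξ => χ (-ξ)) (-a) := by
        refine ContinuousAt.comp (g := χ) ?_ continuous_neg.continuousAt
        rwa [neg_neg]
      have h2 := h1.tendsto.mono_left (nhdsWithin_le_nhds (s := Ioi (-a)))
      simpa [ha] using h2
  exact A.not_vanishAt_neg hv (hB.vanishAt A.neg)

end Arc

/-! ### Construction of profiles -/

section Construction

variable {D f g : ℝ → ℝ} {α c : ℝ} {w : ℝ → ℝ}

/-- The time `G(s) = ∫_s^α D / w` at which the profile leaving `α` at time `0` has the value `s`.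
It is finite since `D / w` has a finite limit at `α`. -/
lemma Data.exists_time (A : Data D f g α) (hw : IsSol (fun s => D s * g s) (dot f) α c w) :
    ∃ G : ℝ → ℝ, ContinuousOn G (Ioc 0 α) ∧ StrictAntiOn G (Ioc 0 α) ∧ G α = 0 ∧
      ∀ s ∈ Ioo 0 α, HasDerivAt G (-(D s / w s)) s := by
  set l := -sMinus D f g α c / g α with hl
  set k : ℝ → ℝ := fun s => if s < α then D s / w s else l with hk
  have hkeq : ∀ s < α, k s = D s / w s := fun s hs => if_pos hs
  have hkα : k α = l := if_neg (lt_irrefl _)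
  have hkc : ContinuousOn k (Ioi 0) := by
    intro s hs
    apply ContinuousAt.continuousWithinAt
    rcases lt_trichotomy s α with h | h | h
    · have hs' : s ∈ Ioo 0 α := ⟨hs, h⟩
      have h1 : ContinuousAt (fun s => D s / w s) s :=
        (continuousAt_of_mem_Ioo A.contD (A.mem_of_lt hs')).div
          (hw.deriv s hs').continuousAt (hw.pos s hs').ne'
      refine h1.congr ?_
      filter_upwards [Iio_mem_nhds h] with t ht using (hkeq t ht).symm
    · subst h
      rw [continuousAt_iff_continuous_left'_right']
      constructor
      · rw [ContinuousWithinAt, hkα]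
        refine (A.tendsto_D_div_w hw).congr' ?_
        filter_upwards [self_mem_nhdsWithin] with t ht using (hkeq t ht).symm
      · rw [ContinuousWithinAt, hkα]
        refine tendsto_const_nhds.congr' ?_
        filter_upwards [self_mem_nhdsWithin] with t ht
        exact (if_neg (not_lt.2 (le_of_lt ht))).symm
    · refine continuousAt_const.congr (f := fun _ => l) ?_
      filter_upwards [Ioi_mem_nhds h] with t ht
      exact (if_neg (not_lt.2 (le_of_lt ht))).symm
  obtain ⟨G₀, hG₀⟩ := exists_primitive isOpen_Ioi hkc
  set G : ℝ → ℝ := fun s => G₀ α - G₀ s with hG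
  have hd : ∀ s ∈ Ioi (0 : ℝ), HasDerivAt G (-k s) s := fun s hs => (hG₀ s hs).const_sub _
  have hc : ContinuousOn G (Ioc 0 α) := fun s hs => (hd s hs.1).continuousAt.continuousWithinAt
  refine ⟨G, hc, ?_, by simp [hG], fun s hs => ?_⟩
  · refine strictAntiOn_of_deriv_neg (convex_Ioc 0 α) hc fun s hs => ?_
    rw [interior_Ioc] at hs
    rw [(hd s hs.1).deriv, hkeq s hs.2]
    exact neg_lt_zero.2 (div_pos (A.Dpos s hs) (hw.pos s hs))
  · rw [← hkeq s hs.2]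
    exact hd s hs.1

/-- The half of a profile that leaves `α` at `0`, frozen at `α` on `(-∞,0]`. -/
structure Half (D f g : ℝ → ℝ) (α c : ℝ) (φ Z : ℝ → ℝ) : Prop where
  contφ : Continuous φ
  mem : ∀ ξ, φ ξ ∈ Icc 0 α
  anti : Antitone φ
  eqα : ∀ ξ ≤ 0, φ ξ = α
  lim : Tendsto φ atTop (𝓝 0)
  contZ : Continuous Z
  Z0 : ∀ ξ ≤ 0, Z ξ = 0
  derivP : ∀ ξ > 0, HasDerivAt (fun η => ∫ s in (0 : ℝ)..φ η, D s) (Z ξ) ξ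
  derivY : ∀ ξ > 0, HasDerivAt (fun η => Z η - f (φ η) + c * φ η) (-g (φ ξ)) ξ

/-- A continuous function whose derivative off a point extends continuously is differentiable at the
point. -/
lemma hasDerivAt_of_eventually_punctured {F F' : ℝ → ℝ} {x : ℝ}
    (h : ∀ᶠ y in 𝓝[≠] x, HasDerivAt F (F' y) y) (hF : ContinuousAt F x)
    (hF' : ContinuousAt F' x) : HasDerivAt F (F' x) x := by
  have hd : ∀ᶠ y in 𝓝[≠] x, deriv F y = F' y := h.mono fun y hy => hy.deriv
  have ht : Tendsto (deriv F) (𝓝[≠] x) (𝓝 (F' x)) :=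
    (hF'.tendsto.mono_left nhdsWithin_le_nhds).congr' (hd.mono fun y hy => hy.symm)
  have hl : 𝓝[<] x ≤ 𝓝[≠] x := nhdsWithin_mono x fun s hs => ne_of_lt hs
  have hr : 𝓝[>] x ≤ 𝓝[≠] x := nhdsWithin_mono x fun s hs => ne_of_gt hs
  have h1 : HasDerivWithinAt F (F' x) (Iic x) x :=
    hasDerivWithinAt_Iic_of_tendsto_deriv (s := {y | HasDerivAt F (F' y) y})
      (fun y hy => HasDerivAt.differentiableAt (f' := F' y) hy |>.differentiableWithinAt)
      hF.continuousWithinAt (hl h) (ht.mono_left hl)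
  have h2 : HasDerivWithinAt F (F' x) (Ici x) x :=
    hasDerivWithinAt_Ici_of_tendsto_deriv (s := {y | HasDerivAt F (F' y) y})
      (fun y hy => HasDerivAt.differentiableAt (f' := F' y) hy |>.differentiableWithinAt)
      hF.continuousWithinAt (hr h) (ht.mono_left hr)
  have := h1.union h2
  rwa [Iic_union_Ici, hasDerivWithinAt_univ] at this

/-- If `w(0⁺) = 0`, the half profile exists: it solves `φ' = -w(φ) / D(φ)` and its flux is `-w(φ)`.
It stays at `0` from the moment, if any, at which it gets there. -/
theorem Data.exists_half (A : Data D f g α) (hv : VanishAt D f g α c) :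
    ∃ φ Z, Half D f g α c φ Z := by
  obtain ⟨w, hw, hw0⟩ := hv
  obtain ⟨G, hGc, hGa, hGα, hGd⟩ := A.exists_time hw
  have hα := A.α0
  have hGcont : ∀ s ∈ Ioo 0 α, ContinuousAt G s := fun s hs => (hGd s hs).continuousAt
  have hαm : α ∈ Ioc 0 α := ⟨hα, le_rfl⟩
  set S : ℝ → Set ℝ := fun ξ => {s | s = 0 ∨ s ∈ Ioc 0 α ∧ ξ ≤ G s} with hS
  -- the profile is the generalised inverse of `G`
  set φ : ℝ → ℝ := fun ξ => sSup (S ξ) with hφ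
  have hSne : ∀ ξ, (S ξ).Nonempty := fun ξ => ⟨0, Or.inl rfl⟩
  have hSle : ∀ ξ, ∀ s ∈ S ξ, s ≤ α := by
    rintro ξ s (rfl | ⟨h, -⟩)
    · exact hα.le
    · exact h.2
  have hSb : ∀ ξ, BddAbove (S ξ) := fun ξ => ⟨α, hSle ξ⟩
  have hmem : ∀ ξ, φ ξ ∈ Icc 0 α := fun ξ =>
    ⟨le_csSup (hSb ξ) (Or.inl rfl), csSup_le (hSne ξ) (hSle ξ)⟩
  have hanti : Antitone φ := by
    intro ξ η hξη
    refine csSup_le_csSup (hSb ξ) (hSne η) ?_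
    rintro s (rfl | ⟨h, h'⟩)
    · exact Or.inl rfl
    · exact Or.inr ⟨h, hξη.trans h'⟩
  have hinv : ∀ s ∈ Ioc 0 α, φ (G s) = s := by
    intro s hs
    refine le_antisymm (csSup_le (hSne _) ?_) (le_csSup (hSb _) (Or.inr ⟨hs, le_rfl⟩))
    rintro t (rfl | ⟨h, h'⟩)
    · exact hs.1.le
    · exact (hGa.le_iff_ge hs h).1 h'
  have heqα : ∀ ξ ≤ 0, φ ξ = α := fun ξ hξ =>
    le_antisymm (hmem ξ).2 (le_csSup (hSb ξ) (Or.inr ⟨hαm, by rw [hGα]; exact hξ⟩))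
  have hlow : ∀ ξ, ∀ s ∈ Ioo 0 (φ ξ), ξ < G s := by
    intro ξ s hs
    obtain ⟨t, ht, hst⟩ := exists_lt_of_lt_csSup (hSne ξ) hs.2
    rcases ht with rfl | ⟨h, h'⟩
    · exact absurd hs.1 (not_lt.2 hst.le)
    · exact h'.trans_lt (hGa ⟨hs.1, hst.le.trans h.2⟩ h hst)
  have hupp : ∀ ξ, ∀ s ∈ Ioc 0 α, φ ξ < s → G s < ξ := by
    intro ξ s hs hlt
    by_contra! hle
    exact absurd (le_csSup (hSb ξ) (Or.inr ⟨hs, hle⟩)) (not_le.2 hlt)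
  have hcont : Continuous φ := by
    refine continuous_iff_continuousAt.2 fun ξ => tendsto_order.2 ⟨fun l hl => ?_, fun u hu => ?_⟩
    · by_cases hl0 : l < 0
      · exact Eventually.of_forall fun η => hl0.trans_le (hmem η).1
      · push Not at hl0
        obtain ⟨s, hs1, hs2⟩ := exists_between hl
        have hs0 : 0 < s := hl0.trans_lt hs1
        filter_upwards [Iio_mem_nhds (hlow ξ s ⟨hs0, hs2⟩)] with η hη
        have h1 := hanti (le_of_lt hη)
        rw [hinv s ⟨hs0, hs2.le.trans (hmem ξ).2⟩] at h1
        exact hs1.trans_le h1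
    · by_cases huα : α < u
      · exact Eventually.of_forall fun η => (hmem η).2.trans_lt huα
      · push Not at huα
        obtain ⟨s, hs1, hs2⟩ := exists_between hu
        have hs : s ∈ Ioc 0 α := ⟨(hmem ξ).1.trans_lt hs1, hs2.le.trans huα⟩
        filter_upwards [Ioi_mem_nhds (hupp ξ s hs hs1)] with η hη
        have h1 := hanti (le_of_lt hη)
        rw [hinv s hs] at h1
        exact h1.trans_lt hs2
  have hlt : ∀ ξ > 0, φ ξ < α := by
    intro ξ hξ
    have h1 : ∀ᶠ s in 𝓝[Ioc 0 α] α, G s < ξ :=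
      (hGc α hαm).eventually (gt_mem_nhds (by rwa [hGα]))
    have h2 : ∀ᶠ s in 𝓝[<] α, G s < ξ := by
      rw [← nhdsWithin_Ioo_eq_nhdsLT hα]
      exact h1.filter_mono (nhdsWithin_mono _ Ioo_subset_Ioc_self)
    obtain ⟨s, hs, hs'⟩ := (h2.and (Ioo_mem_nhdsLT hα)).exists
    have h3 := hanti hs.le
    rw [hinv s ⟨hs'.1, hs'.2.le⟩] at h3
    exact h3.trans_lt hs'.2
  have hlim : Tendsto φ atTop (𝓝 0) := by
    refine tendsto_order.2 ⟨fun l hl => Eventually.of_forall fun η => hl.trans_le (hmem η).1,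
      fun u hu => ?_⟩
    obtain ⟨s, hs⟩ := nonempty_Ioo.2 (lt_min hu hα)
    have hs' : s ∈ Ioc 0 α := ⟨hs.1, hs.2.le.trans (min_le_right _ _)⟩
    filter_upwards [eventually_ge_atTop (G s)] with η hη
    have h1 := hanti hη
    rw [hinv s hs'] at h1
    exact h1.trans_lt (hs.2.trans_le (min_le_left _ _))
  have hGφ : ∀ ξ > 0, 0 < φ ξ → G (φ ξ) = ξ := by
    intro ξ hξ h0
    have hm : φ ξ ∈ Ioo 0 α := ⟨h0, hlt ξ hξ⟩
    have hc := (hGcont _ hm).tendsto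
    apply le_antisymm
    · refine le_of_tendsto (hc.mono_left (nhdsWithin_le_nhds (s := Ioi (φ ξ)))) ?_
      filter_upwards [Ioo_mem_nhdsGT hm.2] with s hs
      exact (hupp ξ s ⟨h0.trans hs.1, hs.2.le⟩ hs.1).le
    · refine ge_of_tendsto (hc.mono_left (nhdsWithin_le_nhds (s := Iio (φ ξ)))) ?_
      filter_upwards [Ioo_mem_nhdsLT hm.1] with s hs
      exact (hlow ξ s hs).le
  have hφd : ∀ ξ > 0, 0 < φ ξ → HasDerivAt φ (-(w (φ ξ)) / D (φ ξ)) ξ := by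
    intro ξ hξ h0
    have hm : φ ξ ∈ Ioo 0 α := ⟨h0, hlt ξ hξ⟩
    have h1 : -(D (φ ξ) / w (φ ξ)) ≠ 0 :=
      neg_ne_zero.2 (div_pos (A.Dpos _ hm) (hw.pos _ hm)).ne'
    refine (HasDerivAt.of_local_left_inverse hcont.continuousAt (hGd _ hm) h1 ?_).congr_deriv ?_
    · filter_upwards [Ioi_mem_nhds hξ, hcont.continuousAt.eventually (lt_mem_nhds h0)] with y hy hy0
      exact hGφ y hy hy0
    · rw [inv_neg, inv_div, neg_div]
  -- the flux, with the value `0` where the profile vanishes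
  set v : ℝ → ℝ := fun s => if 0 < s then w s else 0 with hvdef
  have hvpos : ∀ s, 0 < s → v s = w s := fun s hs => if_pos hs
  have hvc : ContinuousOn v (Icc 0 α) := by
    intro s hs
    rcases eq_or_lt_of_le hs.1 with h0 | h0
    · subst h0
      have h1 : Tendsto v (𝓝[>] 0) (𝓝 0) := hw0.congr' (by
        filter_upwards [self_mem_nhdsWithin] with t ht using (hvpos t ht).symm)
      have h2 : ContinuousWithinAt v (insert 0 (Ioi 0)) 0 := by
        rw [continuousWithinAt_insert_self, ContinuousWithinAt]
        simpa [hvdef] using h1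
      exact h2.mono fun t ht => by
        rcases eq_or_lt_of_le ht.1 with h | h
        · exact Or.inl h.symm
        · exact Or.inr h
    · have h1 : ContinuousWithinAt v (Ioc 0 α) s :=
        (hw.cont s ⟨h0, hs.2⟩).congr (fun t ht => hvpos t ht.1) (hvpos s h0)
      refine h1.mono_of_mem_nhdsWithin ?_
      filter_upwards [self_mem_nhdsWithin, nhdsWithin_le_nhds (Ioi_mem_nhds h0)] with t ht ht'
      exact ⟨ht', ht.2⟩
  set Z : ℝ → ℝ := fun ξ => -v (φ ξ) with hZ
  have hZc : Continuous Z := (hvc.comp_continuous hcont hmem).neg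
  have h01 : ∀ ξ, φ ξ ∈ Icc (0 : ℝ) 1 := fun ξ => ⟨(hmem ξ).1, (hmem ξ).2.trans A.α1.le⟩
  set P : ℝ → ℝ := fun η => ∫ s in (0 : ℝ)..φ η, D s with hP
  set Y : ℝ → ℝ := fun η => Z η - f (φ η) + c * φ η with hY
  have hPc : Continuous P := (continuousOn_prim A.contD).comp_continuous hcont h01
  have hfc : Continuous fun η => f (φ η) := A.contf.comp_continuous hcont h01
  have hgc : Continuous fun η => g (φ η) := A.contg.comp_continuous hcont h01
  have hYc : Continuous Y := (hZc.sub hfc).add (continuous_const.mul hcont)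
  -- both equations hold where the profile is positive and where it is locally zero; this leaves out
  -- at most the first zero, where they follow by continuity
  have hgood : ∀ ξ > 0, 0 < φ ξ → HasDerivAt P (Z ξ) ξ ∧ HasDerivAt Y (-g (φ ξ)) ξ := by
    intro ξ hξ h0
    have hm : φ ξ ∈ Ioo 0 α := ⟨h0, hlt ξ hξ⟩
    have hm1 := A.mem_of_lt hm
    have hd := hφd ξ hξ h0
    have hD0 := (A.Dpos _ hm).ne'
    have hw0' := (hw.pos _ hm).ne'
    constructor
    · have h1 := ((hasDerivWithinAt_prim A.contD (h01 ξ)).hasDerivAt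
        (Icc_mem_nhds hm1.1 hm1.2)).comp ξ hd
      refine h1.congr_deriv ?_
      simp only [hZ, hvpos _ h0]
      field_simp
    · have h1 := (((hw.deriv _ hm).comp ξ hd).neg.sub
        ((hasDerivAt_dot A.hf.1 hm1).comp ξ hd)).add (hd.const_mul c)
      refine (h1.congr_of_eventuallyEq ?_).congr_deriv ?_
      · filter_upwards [hcont.continuousAt.eventually (lt_mem_nhds h0)] with η hη
        simp only [hY, hZ, hvpos _ hη, Function.comp_def, Pi.add_apply, Pi.sub_apply, Pi.neg_apply]
      · field_simp
        ring
  have hzero : ∀ ξ, (∀ᶠ η in 𝓝 ξ, φ η = 0) → HasDerivAt P (Z ξ) ξ ∧ HasDerivAt Y (-g (φ ξ)) ξ := by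
    intro ξ hev
    have h0 := hev.self_of_nhds
    have hZ0 : ∀ η, φ η = 0 → Z η = 0 := fun η hη => by simp [hZ, hvdef, hη]
    rw [hZ0 ξ h0, h0, A.g0, neg_zero]
    constructor
    · refine (hasDerivAt_const ξ (0 : ℝ)).congr_of_eventuallyEq ?_
      filter_upwards [hev] with η hη
      simp [hP, hη]
    · refine (hasDerivAt_const ξ (-f 0)).congr_of_eventuallyEq ?_
      filter_upwards [hev] with η hη
      simp [hY, hη, hZ0 η hη]
  have hpunct : ∀ ξ > 0, ∀ᶠ η in 𝓝[≠] ξ, HasDerivAt P (Z η) η ∧ HasDerivAt Y (-g (φ η)) η := by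
    intro ξ hξ
    by_cases h0 : 0 < φ ξ
    · apply Eventually.filter_mono nhdsWithin_le_nhds
      filter_upwards [Ioi_mem_nhds hξ, hcont.continuousAt.eventually (lt_mem_nhds h0)] with y hy hy0
      exact hgood y hy hy0
    have hξ0 : φ ξ = 0 := le_antisymm (not_lt.1 h0) (hmem ξ).1
    have hafter : ∀ y, φ y = 0 → ∀ z > y, ∀ᶠ η in 𝓝 z, φ η = 0 := by
      intro y hy z hz
      filter_upwards [Ioi_mem_nhds hz] with η hη
      exact le_antisymm (hy ▸ hanti (le_of_lt hη)) (hmem η).1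
    by_cases hex : ∃ y < ξ, φ y = 0
    · obtain ⟨y, hy, hy0⟩ := hex
      apply Eventually.filter_mono nhdsWithin_le_nhds
      filter_upwards [Ioi_mem_nhds hy] with z hz
      exact hzero z (hafter y hy0 z hz)
    · push Not at hex
      filter_upwards [self_mem_nhdsWithin, nhdsWithin_le_nhds (Ioi_mem_nhds hξ)] with z hz hz0
      rcases lt_or_gt_of_ne hz with h | h
      · exact hgood z hz0 (lt_of_le_of_ne (hmem z).1 (hex z h).symm)
      · exact hzero z (hafter ξ hξ0 z h)
  refine ⟨φ, Z, hcont, hmem, hanti, heqα, hlim, hZc, fun ξ hξ => ?_, fun ξ hξ => ?_, fun ξ hξ => ?_⟩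
  · simp only [hZ, heqα ξ hξ, hvpos α hα, hw.zero, neg_zero]
  · exact hasDerivAt_of_eventually_punctured ((hpunct ξ hξ).mono fun y hy => hy.1)
      hPc.continuousAt hZc.continuousAt
  · exact hasDerivAt_of_eventually_punctured (F' := fun η => -g (φ η))
      ((hpunct ξ hξ).mono fun y hy => hy.2) hYc.continuousAt hgc.neg.continuousAt

end Construction

/-! ### The symmetry exchanging the two equilibria -/

/-- The diffusivity after the change of variables `ρ ↦ 1 - ρ`, `ξ ↦ -ξ`. -/
def reflD (D : ℝ → ℝ) (s : ℝ) : ℝ := -D (1 - s)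

/-- The convection after the change of variables `ρ ↦ 1 - ρ`, `ξ ↦ -ξ`, normalised at `0`. -/
def reflF (f : ℝ → ℝ) (s : ℝ) : ℝ := f 1 - f (1 - s)

/-- The reaction after the change of variables `ρ ↦ 1 - ρ`, `ξ ↦ -ξ`. -/
def reflG (g : ℝ → ℝ) (s : ℝ) : ℝ := g (1 - s)

section Reflection

variable {D f g : ℝ → ℝ} {α c : ℝ} {I : Set ℝ} {φ Z : ℝ → ℝ}

lemma reflD_reflD (D : ℝ → ℝ) : reflD (reflD D) = D := by
  funext s; simp [reflD]

lemma reflF_reflF (h : f 0 = 0) : reflF (reflF f) = f := by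
  funext s; simp [reflF, h]

lemma reflG_reflG (g : ℝ → ℝ) : reflG (reflG g) = g := by
  funext s; simp [reflG]

lemma mapsTo_one_sub : MapsTo (fun s : ℝ => 1 - s) (Icc 0 1) (Icc 0 1) := fun s hs =>
  ⟨by linarith [hs.2], by linarith [hs.1]⟩

lemma contDiffOn_comp_one_sub {F : ℝ → ℝ} (hF : ContDiffOn ℝ 1 F (Icc 0 1)) :
    ContDiffOn ℝ 1 (fun s => F (1 - s)) (Icc 0 1) :=
  hF.comp ((contDiff_const.sub contDiff_id).contDiffOn) mapsTo_one_sub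

lemma hasDerivWithinAt_comp_one_sub {F : ℝ → ℝ} (hF : ContDiffOn ℝ 1 F (Icc 0 1)) {s : ℝ}
    (hs : s ∈ Icc (0 : ℝ) 1) :
    HasDerivWithinAt (fun s => F (1 - s)) (-dot F (1 - s)) (Icc 0 1) s := by
  have h1 := hasDerivWithinAt_dot hF (mapsTo_one_sub hs)
  have h2 : HasDerivWithinAt (fun s : ℝ => 1 - s) (-1) (Icc 0 1) s :=
    (hasDerivWithinAt_id s _).const_sub 1
  exact (h1.comp s h2 mapsTo_one_sub).congr_deriv (by ring)

lemma dot_reflD (hD : ContDiffOn ℝ 1 D (Icc 0 1)) {s : ℝ} (hs : s ∈ Icc (0 : ℝ) 1) :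
    dot (reflD D) s = dot D (1 - s) := by
  have := (hasDerivWithinAt_comp_one_sub hD hs).neg
  rw [neg_neg] at this
  exact this.derivWithin (uniqueDiffOn_Icc zero_lt_one s hs)

lemma dot_reflF (hf : ContDiffOn ℝ 1 f (Icc 0 1)) {s : ℝ} (hs : s ∈ Icc (0 : ℝ) 1) :
    dot (reflF f) s = dot f (1 - s) := by
  have := (hasDerivWithinAt_comp_one_sub hf hs).const_sub (f 1)
  rw [neg_neg] at this
  exact this.derivWithin (uniqueDiffOn_Icc zero_lt_one s hs)

lemma map_one_sub_nhdsGT (a : ℝ) : map (fun s : ℝ => 1 - s) (𝓝[>] a) = 𝓝[<] (1 - a) := by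
  simp

lemma map_one_sub_nhdsLT (a : ℝ) : map (fun s : ℝ => 1 - s) (𝓝[<] a) = 𝓝[>] (1 - a) := by
  simp

lemma diniUpperRight_reflect (q : ℝ → ℝ) :
    diniUpperRight (fun s => -q (1 - s)) 0 = diniUpperLeft q 1 := by
  have h := map_one_sub_nhdsGT 0
  rw [sub_zero] at h
  rw [diniUpperLeft, ← h, diniUpperRight, limsup, limsup, Filter.map_map]
  congr 2
  funext s
  simp only [Function.comp_def]
  congr 1
  rw [sub_zero, sub_zero, show (1 - s - 1 : ℝ) = -s by ring, div_neg, ← neg_div]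
  congr 1; ring

lemma diniUpperLeft_reflect (q : ℝ → ℝ) :
    diniUpperLeft (fun s => -q (1 - s)) 1 = diniUpperRight q 0 := by
  have h := map_one_sub_nhdsLT 1
  rw [sub_self] at h
  rw [diniUpperRight, ← h, diniUpperLeft, limsup, limsup, Filter.map_map]
  congr 2
  funext s
  simp only [Function.comp_def]
  congr 1
  rw [sub_self, sub_zero, show (s - 1 : ℝ) = -(1 - s) by ring, div_neg, ← neg_div]
  congr 1; ring

lemma Data.reflect (A : Data D f g α) : Data (reflD D) (reflF f) (reflG g) (1 - α) := by
  have h01 : ∀ s ∈ Ioo (0 : ℝ) 1, 1 - s ∈ Ioo (0 : ℝ) 1 := fun s hs =>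
    ⟨by linarith [hs.2], by linarith [hs.1]⟩
  refine ⟨⟨contDiffOn_const.sub (contDiffOn_comp_one_sub A.hf.1), by simp [reflF]⟩,
    ⟨A.contg.comp (continuousOn_const.sub continuousOn_id) mapsTo_one_sub,
      fun s hs => A.gpos _ (h01 s hs), by simp [reflG, A.hg.2.2.2], by simp [reflG, A.g0]⟩,
    ⟨⟨by linarith [A.α1], by linarith [A.α0]⟩, (contDiffOn_comp_one_sub A.hD.2.1).neg,
      fun s hs => ?_, fun s hs => ?_⟩, ?_, ?_⟩
  · exact neg_pos.2 (A.Dneg _ ⟨by linarith [hs.2], by linarith [hs.1]⟩)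
  · exact neg_neg_of_pos (A.Dpos _ ⟨by linarith [hs.2], by linarith [hs.1]⟩)
  · have := diniUpperRight_reflect (fun s => D s * g s)
    simp only [reflD, reflG, neg_mul]
    rw [this]
    exact A.hDg.2
  · have := diniUpperLeft_reflect (fun s => D s * g s)
    simp only [reflD, reflG, neg_mul]
    rw [this]
    exact A.hDg.1

lemma sMinus_reflect (A : Data D f g α) (c : ℝ) :
    sMinus (reflD D) (reflF f) (reflG g) (1 - α) c = sMinus D f g α c := by
  have h : (1 - α) ∈ Icc (0 : ℝ) 1 := Ioo_subset_Icc_self A.reflect.mem_α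
  rw [sMinus, sMinus, dot_reflD A.hD.2.1 h, dot_reflF A.hf.1 h, reflG, sub_sub_cancel]

lemma integral_reflD (hD : ContinuousOn D (Icc 0 1)) {x : ℝ} (hx : x ∈ Icc (0 : ℝ) 1) :
    (∫ s in (0 : ℝ)..(1 - x), reflD D s)
      = (∫ s in (0 : ℝ)..x, D s) - ∫ s in (0 : ℝ)..1, D s := by
  have hi : ∀ y ∈ Icc (0 : ℝ) 1, IntervalIntegrable D volume 0 y := fun y hy =>
    (hD.mono (by rw [uIcc_of_le hy.1]; exact Icc_subset_Icc_right hy.2)).intervalIntegrable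
  have h1 := intervalIntegral.integral_interval_sub_left (hi 1 ⟨zero_le_one, le_rfl⟩) (hi x hx)
  simp only [reflD, intervalIntegral.integral_neg]
  rw [intervalIntegral.integral_comp_sub_left (fun s => D s) 1]
  simp only [sub_sub_cancel, sub_zero]
  linarith

lemma Strong.reflect (h : Strong D f g I c φ Z) (hD : ContinuousOn D (Icc 0 1)) (hI : IsOpen I) :
    Strong (reflD D) (reflF f) (reflG g) (-I) c (fun ξ => 1 - φ (-ξ)) (fun ξ => -Z (-ξ)) := by
  have hm : MapsTo (fun ξ : ℝ => -ξ) (-I) I := fun ξ hξ => hξ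
  refine ⟨continuousOn_const.sub (h.contφ.comp continuous_neg.continuousOn hm),
    fun ξ hξ => mapsTo_one_sub (h.mapsTo (hm hξ)),
    (h.contZ.comp continuous_neg.continuousOn hm).neg, fun ξ hξ => ?_, fun ξ hξ => ?_⟩
  · have h1 := ((h.derivP (-ξ) (hm hξ)).comp ξ (hasDerivAt_neg ξ)).sub_const
      (∫ s in (0 : ℝ)..1, D s)
    refine (h1.congr_of_eventuallyEq ?_).congr_deriv (by ring)
    filter_upwards [hI.neg.mem_nhds hξ] with η hη
    exact integral_reflD hD (h.mapsTo (hm hη))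
  · have h1 := (((h.derivY (-ξ) (hm hξ)).comp ξ (hasDerivAt_neg ξ)).neg).add_const (c - f 1)
    refine (h1.congr_of_eventuallyEq (Eventually.of_forall fun η => ?_)).congr_deriv ?_
    · simp only [Function.comp_def, Pi.neg_apply, reflF, sub_sub_cancel]
      ring
    · simp [reflG]

end Reflection

/-! ### The threshold speeds -/

section Speeds

variable {D f g : ℝ → ℝ} {α c : ℝ} {I : Set ℝ} {φ Z φ₁ Z₁ : ℝ → ℝ}

lemma Antitone.ae_differentiableAt' (h : Antitone φ) : ∀ᵐ ξ, DifferentiableAt ℝ φ ξ := by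
  filter_upwards [Monotone.ae_differentiableAt h.neg] with ξ hξ
  simpa using hξ.neg

lemma Half.strong (H : Half D f g α c φ Z) (A : Data D f g α) : Strong D f g (Ioi 0) c φ Z :=
  ⟨H.contφ.continuousOn, fun ξ _ => ⟨(H.mem ξ).1, (H.mem ξ).2.trans A.α1.le⟩,
    H.contZ.continuousOn, H.derivP, H.derivY⟩

lemma eq_of_eqOn_Ioi {F G : ℝ → ℝ} (hF : ContinuousAt F 0) (hG : ContinuousAt G 0)
    (h : EqOn F G (Ioi 0)) : F 0 = G 0 := by
  refine tendsto_nhds_unique (hF.tendsto.mono_left (nhdsWithin_le_nhds (s := Ioi 0))) ?_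
  refine (hG.tendsto.mono_left (nhdsWithin_le_nhds (s := Ioi 0))).congr' ?_
  filter_upwards [self_mem_nhdsWithin] with x hx using (h hx).symm

/-- The half profile built from `w` is a strict semi-wavefront, and every semi-wavefront is an arc. -/
lemma Data.mem_speedsTo0_iff (A : Data D f g α) : c ∈ speedsTo0 D f g α ↔ VanishAt D f g α c := by
  constructor
  · rintro ⟨a, φ, htw, hanti, hlim, -, -⟩
    obtain ⟨Z, hZ⟩ := htw.exists_strong A.contD A.contf A.contg isOpen_Ioi
    exact (hZ.below A hanti hlim).vanishAt A
  · intro hv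
    obtain ⟨φ, Z, H⟩ := A.exists_half hv
    refine ⟨0, φ, (H.strong A).isTW A.contD A.contf A.contg isOpen_Ioi
      (ae_restrict_of_ae (Antitone.ae_differentiableAt' H.anti)), H.anti.antitoneOn _, ?_, H.lim, ?_⟩
    · have := (H.contφ.tendsto 0).mono_left (nhdsWithin_le_nhds (s := Ioi 0))
      rwa [H.eqα 0 le_rfl] at this
    · rintro ⟨χ, htw, hχ, heq⟩
      obtain ⟨W, hW⟩ := htw.exists_strong A.contD A.contf A.contg isOpen_univ
      refine Below.not_extends (a := 0) A hv hW hχ ?_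
      rw [eq_of_eqOn_Ioi (hW.contφ.continuousAt univ_mem) H.contφ.continuousAt heq, H.eqα 0 le_rfl]

/-- The reflection exchanging the equilibria reduces this to the semi-wavefronts to `0`. -/
lemma Data.mem_speedsFrom1_iff (A : Data D f g α) :
    c ∈ speedsFrom1 D f g α ↔ VanishAt (reflD D) (reflF f) (reflG g) (1 - α) c := by
  constructor
  · rintro ⟨b, φ, htw, hanti, -, hlim, -⟩
    obtain ⟨Z, hZ⟩ := htw.exists_strong A.contD A.contf A.contg isOpen_Iio
    have hR := hZ.reflect A.contD isOpen_Iio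
    have hset : -Iio b = Ioi (-b) := by simp
    rw [hset] at hR
    refine (hR.below A.reflect ?_ ?_).vanishAt A.reflect
    · intro x hx y hy hxy
      have hx' : -x ∈ Iio b := by simp only [mem_Iio]; linarith [mem_Ioi.1 hx]
      have hy' : -y ∈ Iio b := by simp only [mem_Iio]; linarith [mem_Ioi.1 hy]
      exact sub_le_sub_left (hanti hy' hx' (neg_le_neg hxy)) 1
    · have h1 : Tendsto (fun x : ℝ => -x) (𝓝[>] (-b)) (𝓝[<] b) := tendsto_neg_nhdsGT_neg
      exact tendsto_const_nhds.sub (hlim.comp h1)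
  · intro hv
    obtain ⟨φ, Z, H⟩ := A.reflect.exists_half hv
    have hS := (H.strong A.reflect).reflect A.reflect.contD isOpen_Ioi
    rw [reflD_reflD, reflF_reflF A.hf.2, reflG_reflG, show -Ioi (0 : ℝ) = Iio 0 by simp] at hS
    have hanti : Antitone fun ξ => 1 - φ (-ξ) := fun x y hxy =>
      sub_le_sub_left (H.anti (neg_le_neg hxy)) 1
    have hc : Continuous fun ξ => 1 - φ (-ξ) :=
      continuous_const.sub (H.contφ.comp continuous_neg)
    refine ⟨0, fun ξ => 1 - φ (-ξ), hS.isTW A.contD A.contf A.contg isOpen_Iio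
      (ae_restrict_of_ae (Antitone.ae_differentiableAt' hanti)), hanti.antitoneOn _, ?_, ?_, ?_⟩
    · have := (H.lim.comp tendsto_neg_atBot_atTop).const_sub 1
      simpa [Function.comp_def] using this
    · have := (hc.tendsto 0).mono_left (nhdsWithin_le_nhds (s := Iio 0))
      rw [neg_zero, H.eqα 0 le_rfl, sub_sub_cancel] at this
      exact this
    · rintro ⟨χ, htw, hχ, heq⟩
      obtain ⟨W, hW⟩ := htw.exists_strong A.contD A.contf A.contg isOpen_univ
      have hR := hW.reflect A.contD isOpen_univ
      rw [neg_univ] at hR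
      have hχ0 : ContinuousAt (fun ξ => 1 - χ (-ξ)) 0 := hR.contφ.continuousAt univ_mem
      refine Below.not_extends (a := 0) A.reflect hv hR
        (fun ξ => ⟨by linarith [(hχ (-ξ)).2], by linarith [(hχ (-ξ)).1]⟩) ?_
      rw [eq_of_eqOn_Ioi hχ0 H.contφ.continuousAt, H.eqα 0 le_rfl]
      intro x hx
      have hx' : -x ∈ Iio (0 : ℝ) := by simpa using hx
      have := heq hx'
      simp only [neg_neg] at this
      simp only [this]
      ring

lemma csInf_eq_of_mem_iff {S : Set ℝ} {c₀ : ℝ} (h : ∀ c, c ∈ S ↔ c₀ ≤ c) : sInf S = c₀ := by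
  have : S = Ici c₀ := Set.ext h
  rw [this, csInf_Ici]

lemma Data.vanishAt_iff (A : Data D f g α) : VanishAt D f g α c ↔ cpr D f g α ≤ c := by
  obtain ⟨c₀, hc₀⟩ := A.exists_threshold
  rw [hc₀, cpr, csInf_eq_of_mem_iff (c₀ := c₀) fun c => A.mem_speedsTo0_iff.trans (hc₀ c)]

lemma Data.vanishAt_reflect_iff (A : Data D f g α) :
    VanishAt (reflD D) (reflF f) (reflG g) (1 - α) c ↔ cnl D f g α ≤ c := by
  obtain ⟨c₀, hc₀⟩ := A.reflect.exists_threshold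
  rw [hc₀, cnl, csInf_eq_of_mem_iff (c₀ := c₀) fun c => A.mem_speedsFrom1_iff.trans (hc₀ c)]

lemma Data.cpr_reflect (A : Data D f g α) :
    cpr (reflD D) (reflF f) (reflG g) (1 - α) = cnl D f g α :=
  le_antisymm (A.reflect.vanishAt_iff.1 (A.vanishAt_reflect_iff.2 le_rfl))
    (A.vanishAt_reflect_iff.1 (A.reflect.vanishAt_iff.2 le_rfl))

/-! ### Wavefronts -/

/-- A wavefront together with its flux. -/
structure Wave (D f g : ℝ → ℝ) (c : ℝ) (φ Z : ℝ → ℝ) : Prop where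
  strong : Strong D f g univ c φ Z
  anti : Antitone φ
  bot : Tendsto φ atBot (𝓝 1)
  top : Tendsto φ atTop (𝓝 0)

lemma Data.isWavefront_iff (A : Data D f g α) : IsWavefront D f g c φ ↔ ∃ Z, Wave D f g c φ Z := by
  constructor
  · rintro ⟨htw, hanti, hb, ht⟩
    obtain ⟨Z, hZ⟩ := htw.exists_strong A.contD A.contf A.contg isOpen_univ
    exact ⟨Z, hZ, hanti, hb, ht⟩
  · rintro ⟨Z, hZ, hanti, hb, ht⟩
    exact ⟨hZ.isTW A.contD A.contf A.contg isOpen_univ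
      (ae_restrict_of_ae (Antitone.ae_differentiableAt' hanti)), hanti, hb, ht⟩

lemma Wave.reflect (h : Wave D f g c φ Z) (A : Data D f g α) :
    Wave (reflD D) (reflF f) (reflG g) c (fun ξ => 1 - φ (-ξ)) (fun ξ => -Z (-ξ)) := by
  refine ⟨by simpa using h.strong.reflect A.contD isOpen_univ, fun x y hxy =>
    sub_le_sub_left (h.anti (neg_le_neg hxy)) 1, ?_, ?_⟩
  · have := (h.top.comp tendsto_neg_atBot_atTop).const_sub 1
    simpa [Function.comp_def] using this
  · have := (h.bot.comp tendsto_neg_atTop_atBot).const_sub 1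
    simpa [Function.comp_def] using this

/-- Two halves with the same speed, from `α` to `0` and from `1` to `α`, form a wavefront: the flux
vanishes at the junction. -/
lemma Half.wave (H : Half D f g α c φ Z) (A : Data D f g α)
    (H₁ : Half (reflD D) (reflF f) (reflG g) (1 - α) c φ₁ Z₁) :
    Wave D f g c (fun ξ => φ ξ + (1 - φ₁ (-ξ)) - α) (fun ξ => Z ξ - Z₁ (-ξ)) := by
  set Φ : ℝ → ℝ := fun ξ => φ ξ + (1 - φ₁ (-ξ)) - α with hΦ
  set W : ℝ → ℝ := fun ξ => Z ξ - Z₁ (-ξ) with hW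
  have hr : ∀ ξ ≥ 0, Φ ξ = φ ξ ∧ W ξ = Z ξ := fun ξ hξ => by
    simp only [hΦ, hW, H₁.eqα (-ξ) (by linarith), H₁.Z0 (-ξ) (by linarith)]
    constructor <;> ring
  have hl : ∀ ξ ≤ 0, Φ ξ = 1 - φ₁ (-ξ) ∧ W ξ = -Z₁ (-ξ) := fun ξ hξ => by
    simp only [hΦ, hW, H.eqα ξ hξ, H.Z0 ξ hξ]
    constructor <;> ring
  have hΦc : Continuous Φ :=
    (H.contφ.add (continuous_const.sub (H₁.contφ.comp continuous_neg))).sub continuous_const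
  have hWc : Continuous W := H.contZ.sub (H₁.contZ.comp continuous_neg)
  have h01 : ∀ ξ, Φ ξ ∈ Icc (0 : ℝ) 1 := by
    intro ξ
    rcases le_total 0 ξ with h | h
    · rw [(hr ξ h).1]
      exact ⟨(H.mem ξ).1, (H.mem ξ).2.trans A.α1.le⟩
    · rw [(hl ξ h).1]
      have := H₁.mem (-ξ)
      exact ⟨by linarith [this.2, A.α0], by linarith [this.1]⟩
  have hanti : Antitone Φ := fun x y hxy => by
    have h1 := H.anti hxy
    have h2 := H₁.anti (neg_le_neg hxy)
    simp only [hΦ]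
    linarith
  have hS := (H₁.strong A.reflect).reflect A.reflect.contD isOpen_Ioi
  rw [reflD_reflD, reflF_reflF A.hf.2, reflG_reflG, show -Ioi (0 : ℝ) = Iio 0 by simp] at hS
  set P : ℝ → ℝ := fun η => ∫ s in (0 : ℝ)..Φ η, D s with hP
  set Y : ℝ → ℝ := fun η => W η - f (Φ η) + c * Φ η with hY
  have hPc : Continuous P := (continuousOn_prim A.contD).comp_continuous hΦc h01
  have hfc : Continuous fun η => f (Φ η) := A.contf.comp_continuous hΦc h01
  have hgc : Continuous fun η => g (Φ η) := A.contg.comp_continuous hΦc h01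
  have hYc : Continuous Y := (hWc.sub hfc).add (continuous_const.mul hΦc)
  -- off the junction one of the two halves is constant; at the junction continuity suffices
  have hne : ∀ ξ ≠ 0, HasDerivAt P (W ξ) ξ ∧ HasDerivAt Y (-g (Φ ξ)) ξ := by
    intro ξ hξ
    rcases lt_or_gt_of_ne hξ with h | h
    · have hev : ∀ᶠ η in 𝓝 ξ, Φ η = 1 - φ₁ (-η) ∧ W η = -Z₁ (-η) := by
        filter_upwards [Iio_mem_nhds h] with η hη using hl η (le_of_lt hη)
      rw [(hl ξ h.le).1, (hl ξ h.le).2]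
      constructor
      · refine (hS.derivP ξ h).congr_of_eventuallyEq ?_
        filter_upwards [hev] with η hη
        simp only [hP, hη.1]
      · refine (hS.derivY ξ h).congr_of_eventuallyEq ?_
        filter_upwards [hev] with η hη
        simp only [hY, hη.1, hη.2]
    · have hev : ∀ᶠ η in 𝓝 ξ, Φ η = φ η ∧ W η = Z η := by
        filter_upwards [Ioi_mem_nhds h] with η hη using hr η (le_of_lt hη)
      rw [(hr ξ h.le).1, (hr ξ h.le).2]
      constructor
      · refine (H.derivP ξ h).congr_of_eventuallyEq ?_
        filter_upwards [hev] with η hη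
        simp only [hP, hη.1]
      · refine (H.derivY ξ h).congr_of_eventuallyEq ?_
        filter_upwards [hev] with η hη
        simp only [hY, hη.1, hη.2]
  have hall : ∀ ξ, HasDerivAt P (W ξ) ξ ∧ HasDerivAt Y (-g (Φ ξ)) ξ := by
    intro ξ
    by_cases h : ξ = 0
    · subst h
      have hev : ∀ᶠ η in 𝓝[≠] (0 : ℝ), HasDerivAt P (W η) η ∧ HasDerivAt Y (-g (Φ η)) η := by
        filter_upwards [self_mem_nhdsWithin] with η hη using hne η hη
      exact ⟨hasDerivAt_of_eventually_punctured (hev.mono fun y hy => hy.1)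
          hPc.continuousAt hWc.continuousAt,
        hasDerivAt_of_eventually_punctured (F' := fun η => -g (Φ η))
          (hev.mono fun y hy => hy.2) hYc.continuousAt hgc.neg.continuousAt⟩
    · exact hne ξ h
  refine ⟨⟨hΦc.continuousOn, fun ξ _ => h01 ξ, hWc.continuousOn, fun ξ _ => (hall ξ).1,
    fun ξ _ => (hall ξ).2⟩, hanti, ?_, ?_⟩
  · have := (H₁.lim.comp tendsto_neg_atBot_atTop).const_sub 1
    rw [sub_zero] at this
    refine this.congr' ?_
    filter_upwards [eventually_le_atBot 0] with ξ hξ using (hl ξ hξ).1.symm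
  · refine H.lim.congr' ?_
    filter_upwards [eventually_ge_atTop 0] with ξ hξ using (hr ξ hξ).1.symm

lemma Wave.exists_eq_α (h : Wave D f g c φ Z) (A : Data D f g α) : ∃ a, φ a = α := by
  obtain ⟨x, hx⟩ := (h.bot.eventually (lt_mem_nhds A.α1)).exists
  obtain ⟨y, hy⟩ := (h.top.eventually (gt_mem_nhds A.α0)).exists
  have hc : Continuous φ := continuousOn_univ.1 h.strong.contφ
  exact mem_range_of_exists_le_of_exists_ge hc ⟨y, hy.le⟩ ⟨x, hx.le⟩

lemma Wave.below (h : Wave D f g c φ Z) (A : Data D f g α) {a : ℝ} (ha : φ a = α) :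
    Below D f g α c a φ Z := by
  refine (h.strong.mono (subset_univ (Ioi a))).below A (h.anti.antitoneOn _) ?_
  have := (h.strong.contφ.continuousAt (x := a) univ_mem).tendsto.mono_left
    (nhdsWithin_le_nhds (s := Ioi a))
  rwa [ha] at this

/-- A wavefront consists of its two halves; conversely two halves with a common speed are glued. -/
lemma Data.exists_wave_iff (A : Data D f g α) :
    (∃ φ, IsWavefront D f g c φ) ↔ cpn D f g α ≤ c := by
  rw [cpn, max_le_iff, ← A.vanishAt_iff, ← A.vanishAt_reflect_iff]
  constructor
  · rintro ⟨φ, hφ⟩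
    obtain ⟨Z, hZ⟩ := A.isWavefront_iff.1 hφ
    obtain ⟨a, ha⟩ := hZ.exists_eq_α A
    obtain ⟨b, hb⟩ := (hZ.reflect A).exists_eq_α A.reflect
    exact ⟨(hZ.below A ha).vanishAt A, ((hZ.reflect A).below A.reflect hb).vanishAt A.reflect⟩
  · rintro ⟨h1, h2⟩
    obtain ⟨φ, Z, H⟩ := A.exists_half h1
    obtain ⟨φ₁, Z₁, H₁⟩ := A.reflect.exists_half h2
    exact ⟨_, A.isWavefront_iff.2 ⟨_, H.wave A H₁⟩⟩

end Speeds

/-! ### Wavefronts to the right of the level `α` -/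

section Right

variable {D f g : ℝ → ℝ} {α c a : ℝ} {φ Z w φ₁ Z₁ φ₂ Z₂ : ℝ → ℝ}

lemma Wave.continuous (h : Wave D f g c φ Z) : Continuous φ := continuousOn_univ.1 h.strong.contφ

lemma Wave.mem (h : Wave D f g c φ Z) (ξ : ℝ) : φ ξ ∈ Icc (0 : ℝ) 1 := h.strong.mapsTo (mem_univ ξ)

lemma Wave.lt_α (h : Wave D f g c φ Z) (A : Data D f g α) (ha : φ a = α) {ξ : ℝ} (hξ : a < ξ) :
    φ ξ < α := (h.below A ha).lt ξ hξ

lemma Wave.α_lt (h : Wave D f g c φ Z) (A : Data D f g α) (ha : φ a = α) {ξ : ℝ} (hξ : ξ < a) :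
    α < φ ξ := by
  have := (h.reflect A).lt_α A.reflect (a := -a) (by simp [ha]) (neg_lt_neg hξ)
  simp only [neg_neg] at this
  linarith

lemma Wave.eq_α_iff (h : Wave D f g c φ Z) (A : Data D f g α) (ha : φ a = α) (ξ : ℝ) :
    φ ξ = α ↔ ξ = a := by
  constructor
  · intro hξ
    rcases lt_trichotomy ξ a with h1 | h1 | h1
    · exact absurd hξ (h.α_lt A ha h1).ne'
    · exact h1
    · exact absurd hξ (h.lt_α A ha h1).ne
  · rintro rfl
    exact ha

lemma Wave.mem_arc (h : Wave D f g c φ Z) {ξ : ℝ} (hξ : a < ξ) (h0 : 0 < φ ξ) : ξ ∈ arc φ a :=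
  ⟨hξ, fun _ hη => h0.trans_le (h.anti hη.2)⟩

/-- Right of `α` the profile solves the autonomous equation `φ' = -w(φ) / D(φ)`. -/
lemma Wave.hasDerivAt_right (h : Wave D f g c φ Z) (A : Data D f g α) (ha : φ a = α)
    (hw : IsSol (fun s => D s * g s) (dot f) α c w) {ξ : ℝ} (hξ : a < ξ) (h0 : 0 < φ ξ) :
    HasDerivAt φ (-(w (φ ξ) / D (φ ξ))) ξ := by
  have B := h.below A ha
  have hZ : Tendsto Z (𝓝[>] a) (𝓝 0) := by
    rw [← h.strong.flux_eq_zero_of_eq_α A isOpen_univ (mem_univ a) ha]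
    exact (h.strong.contZ.continuousAt univ_mem).tendsto.mono_left nhdsWithin_le_nhds
  have h1 := B.hasDerivAt A hξ h0
  rwa [B.flux_eq A hw hZ (h.mem_arc hξ h0), neg_div] at h1

lemma Wave.deriv_neg_right (h : Wave D f g c φ Z) (A : Data D f g α) (ha : φ a = α) {ξ : ℝ}
    (hξ : a < ξ) (h0 : 0 < φ ξ) : deriv φ ξ < 0 := by
  obtain ⟨w, hw⟩ := exists_isSol A.coef c
  have hm : φ ξ ∈ Ioo 0 α := ⟨h0, h.lt_α A ha hξ⟩
  rw [(h.hasDerivAt_right A ha hw hξ h0).deriv]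
  exact neg_lt_zero.2 (div_pos (hw.pos _ hm) (A.Dpos _ hm))

/-! ### Uniqueness -/

/-- The time since the passage through `α` is a function `G` of the value of the profile alone. -/
lemma Wave.time_eq (h : Wave D f g c φ Z) (A : Data D f g α) (ha : φ a = α)
    (hw : IsSol (fun s => D s * g s) (dot f) α c w) {G : ℝ → ℝ} (hGc : ContinuousOn G (Ioc 0 α))
    (hGα : G α = 0) (hGd : ∀ s ∈ Ioo 0 α, HasDerivAt G (-(D s / w s)) s) {ξ : ℝ} (hξ : a < ξ)
    (h0 : 0 < φ ξ) : G (φ ξ) = ξ - a := by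
  have hm : ∀ t ∈ Ioc a ξ, φ t ∈ Ioo 0 α := fun t ht =>
    ⟨h0.trans_le (h.anti ht.2), h.lt_α A ha ht.1⟩
  have hd : ∀ t ∈ Ioc a ξ, HasDerivAt (fun t => G (φ t) - t) 0 t := by
    intro t ht
    have h1 := ((hGd _ (hm t ht)).comp t
      (h.hasDerivAt_right A ha hw ht.1 (hm t ht).1)).sub (hasDerivAt_id t)
    refine h1.congr_deriv ?_
    have h2 := (A.Dpos _ (hm t ht)).ne'
    have h3 := (hw.pos _ (hm t ht)).ne'
    field_simp
    ring
  have hconst : ∀ᶠ t in 𝓝[>] a, G (φ t) - t = G (φ ξ) - ξ := by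
    filter_upwards [Ioo_mem_nhdsGT hξ] with t ht
    have hd' : ∀ r ∈ Icc t ξ, HasDerivAt (fun t => G (φ t) - t) 0 r := fun r hr =>
      hd r ⟨ht.1.trans_le hr.1, hr.2⟩
    have h1 := sub_le_mul_of_deriv_le (C := 0) ht.2 hd' (fun r _ => le_rfl)
    have h2 := mul_le_sub_of_le_deriv (C := 0) ht.2 hd' (fun r _ => le_rfl)
    linarith
  have hlim : Tendsto (fun t => G (φ t) - t) (𝓝[>] a) (𝓝 (G α - a)) := by
    refine Tendsto.sub ?_ (tendsto_id.mono_left nhdsWithin_le_nhds)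
    refine (hGc α ⟨A.α0, le_rfl⟩).tendsto.comp
      (tendsto_nhdsWithin_iff.2 ⟨(h.below A ha).lim, ?_⟩)
    filter_upwards [Ioo_mem_nhdsGT hξ] with t ht
    exact Ioo_subset_Ioc_self (hm t ⟨ht.1, ht.2.le⟩)
  have := tendsto_nhds_unique (tendsto_const_nhds.congr' (hconst.mono fun t ht => ht.symm)) hlim
  rw [hGα] at this
  linarith

lemma Wave.le_right (h₁ : Wave D f g c φ₁ Z₁) (h₂ : Wave D f g c φ₂ Z₂) (A : Data D f g α)
    {a₁ a₂ : ℝ} (ha₁ : φ₁ a₁ = α) (ha₂ : φ₂ a₂ = α) {t : ℝ} (ht : 0 < t) :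
    φ₁ (a₁ + t) ≤ φ₂ (a₂ + t) := by
  obtain ⟨w, hw⟩ := exists_isSol A.coef c
  obtain ⟨G, hGc, -, hGα, hGd⟩ := A.exists_time hw
  by_contra! hlt
  have h0 : 0 < φ₁ (a₁ + t) := (h₂.mem _).1.trans_lt hlt
  have hα : φ₁ (a₁ + t) < α := h₁.lt_α A ha₁ (by linarith)
  have e1 := h₁.time_eq A ha₁ hw hGc hGα hGd (show a₁ < a₁ + t by linarith) h0
  -- the second profile takes the same value at an earlier time
  obtain ⟨x, hx, hxe⟩ := intermediate_value_Icc' (show a₂ ≤ a₂ + t by linarith)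
    h₂.continuous.continuousOn (show φ₁ (a₁ + t) ∈ Icc (φ₂ (a₂ + t)) (φ₂ a₂) from
      ⟨hlt.le, by rw [ha₂]; exact hα.le⟩)
  have hx1 : a₂ < x := by
    refine lt_of_le_of_ne hx.1 ?_
    rintro rfl
    linarith
  have hx2 : x < a₂ + t := by
    refine lt_of_le_of_ne hx.2 ?_
    rintro rfl
    linarith
  have e2 := h₂.time_eq A ha₂ hw hGc hGα hGd hx1 (by rw [hxe]; exact h0)
  rw [hxe] at e2
  linarith

/-- Two wavefronts with the same speed are translated so that both take the value `α` at one point. -/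
theorem Wave.unique (h₁ : Wave D f g c φ₁ Z₁) (h₂ : Wave D f g c φ₂ Z₂) (A : Data D f g α) :
    ∃ τ : ℝ, ∀ ξ, φ₂ ξ = φ₁ (ξ + τ) := by
  obtain ⟨a₁, ha₁⟩ := h₁.exists_eq_α A
  obtain ⟨a₂, ha₂⟩ := h₂.exists_eq_α A
  have key : ∀ t, φ₁ (a₁ + t) = φ₂ (a₂ + t) := by
    intro t
    rcases lt_trichotomy t 0 with ht | ht | ht
    · have hr₁ := h₁.reflect A
      have hr₂ := h₂.reflect A
      have e1 := hr₁.le_right hr₂ A.reflect (a₁ := -a₁) (a₂ := -a₂) (by simp [ha₁]) (by simp [ha₂])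
        (neg_pos.2 ht)
      have e2 := hr₂.le_right hr₁ A.reflect (a₁ := -a₂) (a₂ := -a₁) (by simp [ha₂]) (by simp [ha₁])
        (neg_pos.2 ht)
      simp only [neg_add_rev, neg_neg, add_comm t] at e1 e2
      linarith
    · rw [ht, add_zero, add_zero, ha₁, ha₂]
    · exact le_antisymm (h₁.le_right h₂ A ha₁ ha₂ ht) (h₂.le_right h₁ A ha₂ ha₁ ht)
  refine ⟨a₁ - a₂, fun ξ => ?_⟩
  have := key (ξ - a₂)
  rw [add_sub_cancel] at this
  rw [← this]
  congr 1
  ring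

/-! ### The slope of the profile at `α` -/

lemma Wave.tendsto_deriv_comp (h : Wave D f g c φ Z) (A : Data D f g α) (ha : φ a = α)
    (hw : IsSol (fun s => D s * g s) (dot f) α c w) {l : Filter ℝ}
    (hl : Tendsto (fun s => -(w s / D s)) (𝓝[<] α) l) : Tendsto (deriv φ) (𝓝[>] a) l := by
  have h1 : Tendsto φ (𝓝[>] a) (𝓝[<] α) := tendsto_nhdsWithin_iff.2 ⟨(h.below A ha).lim, by
    filter_upwards [self_mem_nhdsWithin] with ξ hξ using h.lt_α A ha hξ⟩
  refine (hl.comp h1).congr' ?_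
  filter_upwards [self_mem_nhdsWithin, (h.below A ha).lim.eventually (lt_mem_nhds A.α0)]
    with ξ hξ h0
  exact (h.hasDerivAt_right A ha hw hξ h0).deriv.symm

lemma Wave.tendsto_deriv_right (h : Wave D f g c φ Z) (A : Data D f g α) (ha : φ a = α)
    (hs : sMinus D f g α c < 0) :
    Tendsto (deriv φ) (𝓝[>] a) (𝓝 (g α / sMinus D f g α c)) := by
  obtain ⟨w, hw⟩ := exists_isSol A.coef c
  refine h.tendsto_deriv_comp A ha hw ?_
  have h1 := ((A.tendsto_D_div_w hw).inv₀
    (div_pos (neg_pos.2 hs) A.gα).ne').neg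
  simpa [inv_div, neg_div, div_neg] using h1

lemma Wave.tendsto_deriv_right_atBot (h : Wave D f g c φ Z) (A : Data D f g α) (ha : φ a = α)
    (hs : sMinus D f g α c = 0) : Tendsto (deriv φ) (𝓝[>] a) atBot := by
  obtain ⟨w, hw⟩ := exists_isSol A.coef c
  refine h.tendsto_deriv_comp A ha hw ?_
  have h1 := A.tendsto_D_div_w hw
  rw [hs, neg_zero, zero_div] at h1
  have h2 : Tendsto (fun s => D s / w s) (𝓝[<] α) (𝓝[>] 0) := tendsto_nhdsWithin_iff.2 ⟨h1, by
    filter_upwards [Ioo_mem_nhdsLT A.α0] with s hs using div_pos (A.Dpos s hs) (hw.pos s hs)⟩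
  have h3 := tendsto_neg_atTop_atBot.comp (tendsto_inv_nhdsGT_zero.comp h2)
  simpa [Function.comp_def, inv_div] using h3

/-! ### Smoothness of the profile -/

/-- The derivative exists and is continuous at the point. -/
def C1At (φ : ℝ → ℝ) (ξ : ℝ) : Prop := DifferentiableAt ℝ φ ξ ∧ ContinuousAt (deriv φ) ξ

lemma C1At.of_eventually {F' : ℝ → ℝ} {ξ : ℝ} (h : ∀ᶠ η in 𝓝 ξ, HasDerivAt φ (F' η) η)
    (hc : ContinuousAt F' ξ) : C1At φ ξ :=
  ⟨h.self_of_nhds.differentiableAt, hc.congr (h.mono fun _ hη => hη.deriv.symm)⟩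

lemma deriv_one_sub_comp_neg (φ : ℝ → ℝ) (ξ : ℝ) :
    deriv (fun ξ => 1 - φ (-ξ)) ξ = deriv φ (-ξ) := by
  rw [deriv_const_sub, deriv_comp_neg, neg_neg]

lemma C1At.of_reflect {ξ : ℝ} (h : C1At (fun ξ => 1 - φ (-ξ)) (-ξ)) : C1At φ ξ := by
  constructor
  · have h1 : DifferentiableAt ℝ (fun x => 1 - (1 - φ (- -x))) ξ :=
      (differentiableAt_const _).sub
        (DifferentiableAt.comp (f := fun x : ℝ => -x) ξ h.1 differentiable_neg.differentiableAt)
    simpa using h1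
  · have h1 : ContinuousAt (fun x => deriv (fun ξ => 1 - φ (-ξ)) (-x)) ξ :=
      ContinuousAt.comp (f := fun x : ℝ => -x) h.2 continuous_neg.continuousAt
    simp only [deriv_one_sub_comp_neg, neg_neg] at h1
    exact h1

lemma C1At.of_eventually_const {ξ k : ℝ} (h : ∀ᶠ η in 𝓝 ξ, φ η = k) : C1At φ ξ := by
  refine C1At.of_eventually (F' := fun _ => 0) ?_ continuousAt_const
  filter_upwards [h.eventually_nhds] with η hη
  exact (hasDerivAt_const η k).congr_of_eventuallyEq hη

lemma Wave.continuousAt_slope (h : Wave D f g c φ Z) (A : Data D f g α) (ha : φ a = α)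
    (hw : IsSol (fun s => D s * g s) (dot f) α c w) {ξ : ℝ} (hξ : a < ξ) (h0 : 0 < φ ξ) :
    ContinuousAt (fun η => -(w (φ η) / D (φ η))) ξ := by
  have hm : φ ξ ∈ Ioo 0 α := ⟨h0, h.lt_α A ha hξ⟩
  have h1 : ContinuousAt (fun s => -(w s / D s)) (φ ξ) :=
    ((hw.deriv _ hm).continuousAt.div (continuousAt_of_mem_Ioo A.contD (A.mem_of_lt hm))
      (A.Dpos _ hm).ne').neg
  exact ContinuousAt.comp (g := fun s => -(w s / D s)) h1 h.continuous.continuousAt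

lemma Wave.c1At_of_pos (h : Wave D f g c φ Z) (A : Data D f g α) (ha : φ a = α) {ξ : ℝ}
    (hξ : a < ξ) (h0 : 0 < φ ξ) : C1At φ ξ := by
  obtain ⟨w, hw⟩ := exists_isSol A.coef c
  refine C1At.of_eventually ?_ (h.continuousAt_slope A ha hw hξ h0)
  filter_upwards [Ioi_mem_nhds hξ, h.continuous.continuousAt.eventually (lt_mem_nhds h0)]
    with η hη hη0 using h.hasDerivAt_right A ha hw hη hη0

/-- If the profile reaches `0`, it does so at a first point, and stays there. -/
lemma Wave.exists_first_zero (h : Wave D f g c φ Z) (A : Data D f g α) (ha : φ a = α)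
    (hex : ∃ ξ, φ ξ = 0) :
    ∃ e > a, (∀ ξ < e, 0 < φ ξ) ∧ ∀ ξ ≥ e, φ ξ = 0 := by
  set S := φ ⁻¹' {0} with hS
  have hSc : IsClosed S := isClosed_singleton.preimage h.continuous
  have hlow : ∀ ξ ≤ a, 0 < φ ξ := fun ξ hξ => by
    have := h.anti hξ
    rw [ha] at this
    exact A.α0.trans_le this
  have hSb : BddBelow S := ⟨a, fun ξ hξ => by
    by_contra! hlt
    exact absurd hξ (hlow ξ hlt.le).ne'⟩
  have he : sInf S ∈ S := hSc.csInf_mem hex hSb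
  refine ⟨sInf S, ?_, fun ξ hξ => lt_of_le_of_ne (h.mem ξ).1 fun h0 => ?_, fun ξ hξ => ?_⟩
  · by_contra! hle
    exact absurd he (hlow _ hle).ne'
  · exact absurd (csInf_le hSb h0.symm) (not_le.2 hξ)
  · exact le_antisymm ((h.anti hξ).trans_eq he) (h.mem ξ).1

lemma tendsto_left_of_pos {e : ℝ} (hc : Continuous φ) (hpos : ∀ ξ < e, 0 < φ ξ) (he : φ e = 0) :
    Tendsto φ (𝓝[<] e) (𝓝[>] 0) := by
  refine tendsto_nhdsWithin_iff.2 ⟨?_, ?_⟩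
  · rw [← he]
    exact (hc.tendsto e).mono_left nhdsWithin_le_nhds
  · filter_upwards [self_mem_nhdsWithin] with ξ hξ using hpos ξ hξ

/-- If `w / D → 0` at `0`, the profile reaches `0` with zero slope. -/
lemma Wave.c1At_right (h : Wave D f g c φ Z) (A : Data D f g α) (ha : φ a = α)
    (hw : IsSol (fun s => D s * g s) (dot f) α c w)
    (hsmall : ∀ ε > 0, ∀ᶠ s in 𝓝[>] 0, w s ≤ ε * D s) {ξ : ℝ} (hξ : a < ξ) : C1At φ ξ := by
  rcases (h.mem ξ).1.lt_or_eq with h0 | h0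
  · exact h.c1At_of_pos A ha hξ h0
  obtain ⟨e, hae, hpos, hzero⟩ := h.exists_first_zero A ha ⟨ξ, h0.symm⟩
  have heξ : e ≤ ξ := by
    by_contra! hlt
    exact absurd h0 (hpos ξ hlt).ne
  have hafter : ∀ z > e, ∀ᶠ η in 𝓝 z, φ η = 0 := fun z hz => by
    filter_upwards [Ioi_mem_nhds hz] with η hη using hzero η (le_of_lt hη)
  rcases heξ.lt_or_eq with hlt | rfl
  · exact C1At.of_eventually_const (hafter ξ hlt)
  set F' : ℝ → ℝ := fun η => if η < e then -(w (φ η) / D (φ η)) else 0 with hF'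
  have hleft : ∀ η < e, F' η = -(w (φ η) / D (φ η)) := fun η hη => if_pos hη
  have hright : ∀ η ≥ e, F' η = 0 := fun η hη => if_neg (not_lt.2 hη)
  have hF'c : ContinuousAt F' e := by
    rw [continuousAt_iff_continuous_left'_right']
    constructor
    · rw [ContinuousWithinAt, hright e le_rfl]
      have h1 : Tendsto (fun s => -(w s / D s)) (𝓝[>] 0) (𝓝 0) := by
        suffices h2 : Tendsto (fun s => w s / D s) (𝓝[>] 0) (𝓝 0) by simpa using h2.neg
        refine tendsto_order.2 ⟨fun b hb => ?_, fun b hb => ?_⟩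
        · filter_upwards [Ioo_mem_nhdsGT A.α0] with s hs
          exact hb.trans (div_pos (hw.pos s hs) (A.Dpos s hs))
        · filter_upwards [hsmall (b / 2) (by linarith), Ioo_mem_nhdsGT A.α0] with s hs hs'
          rw [div_lt_iff₀ (A.Dpos s hs')]
          have := A.Dpos s hs'
          nlinarith
      refine (h1.comp (tendsto_left_of_pos h.continuous hpos (hzero e le_rfl))).congr' ?_
      filter_upwards [self_mem_nhdsWithin] with η hη using (hleft η hη).symm
    · rw [ContinuousWithinAt, hright e le_rfl]
      refine tendsto_const_nhds.congr' ?_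
      filter_upwards [self_mem_nhdsWithin] with η hη using (hright η (le_of_lt hη)).symm
  have hpunct : ∀ᶠ η in 𝓝[≠] e, HasDerivAt φ (F' η) η := by
    filter_upwards [self_mem_nhdsWithin, nhdsWithin_le_nhds (Ioi_mem_nhds hae)] with η hη hηa
    rcases lt_or_gt_of_ne hη with hlt | hlt
    · rw [hleft η hlt]
      exact h.hasDerivAt_right A ha hw hηa (hpos η hlt)
    · rw [hright η hlt.le]
      exact (hasDerivAt_const η (0 : ℝ)).congr_of_eventuallyEq (hafter η hlt)
  refine C1At.of_eventually ?_ hF'c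
  have := hasDerivAt_of_eventually_punctured hpunct h.continuous.continuousAt hF'c
  filter_upwards [eventually_nhdsWithin_iff.1 hpunct] with η hη
  by_cases hηe : η = e
  · rwa [hηe]
  · exact hη hηe

/-- Where the profile is `C¹` its flux is too, hence locally Lipschitz and absolutely continuous. -/
lemma Wave.isClassicalOn (h : Wave D f g c φ Z) (A : Data D f g α) {J : Set ℝ} (hJ : IsOpen J)
    (hC : ∀ ξ ∈ J, C1At φ ξ) : IsClassicalOn D f g c φ J := by
  have hZ : ∀ ξ ∈ J, D (φ ξ) * deriv φ ξ = Z ξ := fun ξ hξ =>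
    (h.strong.eq_mul_deriv A.contD isOpen_univ (mem_univ ξ) (hC ξ hξ).1.hasDerivAt).symm
  have hd : ∀ ξ ∈ J, HasDerivAt Z (-g (φ ξ) + (dot f (φ ξ) - c) * deriv φ ξ) ξ := by
    intro ξ hξ
    have hφ := (hC ξ hξ).1.hasDerivAt
    have h1 : HasDerivAt (fun η => f (φ η)) (dot f (φ ξ) * deriv φ ξ) ξ := by
      have := (hasDerivWithinAt_dot A.hf.1 (h.mem ξ)).comp ξ (hφ.hasDerivWithinAt (s := univ))
        fun η _ => h.mem η
      rwa [hasDerivWithinAt_univ] at this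
    have h2 := ((h.strong.derivY ξ (mem_univ ξ)).add h1).sub (hφ.const_mul c)
    refine (h2.congr_of_eventuallyEq (Eventually.of_forall fun η => ?_)).congr_deriv (by ring)
    simp only [Pi.add_apply, Pi.sub_apply]
    ring
  have hfc : Continuous fun ξ => dot f (φ ξ) :=
    (continuousOn_dot A.hf.1).comp_continuous h.continuous h.mem
  have hgc : Continuous fun ξ => g (φ ξ) := A.contg.comp_continuous h.continuous h.mem
  refine ⟨fun ξ hξ => (hC ξ hξ).1, fun x y hxy hsub => ?_, ?_⟩
  · have hc : ContinuousOn (fun ξ => -g (φ ξ) + (dot f (φ ξ) - c) * deriv φ ξ) (Icc x y) :=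
      fun ξ hξ => (hgc.continuousAt.neg.add ((hfc.continuousAt.sub continuousAt_const).mul
        (hC ξ (hsub hξ)).2)).continuousWithinAt
    obtain ⟨K, hK⟩ := isCompact_Icc.exists_bound_of_continuousOn hc
    have hlip : LipschitzOnWith (Real.toNNReal K) Z (uIcc x y) := by
      rw [uIcc_of_le hxy]
      refine (convex_Icc x y).lipschitzOnWith_of_nnnorm_hasDerivWithin_le
        (fun ξ hξ => (hd ξ (hsub hξ)).hasDerivWithinAt) fun ξ hξ => ?_
      rw [← NNReal.coe_le_coe, coe_nnnorm]
      exact (hK ξ hξ).trans (Real.le_coe_toNNReal K)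
    refine LipschitzOnWith.absolutelyContinuousOnInterval (K := Real.toNNReal K) ?_
    rw [uIcc_of_le hxy] at hlip ⊢
    intro ξ hξ η hη
    show edist (D (φ ξ) * deriv φ ξ) (D (φ η) * deriv φ η) ≤ _
    rw [hZ ξ (hsub hξ), hZ η (hsub hη)]
    exact hlip hξ hη
  · filter_upwards [ae_restrict_mem hJ.measurableSet] with ξ hξ
    have : deriv (fun η => D (φ η) * deriv φ η) ξ = -g (φ ξ) + (dot f (φ ξ) - c) * deriv φ ξ := by
      rw [← (hd ξ hξ).deriv]
      refine EventuallyEq.deriv_eq ?_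
      filter_upwards [hJ.mem_nhds hξ] with η hη using hZ η hη
    rw [this]
    ring

/-! ### Reaching the equilibrium `0` -/

/-- A bound `w / D = O(s)` makes `φ'` at least `-M φ`, so the profile decays at most
exponentially. -/
lemma Wave.pos_of_le (h : Wave D f g c φ Z) (A : Data D f g α) (ha : φ a = α)
    (hw : IsSol (fun s => D s * g s) (dot f) α c w) {M : ℝ}
    (hM : ∀ᶠ s in 𝓝[>] 0, w s ≤ M * s * D s) (ξ : ℝ) : 0 < φ ξ := by
  refine lt_of_le_of_ne (h.mem ξ).1 fun h0 => ?_
  obtain ⟨e, hae, hpos, hzero⟩ := h.exists_first_zero A ha ⟨ξ, h0.symm⟩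
  have hlim := tendsto_left_of_pos h.continuous hpos (hzero e le_rfl)
  obtain ⟨x, hx, hx'⟩ := exists_Ioo_of_eventually_left hae (hlim.eventually hM)
  obtain ⟨y, hxy, hye⟩ := exists_between hx.2
  have hd : ∀ t ∈ Ioo x e, HasDerivAt (fun t => φ t * Real.exp (M * t))
      (-(w (φ t) / D (φ t)) * Real.exp (M * t) + φ t * (Real.exp (M * t) * (M * 1))) t :=
    fun t ht => (h.hasDerivAt_right A ha hw (hx.1.trans_lt ht.1) (hpos t ht.2)).mul
      (((hasDerivAt_id t).const_mul M).exp)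
  have hge : ∀ᶠ t in 𝓝[<] e, φ y * Real.exp (M * y) ≤ φ t * Real.exp (M * t) := by
    filter_upwards [Ioo_mem_nhdsLT hye] with t ht
    have := mul_le_sub_of_le_deriv (C := 0) ht.1
      (fun r hr => hd r ⟨hxy.trans_le hr.1, hr.2.trans_lt ht.2⟩) (fun r hr => by
        have hr' : r ∈ Ioo x e := ⟨hxy.trans hr.1, hr.2.trans ht.2⟩
        have hm : φ r ∈ Ioo 0 α := ⟨hpos r hr'.2, h.lt_α A ha (hx.1.trans_lt hr'.1)⟩
        have h1 : w (φ r) / D (φ r) ≤ M * φ r := by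
          rw [div_le_iff₀ (A.Dpos _ hm)]; exact hx' r hr'
        have h2 := Real.exp_pos (M * r)
        nlinarith)
    linarith
  have hlim2 : Tendsto (fun t => φ t * Real.exp (M * t)) (𝓝[<] e) (𝓝 (φ e * Real.exp (M * e))) :=
    ((h.continuous.mul (Real.continuous_exp.comp (continuous_const.mul continuous_id))).tendsto
      e).mono_left nhdsWithin_le_nhds
  have h1 := ge_of_tendsto hlim2 hge
  rw [hzero e le_rfl, zero_mul] at h1
  exact absurd h1 (not_le.2 (mul_pos (hpos y hye) (Real.exp_pos _)))

/-- The solution of the first-order problem for the speed of a wavefront vanishes at `0`. -/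
lemma Wave.isSol_tendsto (h : Wave D f g c φ Z) (A : Data D f g α)
    (hw : IsSol (fun s => D s * g s) (dot f) α c w) : Tendsto w (𝓝[>] 0) (𝓝 0) := by
  obtain ⟨a, ha⟩ := h.exists_eq_α A
  obtain ⟨v, hv, hv0⟩ := (h.below A ha).vanishAt A
  refine hv0.congr' ?_
  filter_upwards [Ioo_mem_nhdsGT A.α0] with s hs using hv.eq A.coef hw ⟨hs.1, hs.2.le⟩

/-- Sufficient conditions for the equilibrium `0` not to be reached.  If `D(0) > 0`, the bound
`w = O(s)` is enough; if `D(0) = 0`, the sharper bound `w = O(s D)` is used. -/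
lemma Wave.pos (h : Wave D f g c φ Z) (A : Data D f g α)
    (hc : 0 < D 0 ∨ cpr D f g α < c ∧ diniUpperRight g 0 < ⊤) (ξ : ℝ) : 0 < φ ξ := by
  obtain ⟨a, ha⟩ := h.exists_eq_α A
  obtain ⟨w, hw⟩ := exists_isSol A.coef c
  have hpos : 0 < D 0 → 0 < φ ξ := by
    intro hD0
    obtain ⟨C, hC, hCw⟩ := hw.exists_le_mul A.coef (.of_tendsto A.α0 (h.isSol_tendsto A hw))
    refine h.pos_of_le A ha hw (M := 2 * C / D 0) ?_ ξ
    filter_upwards [Ioo_mem_nhdsGT A.α0,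
      (tendsto_zero_right A.contD).eventually (lt_mem_nhds (half_lt_self hD0))] with s hs hDs
    have hs0 := hs.1
    calc w s ≤ C * s := hCw s hs
      _ = 2 * C / D 0 * s * (D 0 / 2) := by field_simp
      _ ≤ 2 * C / D 0 * s * D s := by gcongr
  rcases hc with hD0 | ⟨hc, hdini⟩
  · exact hpos hD0
  rcases A.D0.lt_or_eq with hD0 | hD0
  · exact hpos hD0
  have hv : VanishAt D f g α (cpr D f g α) := A.vanishAt_iff.2 le_rfl
  obtain ⟨M, -, hM⟩ := A.eventually_le_mul_mul_D hD0.symm ((Vanish.le A.coef hv).trans_lt hc) hw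
    (fun ε hε => A.eventually_le_mul_D hv hc hw hε) hdini
  exact h.pos_of_le A ha hw hM ξ

lemma Wave.c1At (h : Wave D f g c φ Z) (A : Data D f g α) (ha : φ a = α)
    (hc : 0 < D 0 ∨ cpr D f g α < c) {ξ : ℝ} (hξ : a < ξ) : C1At φ ξ := by
  rcases hc with hD0 | hc
  · exact h.c1At_of_pos A ha hξ (h.pos A (Or.inl hD0) ξ)
  · obtain ⟨w, hw⟩ := exists_isSol A.coef c
    exact h.c1At_right A ha hw
      (fun ε hε => A.eventually_le_mul_D (A.vanishAt_iff.2 le_rfl) hc hw hε) hξ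

/-- At the threshold speed, with `D(0) = 0`, the profile reaches `0` at a finite point with a
nonzero slope. -/
lemma Wave.sharp (h : Wave D f g c φ Z) (A : Data D f g α) (ha : φ a = α) (hD0 : D 0 = 0)
    (hc : c = cpr D f g α) (hfc : dot f 0 < c) :
    ∃ e > a, φ e = 0 ∧ (∀ ξ > a, ξ ≠ e → C1At φ ξ) ∧ ¬ DifferentiableAt ℝ φ e ∧
      (0 < dot D 0 → Tendsto (deriv φ) (𝓝[<] e) (𝓝 ((dot f 0 - c) / dot D 0))) ∧
      (dot D 0 = 0 → Tendsto (deriv φ) (𝓝[<] e) atBot) := by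
  obtain ⟨w, hw⟩ := exists_isSol A.coef c
  obtain ⟨ε, hε, hup⟩ := A.exists_mul_D_lt hD0 hfc hw fun c' hc' hv =>
    absurd (A.vanishAt_iff.1 hv) (not_le.2 (hc ▸ hc'))
  -- near `0` the profile descends with slope at most `-ε`
  obtain ⟨δ, hδ, hδ'⟩ := exists_Ioo_of_eventually A.α0 hup
  have hslope : ∀ ξ > a, φ ξ ∈ Ioo 0 δ → -(w (φ ξ) / D (φ ξ)) ≤ -ε := by
    intro ξ hξ hm
    have hD := A.Dpos _ ⟨hm.1, hm.2.trans_le hδ.2⟩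
    rw [neg_le_neg_iff, le_div_iff₀ hD]
    exact (hδ' _ hm).le
  -- hence `0` is reached in finite time
  have hex : ∃ ξ, φ ξ = 0 := by
    by_contra! hne
    have hp : ∀ ξ, 0 < φ ξ := fun ξ => lt_of_le_of_ne (h.mem ξ).1 (hne ξ).symm
    obtain ⟨x, hx, hxa⟩ := ((h.top.eventually (gt_mem_nhds hδ.1)).and
      (eventually_gt_atTop a)).exists
    have hlt : x < x + (1 + 1 / ε) := by have : 0 < 1 / ε := by positivity
                                         linarith
    have h1 := sub_le_mul_of_deriv_le (C := -ε) hlt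
      (fun t ht => h.hasDerivAt_right A ha hw (hxa.trans_le ht.1) (hp t))
      (fun t ht => hslope t (hxa.trans ht.1) ⟨hp t, (h.anti ht.1.le).trans_lt hx⟩)
    have h2 := hp (x + (1 + 1 / ε))
    have h3 := (h.mem x).2
    have h4 : -ε * (x + (1 + 1 / ε) - x) = -ε - 1 := by field_simp; ring
    linarith
  obtain ⟨e, hae, hpos, hzero⟩ := h.exists_first_zero A ha hex
  have hlim := tendsto_left_of_pos h.continuous hpos (hzero e le_rfl)
  have hderiv : ∀ᶠ ξ in 𝓝[<] e, -(w (φ ξ) / D (φ ξ)) = deriv φ ξ := by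
    filter_upwards [Ioo_mem_nhdsLT hae] with ξ hξ
    exact (h.hasDerivAt_right A ha hw hξ.1 (hpos ξ hξ.2)).deriv.symm
  -- the slope of `w` at `0` is `c - h(0)`
  have hwlim : Tendsto (fun s => w s / s) (𝓝[>] 0) (𝓝 (c - dot f 0)) := by
    refine tendsto_order.2 ⟨fun m hm => ?_, fun m hm => ?_⟩
    · obtain ⟨m', h1, h2⟩ := exists_between hm
      filter_upwards [A.eventually_mul_le hw hε hup h2, self_mem_nhdsWithin] with s hs hs0
      exact h1.trans_le ((le_div_iff₀ hs0).2 hs)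
    · obtain ⟨m', h1, h2⟩ := exists_between hm
      obtain ⟨b, hb, hb'⟩ := A.coef.eventually_lt h1
      filter_upwards [Ioo_mem_nhdsGT hb.1] with s hs
      have := hw.le_mul A.coef (.of_tendsto A.α0 (h.isSol_tendsto A hw)) hb.2
        (fun t ht => (hb' t ht).le) hs
      exact ((div_le_iff₀ hs.1).2 this).trans_lt h2
  have hDlim := A.tendsto_D_div hD0
  refine ⟨e, hae, hzero e le_rfl, fun ξ hξ hne => ?_, fun hdiff => ?_, fun hd0 => ?_, fun hd0 => ?_⟩
  · rcases lt_or_gt_of_ne hne with hlt | hlt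
    · exact h.c1At_of_pos A ha hξ (hpos ξ hlt)
    · refine C1At.of_eventually_const (k := 0) ?_
      filter_upwards [Ioi_mem_nhds hlt] with η hη using hzero η (le_of_lt hη)
  · have hs := hasDerivAt_iff_tendsto_slope.1 hdiff.hasDerivAt
    have hr : deriv φ e = 0 := by
      refine tendsto_nhds_unique (hs.mono_left
        (nhdsWithin_mono e (show Ioi e ⊆ {e}ᶜ from fun s hs => ne_of_gt hs))) ?_
      refine tendsto_const_nhds.congr' ?_
      filter_upwards [self_mem_nhdsWithin] with ξ hξ
      rw [slope_def_field, hzero ξ (le_of_lt hξ), hzero e le_rfl, sub_zero, zero_div]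
    have hl : deriv φ e ≤ -ε := by
      refine le_of_tendsto (hs.mono_left
        (nhdsWithin_mono e (show Iio e ⊆ {e}ᶜ from fun s hs => ne_of_lt hs))) ?_
      have hev : ∀ᶠ ξ in 𝓝[<] e, φ ξ < δ :=
        (hlim.mono_right nhdsWithin_le_nhds).eventually (gt_mem_nhds hδ.1)
      filter_upwards [hev, Ioo_mem_nhdsLT hae] with ξ hξδ hξ
      -- the estimate on `(ξ, t)` with `t < e` passes to the limit `t → e`
      have h1 : ∀ᶠ t in 𝓝[<] e, φ t ≤ φ ξ + -ε * (t - ξ) := by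
        filter_upwards [Ioo_mem_nhdsLT hξ.2] with t ht
        have := sub_le_mul_of_deriv_le (C := -ε) ht.1
          (fun r hr => h.hasDerivAt_right A ha hw (hξ.1.trans_le hr.1) (hpos r (hr.2.trans_lt ht.2)))
          (fun r hr => hslope r (hξ.1.trans hr.1)
            ⟨hpos r (hr.2.trans ht.2), (h.anti hr.1.le).trans_lt hξδ⟩)
        linarith
      have h2 : Tendsto (fun t => φ ξ + -ε * (t - ξ)) (𝓝[<] e) (𝓝 (φ ξ + -ε * (e - ξ))) :=
        ((continuous_const.add (continuous_const.mul
          (continuous_id.sub continuous_const))).tendsto e).mono_left nhdsWithin_le_nhds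
      have h3 := le_of_tendsto_of_tendsto (hlim.mono_right nhdsWithin_le_nhds) h2 h1
      rw [slope_def_field, hzero e le_rfl, sub_zero, div_le_iff_of_neg (by linarith [hξ.2])]
      linarith
    linarith
  · refine Tendsto.congr' hderiv ?_
    have h1 := (hwlim.div hDlim hd0.ne').neg
    rw [show -((c - dot f 0) / dot D 0) = (dot f 0 - c) / dot D 0 by ring] at h1
    refine (h1.comp hlim).congr' ?_
    filter_upwards [Ioo_mem_nhdsLT hae] with ξ hξ
    have := (hpos ξ hξ.2).ne'
    simp only [Function.comp_def, Pi.div_apply]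
    rw [div_div_div_cancel_right₀ this]
  · refine Tendsto.congr' hderiv ?_
    have h1 : Tendsto (fun s => D s / w s) (𝓝[>] 0) (𝓝 0) := by
      have h2 := hDlim.div hwlim (sub_pos.2 hfc).ne'
      rw [hd0, zero_div] at h2
      refine h2.congr' ?_
      filter_upwards [self_mem_nhdsWithin] with s hs
      have hs0 : s ≠ 0 := ne_of_gt hs
      simp only [Pi.div_apply]
      rw [div_div_div_cancel_right₀ hs0]
    have h2 : Tendsto (fun s => D s / w s) (𝓝[>] 0) (𝓝[>] 0) := tendsto_nhdsWithin_iff.2 ⟨h1, by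
      filter_upwards [Ioo_mem_nhdsGT A.α0] with s hs using div_pos (A.Dpos s hs) (hw.pos s hs)⟩
    have h3 := tendsto_neg_atTop_atBot.comp (tendsto_inv_nhdsGT_zero.comp (h2.comp hlim))
    simpa [Function.comp_def, inv_div] using h3

lemma Wave.deriv_neg (h : Wave D f g c φ Z) (A : Data D f g α) {ξ : ℝ}
    (hξ : φ ξ ∈ Ioo (0 : ℝ) 1 \ {α}) : deriv φ ξ < 0 := by
  obtain ⟨a, ha⟩ := h.exists_eq_α A
  have hne : ξ ≠ a := fun he => hξ.2 ((h.eq_α_iff A ha ξ).2 he)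
  rcases lt_or_gt_of_ne hne with hlt | hlt
  · have h1 := (h.reflect A).deriv_neg_right A.reflect (a := -a) (by simp [ha]) (neg_lt_neg hlt)
      (by simpa using hξ.1.2)
    rwa [deriv_one_sub_comp_neg, neg_neg] at h1
  · exact h.deriv_neg_right A ha hlt hξ.1.1

/-- On an interval of constancy the derivative would vanish at a point where it is negative. -/
lemma Wave.strictAnti (h : Wave D f g c φ Z) (A : Data D f g α) (h0 : ∀ ξ, 0 < φ ξ)
    (h1 : ∀ ξ, φ ξ < 1) : StrictAnti φ := by
  intro x y hxy
  refine lt_of_le_of_ne (h.anti hxy.le) fun heq => ?_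
  obtain ⟨a, ha⟩ := h.exists_eq_α A
  obtain ⟨ξ, hξ, hξa⟩ : ∃ ξ ∈ Ioo x y, ξ ≠ a := by
    obtain ⟨u, hu1, hu2⟩ := exists_between hxy
    by_cases hua : u = a
    · obtain ⟨v, hv1, hv2⟩ := exists_between hu2
      exact ⟨v, ⟨hu1.trans hv1, hv2⟩, fun hva => by linarith [hva.trans hua.symm]⟩
    · exact ⟨u, ⟨hu1, hu2⟩, hua⟩
  have hneg := h.deriv_neg A (ξ := ξ) ⟨⟨h0 ξ, h1 ξ⟩, fun he => hξa ((h.eq_α_iff A ha ξ).1 he)⟩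
  have hev : φ =ᶠ[𝓝 ξ] fun _ => φ x := by
    filter_upwards [Ioo_mem_nhds hξ.1 hξ.2] with η hη
    exact le_antisymm (h.anti hη.1.le) (heq ▸ h.anti hη.2.le)
  rw [hev.deriv_eq, deriv_const] at hneg
  exact lt_irrefl _ hneg

end Right

/-! ### Wavefronts to the left of the level `α` -/

section Left

variable {D f g : ℝ → ℝ} {α c a e : ℝ} {φ Z : ℝ → ℝ}

lemma tendsto_deriv_left_of_reflect {l : Filter ℝ}
    (h : Tendsto (deriv fun ξ => 1 - φ (-ξ)) (𝓝[>] (-a)) l) : Tendsto (deriv φ) (𝓝[<] a) l := by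
  have hn : Tendsto (fun ξ : ℝ => -ξ) (𝓝[<] a) (𝓝[>] (-a)) := tendsto_neg_nhdsLT
  refine (h.comp hn).congr fun ξ => ?_
  rw [Function.comp_apply, deriv_one_sub_comp_neg, neg_neg]

lemma tendsto_deriv_right_of_reflect {l : Filter ℝ}
    (h : Tendsto (deriv fun ξ => 1 - φ (-ξ)) (𝓝[<] e) l) : Tendsto (deriv φ) (𝓝[>] (-e)) l := by
  have hn : Tendsto (fun ξ : ℝ => -ξ) (𝓝[>] (-e)) (𝓝[<] e) := tendsto_neg_nhdsGT_neg
  refine (h.comp hn).congr fun ξ => ?_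
  rw [Function.comp_apply, deriv_one_sub_comp_neg, neg_neg]

lemma differentiableAt_reflect {ξ : ℝ} (h : DifferentiableAt ℝ φ (-ξ)) :
    DifferentiableAt ℝ (fun ξ => 1 - φ (-ξ)) ξ :=
  (DifferentiableAt.comp (f := fun x : ℝ => -x) ξ h differentiable_neg.differentiableAt).const_sub 1

lemma Wave.tendsto_deriv_left (h : Wave D f g c φ Z) (A : Data D f g α) (ha : φ a = α)
    (hs : sMinus D f g α c < 0) :
    Tendsto (deriv φ) (𝓝[<] a) (𝓝 (g α / sMinus D f g α c)) := by
  have h1 := (h.reflect A).tendsto_deriv_right A.reflect (a := -a) (by simp [ha])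
    (by rwa [sMinus_reflect A])
  rw [sMinus_reflect A, reflG, sub_sub_cancel] at h1
  exact tendsto_deriv_left_of_reflect h1

lemma Wave.tendsto_deriv_left_atBot (h : Wave D f g c φ Z) (A : Data D f g α) (ha : φ a = α)
    (hs : sMinus D f g α c = 0) : Tendsto (deriv φ) (𝓝[<] a) atBot :=
  tendsto_deriv_left_of_reflect <| (h.reflect A).tendsto_deriv_right_atBot A.reflect (a := -a)
    (by simp [ha]) (by rwa [sMinus_reflect A])

lemma Wave.c1At_left (h : Wave D f g c φ Z) (A : Data D f g α) (ha : φ a = α)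
    (hc : D 1 < 0 ∨ cnl D f g α < c) {ξ : ℝ} (hξ : ξ < a) : C1At φ ξ := by
  refine C1At.of_reflect ((h.reflect A).c1At A.reflect (a := -a) (by simp [ha]) ?_ (neg_lt_neg hξ))
  rwa [A.cpr_reflect, reflD, sub_zero, neg_pos]

lemma Wave.lt_one (h : Wave D f g c φ Z) (A : Data D f g α)
    (hc : D 1 < 0 ∨ cnl D f g α < c ∧ diniUpperLeft (fun s => -g s) 1 < ⊤) (ξ : ℝ) : φ ξ < 1 := by
  have h1 := (h.reflect A).pos A.reflect (ξ := -ξ) <| by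
    have h2 := diniUpperRight_reflect fun s => -g s
    simp only [neg_neg] at h2
    rwa [A.cpr_reflect, reflD, sub_zero, neg_pos, show reflG g = fun s => g (1 - s) from rfl, h2]
  simpa using h1

/-- A profile that is `C¹` off the level `α` is classical there. -/
lemma Wave.isClassicalOn_compl (h : Wave D f g c φ Z) (A : Data D f g α)
    (hr : ∀ ξ, a < ξ → C1At φ ξ) (hl : ∀ ξ, ξ < a → C1At φ ξ) :
    IsClassicalOn D f g c φ {a}ᶜ :=
  h.isClassicalOn A isOpen_compl_singleton fun ξ hξ =>
    (lt_or_gt_of_ne (show ξ ≠ a from hξ)).elim (hl ξ) (hr ξ)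

lemma Wave.isSharpAt_zero (h : Wave D f g c φ Z) (A : Data D f g α) (ha : φ a = α) (hD0 : D 0 = 0)
    (hc : c = cpr D f g α) (hfc : dot f 0 < c) :
    ∃ e, a < e ∧ IsSharpAt D f g c φ (Ioi a) 0 e ∧
      (0 < dot D 0 → Tendsto (deriv φ) (𝓝[<] e) (𝓝 ((dot f 0 - c) / dot D 0))) ∧
      (dot D 0 = 0 → Tendsto (deriv φ) (𝓝[<] e) atBot) := by
  obtain ⟨e, hae, he, hC, hnd, h1, h2⟩ := h.sharp A ha hD0 hc hfc
  exact ⟨e, hae, ⟨hae, he, h.isClassicalOn A (isOpen_Ioi.sdiff isClosed_singleton)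
    fun ξ hξ => hC ξ hξ.1 hξ.2, hnd⟩, h1, h2⟩

lemma Wave.isSharpAt_one (h : Wave D f g c φ Z) (A : Data D f g α) (ha : φ a = α) (hD1 : D 1 = 0)
    (hc : c = cnl D f g α) (hfc : dot f 1 < c) :
    ∃ e, e < a ∧ IsSharpAt D f g c φ (Iio a) 1 e ∧
      (0 < dot D 1 → Tendsto (deriv φ) (𝓝[>] e) (𝓝 ((dot f 1 - c) / dot D 1))) ∧
      (dot D 1 = 0 → Tendsto (deriv φ) (𝓝[>] e) atBot) := by
  have hf0 : dot (reflF f) 0 = dot f 1 := by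
    rw [dot_reflF A.hf.1 (left_mem_Icc.2 zero_le_one), sub_zero]
  have hd0 : dot (reflD D) 0 = dot D 1 := by
    rw [dot_reflD A.hD.2.1 (left_mem_Icc.2 zero_le_one), sub_zero]
  obtain ⟨e, hae, he, hC, hnd, h1, h2⟩ := (h.reflect A).sharp A.reflect (a := -a) (by simp [ha])
    (by simp [reflD, hD1]) (by rwa [A.cpr_reflect]) (by rwa [hf0])
  rw [hf0, hd0] at h1
  rw [hd0] at h2
  have hea : -e < a := by linarith
  refine ⟨-e, hea, ⟨hea, by linarith, h.isClassicalOn A (isOpen_Iio.sdiff isClosed_singleton)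
    fun ξ hξ => C1At.of_reflect (hC (-ξ) (neg_lt_neg hξ.1) fun hξe => hξ.2 ?_),
    fun hd => hnd (differentiableAt_reflect hd)⟩,
    fun hd => tendsto_deriv_right_of_reflect (h1 hd),
    fun hd => tendsto_deriv_right_of_reflect (h2 hd)⟩
  rw [mem_singleton_iff, ← hξe, neg_neg]

end Left

/-- A bound on `a + x` by a real number excludes `x = +∞`. -/
lemma lt_top_of_coe_add_lt {a c : ℝ} {x : EReal} (h : (a : EReal) + x < c) : x < ⊤ := by
  refine lt_top_iff_ne_top.2 fun hx => ?_
  rw [hx, EReal.coe_add_top] at h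
  exact absurd h not_top_lt

end Wavefront

theorem theorem2p1 (D f g : ℝ → ℝ) (α : ℝ)
    (hf : Wavefront.CondF f) (hg : Wavefront.CondG g) (hD : Wavefront.CondDpn D α)
    (hDg : Wavefront.CondDini D g) :
    -- the two semi-wavefront thresholds are well defined
    (∀ c : ℝ, c ∈ Wavefront.speedsTo0 D f g α ↔ Wavefront.cpr D f g α ≤ c) ∧
    (∀ c : ℝ, c ∈ Wavefront.speedsFrom1 D f g α ↔ Wavefront.cnl D f g α ≤ c) ∧
    -- existence exactly for the speeds above the threshold
    (∀ c : ℝ, (∃ φ : ℝ → ℝ, Wavefront.IsWavefront D f g c φ) ↔ Wavefront.cpn D f g α ≤ c) ∧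
    -- uniqueness up to shifts
    (∀ (c : ℝ) (φ₁ φ₂ : ℝ → ℝ), Wavefront.IsWavefront D f g c φ₁ →
      Wavefront.IsWavefront D f g c φ₂ → ∃ τ : ℝ, ∀ ξ, φ₂ ξ = φ₁ (ξ + τ)) ∧
    -- properties of the profiles
    (∀ (c : ℝ) (φ : ℝ → ℝ), Wavefront.IsWavefront D f g c φ →
      (∀ ξ, φ ξ ∈ Ioo (0 : ℝ) 1 \ {α} → deriv φ ξ < 0) ∧
      ∃ ξα : ℝ, (∀ ξ, φ ξ = α ↔ ξ = ξα) ∧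
        ((Wavefront.dot D α < 0 ∨ Wavefront.dot f α < c) →
          g α / Wavefront.sMinus D f g α c < 0 ∧
          Tendsto (deriv φ) (𝓝[<] ξα) (𝓝 (g α / Wavefront.sMinus D f g α c)) ∧
          Tendsto (deriv φ) (𝓝[>] ξα) (𝓝 (g α / Wavefront.sMinus D f g α c))) ∧
        ((Wavefront.dot D α = 0 ∧ c ≤ Wavefront.dot f α) →
          Tendsto (deriv φ) (𝓝[<] ξα) atBot ∧ Tendsto (deriv φ) (𝓝[>] ξα) atBot) ∧
        -- (i)
        (D 0 * D 1 < 0 → StrictAnti φ ∧ Wavefront.IsClassicalOn D f g c φ {ξα}ᶜ) ∧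
        -- (ii)
        (D 0 * D 1 = 0 → Wavefront.cpn D f g α < c →
          Wavefront.IsClassicalOn D f g c φ {ξα}ᶜ ∧
          (max ((Wavefront.dot f 0 : EReal) + Wavefront.diniUpperRight g 0)
              ((Wavefront.dot f 1 : EReal) + Wavefront.diniUpperLeft (fun s => -g s) 1) < (c : EReal) →
            StrictAnti φ)) ∧
        -- (iii), at the value 0
        (D 0 = 0 → c = Wavefront.cpn D f g α → c = Wavefront.cpr D f g α →
          Wavefront.dot f 0 < c →
          ∃ ξ₀ : ℝ, ξα < ξ₀ ∧ Wavefront.IsSharpAt D f g c φ (Ioi ξα) 0 ξ₀ ∧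
            (0 < Wavefront.dot D 0 →
              (Wavefront.dot f 0 - Wavefront.cpr D f g α) / Wavefront.dot D 0 < 0 ∧
              Tendsto (deriv φ) (𝓝[<] ξ₀)
                (𝓝 ((Wavefront.dot f 0 - Wavefront.cpr D f g α) / Wavefront.dot D 0))) ∧
            (Wavefront.dot D 0 = 0 → Tendsto (deriv φ) (𝓝[<] ξ₀) atBot)) ∧
        -- (iii), at the value 1
        (D 1 = 0 → c = Wavefront.cpn D f g α → c = Wavefront.cnl D f g α →
          Wavefront.dot f 1 < c →
          ∃ ξ₁ : ℝ, ξ₁ < ξα ∧ Wavefront.IsSharpAt D f g c φ (Iio ξα) 1 ξ₁ ∧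
            (0 < Wavefront.dot D 1 →
              (Wavefront.dot f 1 - Wavefront.cnl D f g α) / Wavefront.dot D 1 < 0 ∧
              Tendsto (deriv φ) (𝓝[>] ξ₁)
                (𝓝 ((Wavefront.dot f 1 - Wavefront.cnl D f g α) / Wavefront.dot D 1))) ∧
            (Wavefront.dot D 1 = 0 → Tendsto (deriv φ) (𝓝[>] ξ₁) atBot))) := by
  have A : Wavefront.Data D f g α := ⟨hf, hg, hD, hDg⟩
  refine ⟨fun c => A.mem_speedsTo0_iff.trans A.vanishAt_iff,
    fun c => A.mem_speedsFrom1_iff.trans A.vanishAt_reflect_iff, fun c => A.exists_wave_iff,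
    fun c φ₁ φ₂ h₁ h₂ => ?_, fun c φ h => ?_⟩
  · obtain ⟨Z₁, hZ₁⟩ := A.isWavefront_iff.1 h₁
    obtain ⟨Z₂, hZ₂⟩ := A.isWavefront_iff.1 h₂
    exact hZ₁.unique hZ₂ A
  obtain ⟨Z, h⟩ := A.isWavefront_iff.1 h
  obtain ⟨a, ha⟩ := h.exists_eq_α A
  refine ⟨fun ξ hξ => h.deriv_neg A hξ, a, h.eq_α_iff A ha, fun hc => ?_, fun hc => ?_,
    fun hD01 => ?_, fun _ hc => ?_, fun hD0 _ hc hfc => ?_, fun hD1 _ hc hfc => ?_⟩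
  · have hs := A.sMinus_neg hc
    exact ⟨div_neg_of_pos_of_neg A.gα hs, h.tendsto_deriv_left A ha hs,
      h.tendsto_deriv_right A ha hs⟩
  · have hs := A.sMinus_eq_zero hc.1 hc.2
    exact ⟨h.tendsto_deriv_left_atBot A ha hs, h.tendsto_deriv_right_atBot A ha hs⟩
  · have hD0 : 0 < D 0 := A.D0.lt_of_ne fun h0 => by simp [← h0] at hD01
    have hD1 : D 1 < 0 := neg_of_mul_neg_right hD01 hD0.le
    exact ⟨h.strictAnti A (h.pos A (Or.inl hD0)) (h.lt_one A (Or.inl hD1)),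
      h.isClassicalOn_compl A (fun _ => h.c1At A ha (Or.inl hD0))
        fun _ => h.c1At_left A ha (Or.inl hD1)⟩
  · obtain ⟨hr, hl⟩ := max_lt_iff.1 hc
    refine ⟨h.isClassicalOn_compl A (fun _ => h.c1At A ha (Or.inr hr))
      fun _ => h.c1At_left A ha (Or.inr hl), fun hmax => ?_⟩
    obtain ⟨h0, h1⟩ := max_lt_iff.1 hmax
    exact h.strictAnti A (h.pos A (Or.inr ⟨hr, Wavefront.lt_top_of_coe_add_lt h0⟩))
      (h.lt_one A (Or.inr ⟨hl, Wavefront.lt_top_of_coe_add_lt h1⟩))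
  · obtain ⟨e, hae, hsharp, h1, h2⟩ := h.isSharpAt_zero A ha hD0 hc hfc
    rw [← hc]
    exact ⟨e, hae, hsharp, fun hd => ⟨div_neg_of_neg_of_pos (sub_neg.2 hfc) hd, h1 hd⟩, h2⟩
  · obtain ⟨e, hea, hsharp, h1, h2⟩ := h.isSharpAt_one A ha hD1 hc hfc
    rw [← hc]
    exact ⟨e, hea, hsharp, fun hd => ⟨div_neg_of_neg_of_pos (sub_neg.2 hfc) hd, h1 hd⟩, h2⟩
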